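/- Let $\mathcal H=L^2(\mathbb R)$ be the Hilbert space of a single mode in the position representation, with number states $|n\rangle$ (the Hermite functions), coherent states $|z\rangle$, given for $z=\frac1{\sqrt2}(q+ip)$ by $\pi^{-1/4}e^{-iqp/2}e^{ipx}e^{-(x-q)^2/2}$, conjugation map $(C\psi)(x)=\overline{\psi(x)}$ and Weyl operators $W_{qp}=e^{iqp/2}e^{-iqP}e^{ipQ}$, i.e. $(W_{qp}\psi)(x)=e^{-iqp/2}e^{ipx}\psi(x-q)$. A state is a positive trace class operator of trace one; an observable is a normalized positive operator measure. Let $U$ be the unitary operator on $\mathcal H\otimes\mathcal H$ (50:50 beam splitter) with $$U\,|\alpha\rangle\otimes|\beta\rangle=|\tfrac1{\sqrt2}(\alpha-\beta)\rangle\otimes|\tfrac1{\sqrt2}(\alpha+\beta)\rangle,\qquad \alpha,\beta\in\mathbb C,$$ and let $U_{ij}$ denote $U$ acting on the modes $i$ and $j$ (in this order). Let $\epsilon_1,\epsilon_2,\epsilon_3,\epsilon_4\in(0,1]$ be the detector efficiencies. For $\epsilon\in(0,1]$ put $E^{\epsilon}_n=\sum_{m\ge n}\binom mn\epsilon^n(1-\epsilon)^{m-n}|m\rangle\langle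 m|$, and for $z\neq0$ and Borel $X\subseteq\mathbb R$ put $\mathsf E_{\epsilon_i,\epsilon_j}(X)=\sum E^{\epsilon_i}_m\otimes E^{\epsilon_j}_n$, the sum over all $m,n\in\mathbb N$ with $\frac1{\sqrt2|z|}\big(\frac n{\epsilon_j}-\frac m{\epsilon_i}\big)\in X$ (acting on the modes $i$ and $j$). For states $\rho$ (signal) and $S$ (parameter field), $z\ne 0$ and a phase shift $\phi$, let $$\sigma_{\rho,S,z,\phi}=U_{13}\otimes U_{24}\big(U_{12}(\rho\otimes S)U_{12}^*\otimes|z\rangle\langle z|\otimes|ze^{i\phi}\rangle\langle ze^{i\phi}|\big)U_{13}^*\otimes U_{24}^* ,$$ and let the signal observable $\mathsf E^{S,z,\phi}$ be the observable on $\mathcal B(\mathbb R^2)$ determined by $$\operatorname{tr}[\rho\,\mathsf E^{S,z,\phi}(X\times Y)]=\operatorname{tr}\big[\sigma_{\rho,S,z,\phi}\;\mathsf E_{\epsilon_1,\epsilon_3}(\tfrac1{\sqrt2}X)\otimes\mathsf E_{\epsilon_2,\epsilon_4}(\tfrac1{\sqrt2}Y)\big]$$ for all states $\rho$ and all Borel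 sets $X,Y\subseteq\mathbb R$. For $a,b\in(0,1]$ not both equal to $1$ let $\mu_{a,b}$ be the probability measure on $\mathbb R$ with density $x\mapsto\sqrt{\tfrac{2ab}{\pi(a-2ab+b)}}\,e^{-\frac{2ab}{a-2ab+b}x^2}$, and let $\mu_{1,1}$ be the Dirac measure at $0$. Let $\mu_\epsilon$ be the probability measure on $\mathbb R^2$ with $\mu_\epsilon(X\times Y)=\mu_{\epsilon_1,\epsilon_3}(\frac1{\sqrt2}X)\,\mu_{\epsilon_2,\epsilon_4}(\frac1{\sqrt2}Y)$. For a state $T$ let $\mathsf G^{T}(Z)=\frac1{2\pi}\int_Z W_{qp}TW_{qp}^*\,dq\,dp$ be the covariant phase space observable generated by $T$, and let $(\mu_\epsilon*\mathsf G^T)(Z)=\int\mu_\epsilon(Z-w)\,d\mathsf G^T(w)$ be its smearing; both integrals are weak integrals. **Proposition.** For every state $S$ and every sequence $(r_k)$ of positive numbers with $r_k\to\infty$, the observables $\mathsf E^{S,r_k,\pi/2}$, $\mathsf G^{CSC^{-1}}$ and $\mu_\epsilon*\mathsf G^{CSC^{-1}}$ exist and are uniquely determined by the above relations, and the sequence $(\mathsf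 E^{S,r_k,\frac\pi2})_{k\in\mathbb N}$ converges to $\mu_\epsilon*\mathsf G^{CSC^{-1}}$ weakly in the sense of probabilities: $\mathsf E^{S,r_k,\frac\pi2}(Z)\to(\mu_\epsilon*\mathsf G^{CSC^{-1}})(Z)$ in the weak operator topology for every Borel set $Z\subseteq\mathbb R^2$ with $(\mu_\epsilon*\mathsf G^{CSC^{-1}})(\partial Z)=0$. -/

import Mathlib

open MeasureTheory Set Filter Topology
open scoped TensorProduct ENNReal InnerProductSpace Pointwise

noncomputable section

namespace Homodyne

/-! ## Trace, states -/

section HilbertSpace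

variable {K : Type*} [NormedAddCommGroup K] [InnerProductSpace ℂ K] [CompleteSpace K]

/-- The trace `∑ i, ⟪b i, A (b i)⟫` of an operator, computed in some Hilbert basis `b`. For trace
class operators it is finite and independent of the basis. -/
def trace (A : K →L[ℂ] K) : ℂ :=
  let b := (exists_hilbertBasis ℂ K).choose_spec.choose
  ∑' i, ⟪b i, A (b i)⟫_ℂ

/-- States (density operators): positive operators of trace one. A positive operator whose diagonal
series does not converge gets the default trace `0`, so this forces `ρ` to be trace class. -/
def IsState (ρ : K →L[ℂ] K) : Prop := ρ.IsPositive ∧ trace ρ = 1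

end HilbertSpace

/-! ## The Hilbert space tensor product -/

section Tensor

variable {K₁ K₂ L₁ L₂ : Type*}
  [NormedAddCommGroup K₁] [InnerProductSpace ℂ K₁] [NormedAddCommGroup K₂] [InnerProductSpace ℂ K₂]
  [NormedAddCommGroup L₁] [InnerProductSpace ℂ L₁] [NormedAddCommGroup L₂] [InnerProductSpace ℂ L₂]

/-- The Hilbert space tensor product: completion of the algebraic tensor product. -/
abbrev HTensor (K₁ K₂ : Type*) [NormedAddCommGroup K₁] [InnerProductSpace ℂ K₁]
    [NormedAddCommGroup K₂] [InnerProductSpace ℂ K₂] : Type _ :=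
  UniformSpace.Completion (K₁ ⊗[ℂ] K₂)

/-- The simple tensor `φ ⊗ ψ`. -/
def htmul (φ : K₁) (ψ : K₂) : HTensor K₁ K₂ := ((φ ⊗ₜ[ℂ] ψ : K₁ ⊗[ℂ] K₂) : HTensor K₁ K₂)

/-- The tensor product `A ⊗ B` of bounded operators, i.e. the bounded extension of
`φ ⊗ ψ ↦ A φ ⊗ B ψ`. -/
def opTensor (A : K₁ →L[ℂ] L₁) (B : K₂ →L[ℂ] L₂) : HTensor K₁ K₂ →L[ℂ] HTensor L₁ L₂ :=
  (UniformSpace.Completion.toComplL ∘L TensorProduct.mapL A B).extend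
    (UniformSpace.Completion.toComplL (𝕜 := ℂ))

theorem denseRange_toComplL {E : Type*} [NormedAddCommGroup E] [NormedSpace ℂ E] :
    DenseRange (UniformSpace.Completion.toComplL : E →L[ℂ] UniformSpace.Completion E) :=
  UniformSpace.Completion.denseRange_coe

theorem isUniformInducing_toComplL {E : Type*} [NormedAddCommGroup E] [NormedSpace ℂ E] :
    IsUniformInducing (UniformSpace.Completion.toComplL : E →L[ℂ] UniformSpace.Completion E) :=
  UniformSpace.Completion.isUniformInducing_coe E

theorem opTensor_htmul (A : K₁ →L[ℂ] L₁) (B : K₂ →L[ℂ] L₂) (φ : K₁) (ψ : K₂) :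
    opTensor A B (htmul φ ψ) = htmul (A φ) (B ψ) :=
  ContinuousLinearMap.extend_eq _ denseRange_toComplL isUniformInducing_toComplL (φ ⊗ₜ[ℂ] ψ)

/-- The operator `φ ↦ φ ⊗ ψ`, an isometry when `ψ` is a unit vector. -/
def tensorRight (K₁ : Type*) [NormedAddCommGroup K₁] [InnerProductSpace ℂ K₁] (ψ : K₂) :
    K₁ →L[ℂ] HTensor K₁ K₂ :=
  UniformSpace.Completion.toComplL ∘L (TensorProduct.mkL ℂ K₁ K₂).flip ψ

theorem tensorRight_apply (φ : K₁) (ψ : K₂) : tensorRight K₁ ψ φ = htmul φ ψ := rfl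

end Tensor

/-! ## A single mode, in the position representation -/

/-- The Hilbert space of a single mode, in the position representation. -/
abbrev Mode : Type := Lp ℂ 2 (volume : Measure ℝ)

/-- The wave function of the number state `|n⟩`: the `n`-th Hermite function
`(n! √π)^(-1/2) He_n(√2 x) exp(-x²/2)`, with `He_n` the probabilists' Hermite polynomial
(so `He_n(√2 x) = 2^(-n/2) H_n(x)` for the physicists' one). -/
def hermiteFun (n : ℕ) (x : ℝ) : ℂ :=
  (((Real.sqrt (n.factorial * Real.sqrt Real.pi))⁻¹ *
    Polynomial.aeval (Real.sqrt 2 * x) (Polynomial.hermite n) * Real.exp (-x ^ 2 / 2) : ℝ) : ℂ)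

/-- The wave function of the coherent state `|z⟩`, `z = (q + i p) / √2`:
`π^(-1/4) exp(-i q p / 2) exp(i p x) exp(-(x - q)² / 2)`. -/
def coherentFun (z : ℂ) (x : ℝ) : ℂ :=
  let q : ℝ := Real.sqrt 2 * z.re
  let p : ℝ := Real.sqrt 2 * z.im
  ((Real.pi ^ (-(1 / 4) : ℝ) : ℝ) : ℂ) * Complex.exp (-Complex.I * q * p / 2) *
    Complex.exp (Complex.I * p * x) * Complex.exp (-((x : ℂ) - q) ^ 2 / 2)

theorem memLp_pow_mul_gaussian (k : ℕ) :
    MemLp (fun x : ℝ => x ^ k * Real.exp (-x ^ 2 / 2)) 2 (volume : Measure ℝ) := by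
  rw [memLp_two_iff_integrable_sq (Continuous.aestronglyMeasurable (by fun_prop))]
  have h := integrable_rpow_mul_exp_neg_mul_sq (b := 1) one_pos (s := ((2 * k : ℕ) : ℝ))
    (by have : (0 : ℝ) ≤ ((2 * k : ℕ) : ℝ) := Nat.cast_nonneg _
        linarith)
  refine h.congr (.of_forall fun x => ?_)
  simp only [Real.rpow_natCast, mul_pow, ← pow_mul, ← Real.exp_nat_mul]
  congr 2
  · ring
  · push_cast; ring

theorem memLp_hermiteFun (n : ℕ) : MemLp (hermiteFun n) 2 (volume : Measure ℝ) := by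
  refine MemLp.ofReal (K := ℂ) (f := fun x : ℝ => (Real.sqrt (n.factorial * Real.sqrt Real.pi))⁻¹ *
    Polynomial.aeval (Real.sqrt 2 * x) (Polynomial.hermite n) * Real.exp (-x ^ 2 / 2)) ?_
  have h : MemLp (fun x : ℝ => ∑ k ∈ Finset.range ((Polynomial.hermite n).natDegree + 1),
      ((Real.sqrt (n.factorial * Real.sqrt Real.pi))⁻¹ * ((Polynomial.hermite n).coeff k : ℝ) *
        Real.sqrt 2 ^ k) * (x ^ k * Real.exp (-x ^ 2 / 2))) 2 (volume : Measure ℝ) :=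
    memLp_finsetSum _ fun k _ => (memLp_pow_mul_gaussian k).const_mul _
  refine h.ae_eq (.of_forall fun x => ?_)
  simp only [Polynomial.aeval_eq_sum_range, Finset.mul_sum, Finset.sum_mul, zsmul_eq_mul, mul_pow]
  exact Finset.sum_congr rfl fun k _ => by ring

theorem memLp_coherentFun (z : ℂ) : MemLp (coherentFun z) 2 (volume : Measure ℝ) := by
  have hm : AEStronglyMeasurable (coherentFun z) (volume : Measure ℝ) := by
    unfold coherentFun
    exact Continuous.aestronglyMeasurable (by fun_prop)
  have h := ((memLp_pow_mul_gaussian 0).comp_measurePreserving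
    (measurePreserving_sub_right volume (Real.sqrt 2 * z.re))).const_mul
      (Real.pi ^ (-(1 / 4) : ℝ))
  refine h.of_le hm (.of_forall fun x => le_of_eq ?_)
  have h2 : -((x : ℂ) - (Real.sqrt 2 * z.re : ℝ)) ^ 2 / 2
      = ((-(x - Real.sqrt 2 * z.re) ^ 2 / 2 : ℝ) : ℂ) := by push_cast; ring
  simp only [coherentFun, norm_mul, h2, ← Complex.ofReal_exp, Complex.norm_real, Function.comp]
  simp [Complex.norm_exp]

/-- The number state `|n⟩`. -/
def numberState (n : ℕ) : Mode := (memLp_hermiteFun n).toLp (hermiteFun n)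

/-- The coherent state `|z⟩`. -/
def coherentState (z : ℂ) : Mode := (memLp_coherentFun z).toLp (coherentFun z)

/-- The conjugation map `ψ ↦ (x ↦ conj (ψ x))`. -/
def conjugation : Mode ≃ₗᵢ⋆[ℂ] Mode where
  toFun ψ := star ψ
  invFun ψ := star ψ
  map_add' φ ψ := by
    apply Lp.ext
    filter_upwards [Lp.coeFn_star (φ + ψ), Lp.coeFn_add φ ψ, Lp.coeFn_add (star φ) (star ψ),
      Lp.coeFn_star φ, Lp.coeFn_star ψ] with x h1 h2 h3 h4 h5
    rw [h1, Pi.star_apply, h2, h3, Pi.add_apply, Pi.add_apply, h4, h5, Pi.star_apply, Pi.star_apply,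
      star_add]
  map_smul' c ψ := by
    apply Lp.ext
    filter_upwards [Lp.coeFn_star (c • ψ), Lp.coeFn_smul c ψ, Lp.coeFn_star ψ,
      Lp.coeFn_smul ((starRingEnd ℂ) c) (star ψ)] with x h1 h2 h3 h4
    simp [h1, h2, h3, h4]
  left_inv ψ := star_star ψ
  right_inv ψ := star_star ψ
  norm_map' ψ := by
    apply le_antisymm <;> apply Lp.norm_le_norm_of_ae_le <;>
    · filter_upwards [Lp.coeFn_star ψ] with x h1
      simp [h1]

/-- The operator `C S C⁻¹`, with `C` the conjugation map. -/
def conjOp (S : Mode →L[ℂ] Mode) : Mode →L[ℂ] Mode :=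
  (conjugation.toContinuousLinearEquiv : Mode →L⋆[ℂ] Mode).comp
    (S.comp (conjugation.symm.toContinuousLinearEquiv : Mode →L⋆[ℂ] Mode))

/-- The unitary `e^{-iqP}`, i.e. the translation `(e^{-iqP} ψ)(x) = ψ (x - q)`. -/
def translation (q : ℝ) : Mode →L[ℂ] Mode :=
  (Lp.compMeasurePreservingₗᵢ ℂ (fun x : ℝ => x - q)
    (measurePreserving_sub_right volume q)).toContinuousLinearMap

theorem memLp_modulation (p : ℝ) (ψ : Mode) :
    MemLp (fun x : ℝ => Complex.exp (Complex.I * p * x) * ψ x) 2 (volume : Measure ℝ) := by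
  refine MemLp.of_le (Lp.memLp ψ) (AEStronglyMeasurable.mul
    (Continuous.aestronglyMeasurable (by fun_prop)) (Lp.aestronglyMeasurable ψ)) (.of_forall ?_)
  intro x
  simp [Complex.norm_exp]

/-- The unitary `e^{ipQ}`, i.e. the multiplication `(e^{ipQ} ψ)(x) = e^{ipx} ψ x`. -/
def modulation (p : ℝ) : Mode →L[ℂ] Mode :=
  LinearMap.mkContinuous
    { toFun := fun ψ => (memLp_modulation p ψ).toLp _
      map_add' := fun φ ψ => by
        apply Lp.ext
        filter_upwards [(memLp_modulation p (φ + ψ)).coeFn_toLp, (memLp_modulation p φ).coeFn_toLp,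
          (memLp_modulation p ψ).coeFn_toLp, Lp.coeFn_add φ ψ,
          Lp.coeFn_add ((memLp_modulation p φ).toLp _) ((memLp_modulation p ψ).toLp _)]
          with x h1 h2 h3 h4 h5
        rw [h1, h5, Pi.add_apply, h2, h3, h4, Pi.add_apply, mul_add]
      map_smul' := fun c ψ => by
        apply Lp.ext
        filter_upwards [(memLp_modulation p (c • ψ)).coeFn_toLp, (memLp_modulation p ψ).coeFn_toLp,
          Lp.coeFn_smul c ψ, Lp.coeFn_smul c ((memLp_modulation p ψ).toLp _)] with x h1 h2 h3 h4
        rw [h1, RingHom.id_apply, h4, Pi.smul_apply, h2, h3, Pi.smul_apply, smul_eq_mul,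
          smul_eq_mul, mul_left_comm] }
    1 (fun ψ => by
      rw [one_mul]
      apply Lp.norm_le_norm_of_ae_le
      filter_upwards [(memLp_modulation p ψ).coeFn_toLp] with x h1
      rw [LinearMap.coe_mk, AddHom.coe_mk, h1]
      simp [Complex.norm_exp])

/-- The Weyl operator `W_{qp} = e^{iqp/2} e^{-iqP} e^{ipQ}`, that is,
`(W_{qp} ψ)(x) = e^{-iqp/2} e^{ipx} ψ (x - q)`. -/
def weyl (q p : ℝ) : Mode →L[ℂ] Mode :=
  Complex.exp (Complex.I * q * p / 2) • (translation q ∘L modulation p)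

/-! ## The beam splitter -/

/-- The function `(x, y) ↦ φ x * ψ y` is square integrable. -/
theorem memLp_prodFun (φ ψ : Mode) :
    MemLp (fun w : ℝ × ℝ => φ w.1 * ψ w.2) 2 (volume : Measure (ℝ × ℝ)) := by
  have hm : AEStronglyMeasurable (fun w : ℝ × ℝ => φ w.1 * ψ w.2) (volume : Measure (ℝ × ℝ)) :=
    (Lp.aestronglyMeasurable φ).comp_fst.mul (Lp.aestronglyMeasurable ψ).comp_snd
  rw [memLp_two_iff_integrable_sq_norm hm]
  have h := (((memLp_two_iff_integrable_sq_norm (Lp.aestronglyMeasurable φ)).1 (Lp.memLp φ)).mul_prod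
    ((memLp_two_iff_integrable_sq_norm (Lp.aestronglyMeasurable ψ)).1 (Lp.memLp ψ)))
  refine h.congr (.of_forall fun w => ?_)
  simp [mul_pow]

/-- The element `(x, y) ↦ φ x * ψ y` of `L²(ℝ²)`. -/
def prodFun (φ ψ : Mode) : Lp ℂ 2 (volume : Measure (ℝ × ℝ)) := (memLp_prodFun φ ψ).toLp _

theorem coeFn_prodFun (φ ψ : Mode) : prodFun φ ψ =ᵐ[volume] fun w : ℝ × ℝ => φ w.1 * ψ w.2 :=
  MemLp.coeFn_toLp _

theorem ae_fst {f g : ℝ → ℂ} (h : f =ᵐ[volume] g) :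
    (fun w : ℝ × ℝ => f w.1) =ᵐ[volume] fun w : ℝ × ℝ => g w.1 :=
  Measure.quasiMeasurePreserving_fst.ae_eq_comp h

theorem ae_snd {f g : ℝ → ℂ} (h : f =ᵐ[volume] g) :
    (fun w : ℝ × ℝ => f w.2) =ᵐ[volume] fun w : ℝ × ℝ => g w.2 :=
  Measure.quasiMeasurePreserving_snd.ae_eq_comp h

theorem inner_prodFun (φ ψ φ' ψ' : Mode) :
    ⟪prodFun φ ψ, prodFun φ' ψ'⟫_ℂ = ⟪φ, φ'⟫_ℂ * ⟪ψ, ψ'⟫_ℂ := by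
  rw [L2.inner_def, L2.inner_def, L2.inner_def, ← integral_prod_mul]
  refine integral_congr_ae ?_
  filter_upwards [coeFn_prodFun φ ψ, coeFn_prodFun φ' ψ'] with w h1 h2
  rw [h1, h2]
  simp only [RCLike.inner_apply, map_mul]
  ring

/-- The map `φ ⊗ ψ ↦ ((x, y) ↦ φ x * ψ y)` on the algebraic tensor product. -/
def prodFunₗ : Mode ⊗[ℂ] Mode →ₗ[ℂ] Lp ℂ 2 (volume : Measure (ℝ × ℝ)) :=
  TensorProduct.lift <| LinearMap.mk₂ ℂ prodFun
    (fun φ φ' ψ => by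
      apply Lp.ext
      filter_upwards [coeFn_prodFun (φ + φ') ψ, coeFn_prodFun φ ψ, coeFn_prodFun φ' ψ,
        ae_fst (Lp.coeFn_add φ φ'), Lp.coeFn_add (prodFun φ ψ) (prodFun φ' ψ)] with w h1 h2 h3 h4 h5
      rw [h1, h5, Pi.add_apply, h2, h3, h4, Pi.add_apply, add_mul])
    (fun c φ ψ => by
      apply Lp.ext
      filter_upwards [coeFn_prodFun (c • φ) ψ, coeFn_prodFun φ ψ,
        ae_fst (Lp.coeFn_smul c φ), Lp.coeFn_smul c (prodFun φ ψ)] with w h1 h2 h3 h4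
      rw [h1, h4, Pi.smul_apply, h2, h3, Pi.smul_apply, smul_eq_mul, smul_eq_mul, mul_assoc])
    (fun φ ψ ψ' => by
      apply Lp.ext
      filter_upwards [coeFn_prodFun φ (ψ + ψ'), coeFn_prodFun φ ψ, coeFn_prodFun φ ψ',
        ae_snd (Lp.coeFn_add ψ ψ'), Lp.coeFn_add (prodFun φ ψ) (prodFun φ ψ')] with w h1 h2 h3 h4 h5
      rw [h1, h5, Pi.add_apply, h2, h3, h4, Pi.add_apply, mul_add])
    (fun c φ ψ => by
      apply Lp.ext
      filter_upwards [coeFn_prodFun φ (c • ψ), coeFn_prodFun φ ψ,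
        ae_snd (Lp.coeFn_smul c ψ), Lp.coeFn_smul c (prodFun φ ψ)] with w h1 h2 h3 h4
      rw [h1, h4, Pi.smul_apply, h2, h3, Pi.smul_apply, smul_eq_mul, smul_eq_mul, mul_left_comm])

theorem prodFunₗ_tmul (φ ψ : Mode) : prodFunₗ (φ ⊗ₜ ψ) = prodFun φ ψ := rfl

theorem inner_prodFunₗ (s t : Mode ⊗[ℂ] Mode) : ⟪prodFunₗ s, prodFunₗ t⟫_ℂ = ⟪s, t⟫_ℂ := by
  induction s using TensorProduct.induction_on with
  | zero => simp
  | add a b ha hb => rw [map_add, inner_add_left, inner_add_left, ha, hb]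
  | tmul a b =>
    induction t using TensorProduct.induction_on with
    | zero => simp
    | add c d hc hd => rw [map_add, inner_add_right, inner_add_right, hc, hd]
    | tmul c d => rw [prodFunₗ_tmul, prodFunₗ_tmul, inner_prodFun, TensorProduct.inner_tmul]

/-- The functions `(x, y) ↦ φ x * ψ y` span a dense subspace of `L²(ℝ²)`. -/
theorem denseRange_prodFunₗ : DenseRange prodFunₗ := by
  have key : (LinearMap.range prodFunₗ).topologicalClosure = ⊤ := by
    rw [Submodule.topologicalClosure_eq_top_iff, Submodule.eq_bot_iff]
    intro f hf
    rw [Submodule.mem_orthogonal] at hf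
    have hrect : ∀ A B : Set ℝ, MeasurableSet A → MeasurableSet B → volume A ≠ ∞ → volume B ≠ ∞ →
        ∫ w in A ×ˢ B, f w = 0 := by
      intro A B hA hB hA' hB'
      have h := hf _ ⟨indicatorConstLp 2 hA hA' (1 : ℂ) ⊗ₜ indicatorConstLp 2 hB hB' (1 : ℂ), rfl⟩
      rw [prodFunₗ_tmul, L2.inner_def] at h
      rw [← h, ← integral_indicator (hA.prod hB)]
      refine integral_congr_ae ?_
      filter_upwards [coeFn_prodFun (indicatorConstLp 2 hA hA' (1 : ℂ))
        (indicatorConstLp 2 hB hB' (1 : ℂ)),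
        ae_fst (indicatorConstLp_coeFn (p := 2) (hs := hA) (hμs := hA') (c := (1 : ℂ))),
        ae_snd (indicatorConstLp_coeFn (p := 2) (hs := hB) (hμs := hB') (c := (1 : ℂ)))]
        with w h1 h2 h3
      rw [h1, h2, h3]
      by_cases ha : w.1 ∈ A <;> by_cases hb : w.2 ∈ B <;>
        simp [ha, hb, Set.indicator, Set.mem_prod]
    let I : ℕ → Set ℝ := fun n => Icc (-(n : ℝ)) n
    have hI : ∀ n, volume (I n) ≠ ∞ := fun n => by simp [I]
    have hbox : ∀ n, ∀ᵐ w ∂(volume.restrict (I n ×ˢ I n)), f w = 0 := by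
      intro n
      have hfin : volume (I n ×ˢ I n) < ∞ := by
        rw [Measure.volume_eq_prod, Measure.prod_prod]
        exact ENNReal.mul_lt_top (hI n).lt_top (hI n).lt_top
      have : IsFiniteMeasure ((volume : Measure (ℝ × ℝ)).restrict (I n ×ˢ I n)) :=
        ⟨by rwa [Measure.restrict_apply_univ]⟩
      have hint : Integrable f (volume.restrict (I n ×ˢ I n)) :=
        ((Lp.memLp f).restrict _).integrable (by norm_num)
      have hz : (volume.restrict (I n ×ˢ I n)).withDensityᵥ f =
          (volume.restrict (I n ×ˢ I n)).withDensityᵥ (0 : ℝ × ℝ → ℂ) := by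
        have hr : ∀ A B : Set ℝ, MeasurableSet A → MeasurableSet B →
            (volume.restrict (I n ×ˢ I n)).withDensityᵥ f (A ×ˢ B) =
            (volume.restrict (I n ×ˢ I n)).withDensityᵥ (0 : ℝ × ℝ → ℂ) (A ×ˢ B) := by
          intro A B hA hB
          rw [withDensityᵥ_apply hint (hA.prod hB), withDensityᵥ_zero,
            Measure.restrict_restrict (hA.prod hB), Set.prod_inter_prod,
            hrect _ _ (hA.inter measurableSet_Icc) (hB.inter measurableSet_Icc)
              (measure_ne_top_of_subset inter_subset_right (hI n))
              (measure_ne_top_of_subset inter_subset_right (hI n))]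
          rfl
        refine VectorMeasure.ext_of_generateFrom _ ?_ generateFrom_prod.symm isPiSystem_prod ?_
        · rintro - ⟨A, hA, B, hB, rfl⟩
          exact hr A B hA hB
        · rw [← univ_prod_univ]
          exact hr _ _ MeasurableSet.univ MeasurableSet.univ
      exact hint.ae_eq_of_withDensityᵥ_eq (integrable_zero _ _ _) hz
    have hcov : (⋃ n, I n ×ˢ I n) = (univ : Set (ℝ × ℝ)) := by
      refine eq_univ_of_forall fun w => mem_iUnion.2 ?_
      obtain ⟨n, hn⟩ := exists_nat_ge (max |w.1| |w.2|)
      exact ⟨n, abs_le.1 ((le_max_left _ _).trans hn), abs_le.1 ((le_max_right _ _).trans hn)⟩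
    have hall := (ae_restrict_iUnion_iff (fun n => I n ×ˢ I n) (fun w => f w = 0)).2 hbox
    rw [hcov, Measure.restrict_univ] at hall
    exact (Lp.eq_zero_iff_ae_eq_zero).2 hall
  have := Submodule.dense_iff_topologicalClosure_eq_top.2 key
  rwa [LinearMap.coe_range] at this

/-- The canonical extension of `prodFunₗ` to the completed tensor product. -/
def prodFunL : HTensor Mode Mode →L[ℂ] Lp ℂ 2 (volume : Measure (ℝ × ℝ)) :=
  (prodFunₗ.isometryOfInner inner_prodFunₗ).toContinuousLinearMap.extend
    (UniformSpace.Completion.toComplL (𝕜 := ℂ))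

theorem prodFunL_coe (s : Mode ⊗[ℂ] Mode) : prodFunL (s : HTensor Mode Mode) = prodFunₗ s :=
  ContinuousLinearMap.extend_eq _ denseRange_toComplL isUniformInducing_toComplL s

theorem norm_prodFunL (t : HTensor Mode Mode) : ‖prodFunL t‖ = ‖t‖ := by
  induction t using UniformSpace.Completion.induction_on with
  | hp => exact isClosed_eq (by fun_prop) (by fun_prop)
  | ih s =>
    rw [prodFunL_coe, UniformSpace.Completion.norm_coe]
    exact (prodFunₗ.isometryOfInner inner_prodFunₗ).norm_map s

theorem surjective_prodFunL : Function.Surjective prodFunL := by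
  have hiso : Isometry prodFunL := AddMonoidHomClass.isometry_of_norm _ norm_prodFunL
  have hd : DenseRange prodFunL := by
    refine denseRange_prodFunₗ.mono ?_
    rintro - ⟨s, rfl⟩
    exact ⟨s, prodFunL_coe s⟩
  rw [← Set.range_eq_univ, ← hd.closure_range,
    hiso.isClosedEmbedding.isClosed_range.closure_eq]

/-- The canonical unitary `L²(ℝ) ⊗ L²(ℝ) ≃ L²(ℝ²)`, sending `φ ⊗ ψ` to `(x, y) ↦ φ x * ψ y`. -/
def prodEquiv : HTensor Mode Mode ≃ₗᵢ[ℂ] Lp ℂ 2 (volume : Measure (ℝ × ℝ)) :=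
  LinearIsometryEquiv.ofSurjective ⟨prodFunL.toLinearMap, norm_prodFunL⟩ surjective_prodFunL

theorem prodEquiv_htmul (φ ψ : Mode) : prodEquiv (htmul φ ψ) = prodFun φ ψ :=
  prodFunL_coe (φ ⊗ₜ ψ)

theorem measurePreserving_linear {a b c d : ℝ} (h : a * d - b * c = 1) :
    MeasurePreserving (fun w : ℝ × ℝ => (a * w.1 + b * w.2, c * w.1 + d * w.2)) := by
  have hdet : LinearMap.det (Matrix.toLin (Module.Basis.finTwoProd ℝ) (Module.Basis.finTwoProd ℝ)
      !![a, b; c, d]) = 1 := by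
    rw [LinearMap.det_toLin, Matrix.det_fin_two_of, h]
  have hf : (fun w : ℝ × ℝ => (a * w.1 + b * w.2, c * w.1 + d * w.2)) =
      Matrix.toLin (Module.Basis.finTwoProd ℝ) (Module.Basis.finTwoProd ℝ) !![a, b; c, d] := by
    ext w <;> rw [Matrix.toLin_finTwoProd_apply]
  refine ⟨by fun_prop, ?_⟩
  rw [hf, Measure.map_linearMap_addHaar_eq_smul_addHaar volume (by rw [hdet]; exact one_ne_zero),
    hdet]
  simp

theorem sqrt_half_identity :
    (Real.sqrt 2)⁻¹ * (Real.sqrt 2)⁻¹ - (Real.sqrt 2)⁻¹ * -(Real.sqrt 2)⁻¹ = 1 := by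
  have h : (Real.sqrt 2)⁻¹ * (Real.sqrt 2)⁻¹ = 1 / 2 := by
    rw [← mul_inv, Real.mul_self_sqrt (by norm_num)]; norm_num
  linarith

theorem sqrt_half_identity' :
    (Real.sqrt 2)⁻¹ * (Real.sqrt 2)⁻¹ - -(Real.sqrt 2)⁻¹ * (Real.sqrt 2)⁻¹ = 1 := by
  have := sqrt_half_identity
  linarith

theorem compMeasurePreserving_cancel {S T : ℝ × ℝ → ℝ × ℝ} (hS : MeasurePreserving S)
    (hT : MeasurePreserving T) (h : T ∘ S = id) (f : Lp ℂ 2 (volume : Measure (ℝ × ℝ))) :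
    Lp.compMeasurePreserving S hS (Lp.compMeasurePreserving T hT f) = f := by
  apply Lp.ext
  filter_upwards [Lp.coeFn_compMeasurePreserving (Lp.compMeasurePreserving T hT f) hS,
    hS.quasiMeasurePreserving.ae_eq_comp (Lp.coeFn_compMeasurePreserving f hT)] with w h1 h2
  rw [h1, h2, Function.comp_assoc, h, Function.comp_id]

/-- The rotation `f ↦ ((x, y) ↦ f ((x + y) / √2, (y - x) / √2))` of `L²(ℝ²)`. -/
def rotation : Lp ℂ 2 (volume : Measure (ℝ × ℝ)) ≃ₗᵢ[ℂ] Lp ℂ 2 (volume : Measure (ℝ × ℝ)) where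
  toLinearEquiv := LinearEquiv.ofLinearMap
    (Lp.compMeasurePreservingₗ ℂ _ (measurePreserving_linear sqrt_half_identity))
    (Lp.compMeasurePreservingₗ ℂ _ (measurePreserving_linear sqrt_half_identity'))
    (LinearMap.ext fun f => compMeasurePreserving_cancel _ _ (by
      ext w <;> simp only [Function.comp, id]
      · linear_combination (w.1 * sqrt_half_identity)
      · linear_combination (w.2 * sqrt_half_identity)) f)
    (LinearMap.ext fun f => compMeasurePreserving_cancel _ _ (by
      ext w <;> simp only [Function.comp, id]
      · linear_combination (w.1 * sqrt_half_identity)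
      · linear_combination (w.2 * sqrt_half_identity)) f)
  norm_map' f := Lp.norm_compMeasurePreserving f (measurePreserving_linear sqrt_half_identity)

/-- The lossless `50:50` beam splitter: the unitary operator of `L²(ℝ) ⊗ L²(ℝ) ≃ L²(ℝ²)` given by
the rotation above. By `beamSplitter_coherentState` it maps `|α⟩ ⊗ |β⟩` to
`|(α - β) / √2⟩ ⊗ |(α + β) / √2⟩`. -/
def beamSplitter : HTensor Mode Mode ≃ₗᵢ[ℂ] HTensor Mode Mode :=
  prodEquiv.trans (rotation.trans prodEquiv.symm)

theorem beamSplitter_coherentState (α β : ℂ) :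
    beamSplitter (htmul (coherentState α) (coherentState β)) =
      htmul (coherentState ((α - β) / Real.sqrt 2)) (coherentState ((α + β) / Real.sqrt 2)) := by
  have hU : ∀ t, prodEquiv (beamSplitter t) = rotation (prodEquiv t) := fun t => by
    simp [beamSplitter]
  apply prodEquiv.injective
  rw [hU, prodEquiv_htmul, prodEquiv_htmul]
  apply Lp.ext
  have hs := measurePreserving_linear sqrt_half_identity
  have e (z : ℂ) : coherentState z =ᵐ[volume] coherentFun z := MemLp.coeFn_toLp _
  have h0 : prodFun (coherentState α) (coherentState β) =ᵐ[volume]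
      fun w : ℝ × ℝ => coherentFun α w.1 * coherentFun β w.2 :=
    (coeFn_prodFun _ _).trans ((ae_fst (e α)).mul (ae_snd (e β)))
  filter_upwards [Lp.coeFn_compMeasurePreserving (prodFun (coherentState α) (coherentState β)) hs,
    hs.quasiMeasurePreserving.ae_eq_comp h0,
    coeFn_prodFun (coherentState ((α - β) / Real.sqrt 2)) (coherentState ((α + β) / Real.sqrt 2)),
    ae_fst (e ((α - β) / Real.sqrt 2)), ae_snd (e ((α + β) / Real.sqrt 2))] with w h1 h2 h3 h4 h5
  rw [h3, h4, h5]
  refine (h1.trans h2).trans ?_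
  simp only [Function.comp, coherentFun]
  have hr : ∀ z : ℂ, (z / Real.sqrt 2).re = z.re / Real.sqrt 2 := fun z => Complex.div_ofReal_re _ _
  have hi : ∀ z : ℂ, (z / Real.sqrt 2).im = z.im / Real.sqrt 2 := fun z => Complex.div_ofReal_im _ _
  rw [hr, hi, hr, hi]
  have hcancel : ∀ t : ℝ, Real.sqrt 2 * (t / Real.sqrt 2) = t := fun t => by field_simp
  have hinv : (Real.sqrt 2)⁻¹ = Real.sqrt 2 / 2 := by
    rw [inv_eq_one_div, div_eq_div_iff (by simp) (by norm_num), one_mul,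
      Real.mul_self_sqrt (by norm_num)]
  have hq : (Real.sqrt 2 : ℂ) ^ 2 = 2 := by
    rw [← Complex.ofReal_pow, Real.sq_sqrt (by norm_num)]; norm_num
  have hexp : ∀ a b x₁ x₂ x₃ x₄ x₅ x₆ : ℂ,
      a * Complex.exp x₁ * Complex.exp x₂ * Complex.exp x₃ *
        (b * Complex.exp x₄ * Complex.exp x₅ * Complex.exp x₆) =
      a * b * Complex.exp (x₁ + x₂ + x₃ + x₄ + x₅ + x₆) := fun a b x₁ x₂ x₃ x₄ x₅ x₆ => by
    simp only [Complex.exp_add]; ring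
  rw [hexp, hexp, hcancel, hcancel, hcancel, hcancel, hinv]
  congr 2
  push_cast
  simp only [Complex.sub_re, Complex.sub_im, Complex.add_re, Complex.add_im, Complex.ofReal_add,
    Complex.ofReal_sub]
  linear_combination (-Complex.I * α.re * α.im / 2 + Complex.I * α.im * (w.1 + w.2) / 2
    - ((w.1 + w.2) / 2 - α.re) ^ 2 / 2 - Complex.I * β.re * β.im / 2
    + Complex.I * β.im * (w.2 - w.1) / 2 - ((w.2 - w.1) / 2 - β.re) ^ 2 / 2) * hq

/-! ## Observables -/

/-- Observables of the mode with values in `Ω`: normalized positive operator measures, i.e.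
operator valued set functions on the measurable sets that are positive, weakly σ-additive and take
the value `1` on `Ω`. -/
@[ext]
structure Observable (Ω : Type*) [MeasurableSpace Ω] where
  /-- the underlying measure, σ-additive in the weak operator topology -/
  toVectorMeasure : VectorMeasure Ω (Mode →WOT[ℂ] Mode)
  isPositive : ∀ X, (toVectorMeasure X).toCLM.IsPositive
  apply_univ : (toVectorMeasure univ).toCLM = ContinuousLinearMap.id ℂ Mode

namespace Observable

variable {Ω : Type*} [MeasurableSpace Ω]

/-- The operator (effect) `E(X)`. -/
def effect (E : Observable Ω) (X : Set Ω) : Mode →L[ℂ] Mode := (E.toVectorMeasure X).toCLM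

theorem hasSum_effect (E : Observable Ω) (φ : Mode) {X : ℕ → Set Ω}
    (hX : ∀ i, MeasurableSet (X i)) (hd : Pairwise (Function.onFun Disjoint X)) :
    HasSum (fun i => (⟪φ, E.effect (X i) φ⟫_ℂ).re) (⟪φ, E.effect (⋃ i, X i) φ⟫_ℂ).re := by
  have h := (E.toVectorMeasure.m_iUnion hX hd).map
    (AddMonoidHom.mk' (fun A : Mode →WOT[ℂ] Mode => (⟪φ, A φ⟫_ℂ).re)
      (fun A B => by simp [inner_add_right]))
    (Complex.continuous_re.comp
      (ContinuousLinearMapWOT.continuous_dual_apply φ (innerSL ℂ φ)))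
  exact h

/-- The measure `X ↦ ⟪φ, E(X) φ⟫` on `Ω`, for a vector `φ`. -/
def law (E : Observable Ω) (φ : Mode) : Measure Ω :=
  Measure.ofMeasurable (fun X _ => ENNReal.ofReal (⟪φ, E.effect X φ⟫_ℂ).re)
    (by simp [effect])
    (fun X hX hd => by
      have h := E.hasSum_effect φ hX hd
      rw [← h.tsum_eq, ENNReal.ofReal_tsum_of_nonneg _ h.summable]
      exact fun i => (E.isPositive (X i)).re_inner_nonneg_right φ)

/-- Convergence of observables weakly in the sense of probabilities: `E k (X) → F (X)` in the weak
operator topology for all measurable `X` whose boundary satisfies `F (∂X) = 0`. -/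
def TendstoWeaklyInProbability [TopologicalSpace Ω] (E : ℕ → Observable Ω) (F : Observable Ω) :
    Prop :=
  ∀ X : Set Ω, MeasurableSet X → F.effect (frontier X) = 0 →
    Tendsto (fun k => ContinuousLinearMapWOT.ofCLM ((E k).effect X)) atTop
      (𝓝 (ContinuousLinearMapWOT.ofCLM (F.effect X)))

end Observable

/-! ## Covariant phase space observables and their smearings -/

/-- The operator `A` is the weak integral `∫ f dμ`. -/
def IsWeakIntegral {Ω : Type*} [MeasurableSpace Ω] (f : Ω → (Mode →L[ℂ] Mode)) (μ : Measure Ω)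
    (A : Mode →L[ℂ] Mode) : Prop :=
  ∀ φ ψ : Mode, Integrable (fun x => ⟪φ, f x ψ⟫_ℂ) μ ∧ ∫ x, ⟪φ, f x ψ⟫_ℂ ∂μ = ⟪φ, A ψ⟫_ℂ

/-- `G` is the covariant phase space observable `G^S` generated by `S`:
`G^S(Z) = (2π)⁻¹ ∫_Z W_{qp} S W_{qp}^* dq dp`. -/
def IsPhaseSpaceObservable (S : Mode →L[ℂ] Mode) (G : Observable (ℝ × ℝ)) : Prop :=
  ∀ Z : Set (ℝ × ℝ), MeasurableSet Z →
    IsWeakIntegral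
      (fun w => ((2 * Real.pi)⁻¹ : ℂ) •
        (weyl w.1 w.2 ∘L S ∘L ContinuousLinearMap.adjoint (weyl w.1 w.2)))
      (volume.restrict Z) (G.effect Z)

/-- `M` is the smeared observable `μ * G`, i.e. `(μ * G)(Z) = ∫ μ(Z - w) dG(w)` as a weak integral:
for every vector `φ`, integration is with respect to the measure `⟪φ, G(·) φ⟫`. -/
def IsSmearing (μ : Measure (ℝ × ℝ)) (G M : Observable (ℝ × ℝ)) : Prop :=
  ∀ φ : Mode, ∀ Z : Set (ℝ × ℝ), MeasurableSet Z →
    M.law φ Z = ∫⁻ w, μ {u | u + w ∈ Z} ∂(G.law φ)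

/-- The probability measure `μ_{ε₁,ε₂}`: the Dirac measure at the origin if `ε₁ = ε₂ = 1`, and
otherwise the measure with the Gaussian density
`√(2ε₁ε₂ / (π (ε₁ - 2ε₁ε₂ + ε₂))) exp (-2ε₁ε₂ x² / (ε₁ - 2ε₁ε₂ + ε₂))`. -/
def gaussianSmearing (ε₁ ε₂ : ℝ) : Measure ℝ :=
  open scoped Classical in
  if ε₁ = 1 ∧ ε₂ = 1 then Measure.dirac 0
  else volume.withDensity fun x => ENNReal.ofReal
    (Real.sqrt (2 * ε₁ * ε₂ / (Real.pi * (ε₁ - 2 * ε₁ * ε₂ + ε₂))) *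
      Real.exp (-(2 * ε₁ * ε₂ / (ε₁ - 2 * ε₁ * ε₂ + ε₂)) * x ^ 2))

/-- The probability measure `μ_ε` on `ℝ²`, characterized by
`μ_ε(X × Y) = μ_{ε₁,ε₃}(X / √2) μ_{ε₂,ε₄}(Y / √2)`. -/
def phaseSpaceSmearing (ε₁ ε₂ ε₃ ε₄ : ℝ) : Measure (ℝ × ℝ) :=
  ((gaussianSmearing ε₁ ε₃).map (fun x => Real.sqrt 2 * x)).prod
    ((gaussianSmearing ε₂ ε₄).map (fun y => Real.sqrt 2 * y))

/-! ## Detection -/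

/-- The detection observable of a photon detector with quantum efficiency `ε`:
`E_n^ε = ∑_{m ≥ n} (m choose n) ε^n (1 - ε)^(m - n) |m⟩⟨m|`, where the series converges in the weak
operator topology. The terms with `m < n` vanish since then `m choose n = 0`. -/
def detection (ε : ℝ) (n : ℕ) : Mode →L[ℂ] Mode :=
  (∑' m : ℕ, ContinuousLinearMapWOT.ofCLM
    (((m.choose n * ε ^ n * (1 - ε) ^ (m - n) : ℝ) : ℂ) •
      InnerProductSpace.rankOne ℂ (numberState m) (numberState m))).toCLM

/-- The scaled photon number difference observable of a pair of detectors with efficiencies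
`ε₁, ε₂` and local oscillator amplitude `|z| = r`: the sum of `E_m^{ε₁} ⊗ E_n^{ε₂}` over those
`(m, n)` with `(n / ε₂ - m / ε₁) / (√2 r) ∈ X`, in the weak operator topology. -/
def differenceDetection (ε₁ ε₂ r : ℝ) (X : Set ℝ) : HTensor Mode Mode →L[ℂ] HTensor Mode Mode :=
  (∑' a : {a : ℕ × ℕ // (Real.sqrt 2 * r)⁻¹ * (a.2 / ε₂ - a.1 / ε₁) ∈ X},
    ContinuousLinearMapWOT.ofCLM (opTensor (detection ε₁ a.1.1) (detection ε₂ a.1.2))).toCLM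

/-! ## The eight-port homodyne detector -/

/-- The Hilbert space of the four-mode field, with the modes ordered as `(1, 3), (2, 4)`. -/
abbrev FourMode : Type := HTensor (HTensor Mode Mode) (HTensor Mode Mode)

/-- The isometry of modes `(1, 2)` into the four-mode space which adjoins the coherent states `|z⟩`
in mode `3` and `|w⟩` in mode `4`: `φ₁ ⊗ φ₂ ↦ (φ₁ ⊗ |z⟩) ⊗ (φ₂ ⊗ |w⟩)`. -/
def adjoinOscillators (z w : ℂ) : HTensor Mode Mode →L[ℂ] FourMode :=
  opTensor (tensorRight Mode (coherentState z)) (tensorRight Mode (coherentState w))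

/-- The state
`U₁₃ ⊗ U₂₄ (U₁₂ (ρ ⊗ S) U₁₂^* ⊗ |z⟩⟨z| ⊗ |z e^{iϕ}⟩⟨z e^{iϕ}|) U₁₃^* ⊗ U₂₄^*` of the four-mode
field before detection, for the signal state `ρ`, parameter state `S`, oscillator amplitude `z` and
phase shift `ϕ`. With `V` the isometry adjoining `|z⟩` and `|z e^{iϕ}⟩`, the operator
`T ⊗ |z⟩⟨z| ⊗ |z e^{iϕ}⟩⟨z e^{iϕ}|` is `V T V^*`. -/
def outputState (ρ S : Mode →L[ℂ] Mode) (z : ℂ) (ϕ : ℝ) : FourMode →L[ℂ] FourMode :=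
  let U : HTensor Mode Mode →L[ℂ] HTensor Mode Mode := beamSplitter.toContinuousLinearEquiv
  let V := adjoinOscillators z (z * Complex.exp (Complex.I * ϕ))
  opTensor U U ∘L
    (V ∘L (U ∘L opTensor ρ S ∘L ContinuousLinearMap.adjoint U) ∘L ContinuousLinearMap.adjoint V) ∘L
      ContinuousLinearMap.adjoint (opTensor U U)

/-- `E` is the signal observable `E^{S,z,ϕ}` of the eight-port homodyne detector with detector
efficiencies `ε₁, ε₂, ε₃, ε₄`: for all signal states `ρ` and Borel sets `X, Y`,
`tr[ρ E(X × Y)] = tr[σ_{ρ,S,z,ϕ} E_{ε₁,ε₃}(X / √2) ⊗ E_{ε₂,ε₄}(Y / √2)]`. -/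
def IsSignalObservable (ε₁ ε₂ ε₃ ε₄ : ℝ) (S : Mode →L[ℂ] Mode) (z : ℂ) (ϕ : ℝ)
    (E : Observable (ℝ × ℝ)) : Prop :=
  ∀ ρ : Mode →L[ℂ] Mode, IsState ρ → ∀ X Y : Set ℝ, MeasurableSet X → MeasurableSet Y →
    trace (ρ ∘L E.effect (X ×ˢ Y)) =
      trace (outputState ρ S z ϕ ∘L
        opTensor (differenceDetection ε₁ ε₃ ‖z‖ ((Real.sqrt 2)⁻¹ • X))
          (differenceDetection ε₂ ε₄ ‖z‖ ((Real.sqrt 2)⁻¹ • Y)))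

end Homodyne

end

/-! Decompose `S = ∑ |v_j⟩⟨v_j|` with `∑ ‖v_j‖² = 1`. The signal observable, `G^{CSC⁻¹}` and its
smearing are all partial expectations (`IsReduction`): their matrix elements at `φ, ψ` are sums over
`j` of matrix elements, at `φ ⊗ v_j, ψ ⊗ v_j`, of a positive operator measure on two modes. This
measure does not depend on `S`. For the detector it is the photon count statistics pulled back along
an isometry into four modes (`homodyneIsometry`). For the phase space observable it is
multiplication by indicators compressed along the isometry `J (φ ⊗ v) (q, p) = ⟪W_{qp} C v, φ⟫ /
√(2π)` (`phaseTransform`). Here `C` is forced: `J` must be linear in `v`, while the inner product is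
antilinear in its first slot. Smearing convolves the law `|J Φ|²` with `μ_ε`.

It therefore suffices that, for each two-mode vector `Φ`, the outcome law of the detector converges
weakly to `μ_ε * |J Φ|²`; the sum over `j` follows by dominated convergence
(`tendstoWeaklyInProbability_of_measure`). Both laws have mass `‖Φ‖²`, so Lévy's continuity theorem
reduces this to characteristic functions (`tendsto_measure_of_tendsto_char`). For the detector these
are quadratic forms of contractions (`exists_charOp`), so the limit needs to be checked only on a
total family (`IsTotal.tendsto_inner`).

The total family consists of products of exponential vectors `e(z) = exp(|z|²/2)|z⟩`. Beam splitters
map such products to such products, and the operators `c^N`, which generate count statistics, send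
`e(z)` to `e(cz)`. Since `⟪e(z), e(w)⟫ = exp(conj z * w)`, both sides are single exponentials. A
second order expansion in `1 / r` gives the limit of the exponent (`tendsto_pair_exponent`): the
terms growing with `r` cancel between the two detectors of a pair, the linear terms give the
quadratures, and the quadratic terms give the variance, of which the part in excess of the ideal
detectors is that of `μ_ε` (`tendsto_inner_expVec`).

Existence comes from the same construction (`IsPOVM.exists_observable`). Uniqueness holds because
quadratic forms determine operators, and rectangles determine observables on the plane. -/

noncomputable section

namespace Homodyne

/-! ## Total families -/

section Total

variable {K F : Type*} [NormedAddCommGroup K] [InnerProductSpace ℂ K]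
  [NormedAddCommGroup F] [InnerProductSpace ℂ F] {ι κ : Type*}

/-- A family of vectors is total if its linear span is dense. -/
def IsTotal (x : ι → K) : Prop := Dense (Submodule.span ℂ (range x) : Set K)

theorem IsTotal.mem_closed {x : ι → K} (hx : IsTotal x) {p : Submodule ℂ K}
    (hp : IsClosed (p : Set K)) (h : ∀ i, x i ∈ p) (φ : K) : φ ∈ p := by
  have h1 : (Submodule.span ℂ (range x) : Set K) ⊆ p :=
    SetLike.coe_subset_coe.2 (Submodule.span_le.2 (by rintro - ⟨i, rfl⟩; exact h i))
  exact hp.closure_subset_iff.2 h1 (hx φ)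

theorem IsTotal.clm_ext {x : ι → K} (hx : IsTotal x) {G : Type*} [NormedAddCommGroup G]
    [NormedSpace ℂ G] {f g : K →L[ℂ] G} (h : ∀ i, f (x i) = g (x i)) : f = g :=
  ContinuousLinearMap.ext_on hx (by rintro - ⟨i, rfl⟩; exact h i)

theorem IsTotal.eq_zero {x : ι → K} (hx : IsTotal x) {φ : K} (h : ∀ i, ⟪x i, φ⟫_ℂ = 0) :
    φ = 0 := by
  have h0 : innerSL ℂ φ = 0 := hx.clm_ext fun i => by
    rw [innerSL_apply_apply, ← inner_conj_symm, h i]; simp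
  have := congrArg (fun f : K →L[ℂ] ℂ => f φ) h0
  simpa using this

theorem isTotal_of_forall_inner_eq_zero [CompleteSpace K] {x : ι → K}
    (h : ∀ φ : K, (∀ i, ⟪x i, φ⟫_ℂ = 0) → φ = 0) : IsTotal x := by
  rw [IsTotal, Submodule.dense_iff_topologicalClosure_eq_top,
    Submodule.topologicalClosure_eq_top_iff, Submodule.eq_bot_iff]
  intro φ hφ
  rw [Submodule.mem_orthogonal] at hφ
  exact h φ fun i => hφ _ (Submodule.subset_span ⟨i, rfl⟩)

theorem HilbertBasis.isTotal [CompleteSpace K] (b : HilbertBasis ι ℂ K) : IsTotal b :=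
  Submodule.dense_iff_topologicalClosure_eq_top.2 b.dense_span

/-- Total families with equal Gram matrices are related by a linear isometry. -/
theorem exists_isometry_of_gram [CompleteSpace F] {x : ι → K} (hx : IsTotal x) (y : ι → F)
    (h : ∀ i j, ⟪x i, x j⟫_ℂ = ⟪y i, y j⟫_ℂ) : ∃ J : K →ₗᵢ[ℂ] F, ∀ i, J (x i) = y i := by
  let e := Finsupp.linearCombination ℂ x
  let f := Finsupp.linearCombination ℂ y
  have hinner : ∀ a : ι →₀ ℂ, ⟪e a, e a⟫_ℂ = ⟪f a, f a⟫_ℂ := fun a => by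
    simp only [e, f, Finsupp.linearCombination_apply, Finsupp.sum, sum_inner, inner_sum,
      inner_smul_left, inner_smul_right, h]
  have hnorm : ∀ a : ι →₀ ℂ, ‖f a‖ = ‖e a‖ := fun a => by
    have := hinner a
    rw [inner_self_eq_norm_sq_to_K, inner_self_eq_norm_sq_to_K] at this
    have h2 : ‖e a‖ ^ 2 = ‖f a‖ ^ 2 := by exact_mod_cast this
    exact ((sq_eq_sq₀ (norm_nonneg _) (norm_nonneg _)).1 h2).symm
  have hd : DenseRange e := by
    have : range e = Submodule.span ℂ (range x) := by
      rw [← Finsupp.range_linearCombination]; rfl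
    rw [DenseRange, this]; exact hx
  have hb : ∀ a, ‖f a‖ ≤ 1 * ‖e a‖ := fun a => by rw [one_mul, hnorm]
  -- The family may be linearly dependent, so `e` can have a kernel; equality of norms makes `f`
  -- vanish there and hence factor through `e`.
  have hext : ∀ a, f.extendOfNorm e (e a) = f a :=
    LinearMap.extendOfNorm_eq hd ⟨1, hb⟩
  refine ⟨⟨(f.extendOfNorm e).toLinearMap, fun φ => ?_⟩, fun i => ?_⟩
  · refine hd.induction_on (p := fun φ => ‖f.extendOfNorm e φ‖ = ‖φ‖) φ
      (isClosed_eq (by fun_prop) (by fun_prop)) fun a => ?_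
    rw [hext, hnorm]
  · have := hext (Finsupp.single i 1)
    simpa [e, f] using this

/-- The vectors at which convergence holds form a subspace, and the uniform bound makes it closed.
-/
theorem IsTotal.tendsto_apply {x : ι → K} (hx : IsTotal x) {f : ℕ → K →L[ℂ] ℂ} {g : K →L[ℂ] ℂ}
    {C : ℝ} (hC : ∀ k, ‖f k‖ ≤ C) (h : ∀ i, Tendsto (fun k => f k (x i)) atTop (𝓝 (g (x i))))
    (φ : K) : Tendsto (fun k => f k φ) atTop (𝓝 (g φ)) := by
  let p : Submodule ℂ K :=
    { carrier := {φ | Tendsto (fun k => f k φ) atTop (𝓝 (g φ))}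
      add_mem' := fun {a b} ha hb => by
        simp only [Set.mem_ofPred_eq, map_add] at *
        exact ha.add hb
      zero_mem' := by simp
      smul_mem' := fun c a ha => by
        simp only [Set.mem_ofPred_eq, map_smul] at *
        exact ha.const_smul c }
  refine hx.mem_closed (p := p) ?_ h φ
  rw [← closure_subset_iff_isClosed]
  intro ψ hψ
  change Tendsto (fun k => f k ψ) atTop (𝓝 (g ψ))
  rw [Metric.tendsto_atTop]
  intro δ hδ
  have hC0 : 0 ≤ C := (norm_nonneg _).trans (hC 0)
  have hD : 0 < C + ‖g‖ + 1 := by positivity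
  -- This radius keeps the joint error of `f k` and `g` on `ψ - χ` below `δ / 2`; the summand `1`
  -- only keeps the denominator positive.
  obtain ⟨χ, hχ, hd⟩ := Metric.mem_closure_iff.1 hψ (δ / (2 * (C + ‖g‖ + 1))) (by positivity)
  obtain ⟨N, hN⟩ := (Metric.tendsto_atTop.1 (show Tendsto (fun k => f k χ) atTop (𝓝 (g χ)) from hχ))
    (δ / 2) (by positivity)
  refine ⟨N, fun k hk => ?_⟩
  have h1 := hN k hk
  rw [dist_eq_norm] at h1 hd ⊢
  have h2 : f k ψ - g ψ = (f k χ - g χ) + (f k (ψ - χ) - g (ψ - χ)) := by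
    simp only [map_sub]; ring
  have h3 : ‖f k (ψ - χ)‖ ≤ C * ‖ψ - χ‖ := (f k).le_of_opNorm_le (hC k) _
  have h4 : ‖g (ψ - χ)‖ ≤ ‖g‖ * ‖ψ - χ‖ := g.le_opNorm _
  have h5 : (C + ‖g‖) * ‖ψ - χ‖ ≤ δ / 2 := by
    have : ‖ψ - χ‖ * (2 * (C + ‖g‖ + 1)) ≤ δ := (le_div_iff₀ (by positivity)).1 hd.le
    nlinarith [norm_nonneg (ψ - χ)]
  calc ‖f k ψ - g ψ‖ ≤ ‖f k χ - g χ‖ + (‖f k (ψ - χ)‖ + ‖g (ψ - χ)‖) := by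
        rw [h2]; exact (norm_add_le _ _).trans (by gcongr; exact norm_sub_le _ _)
    _ < δ := by linarith

/-- Weak convergence of uniformly bounded operators can be tested on a total family. -/
theorem IsTotal.tendsto_inner {x : ι → K} (hx : IsTotal x) {B : ℕ → K →L[ℂ] K} {A : K →L[ℂ] K}
    {C : ℝ} (hC : ∀ k, ‖B k‖ ≤ C)
    (h : ∀ i j, Tendsto (fun k => ⟪x i, B k (x j)⟫_ℂ) atTop (𝓝 ⟪x i, A (x j)⟫_ℂ)) (φ ψ : K) :
    Tendsto (fun k => ⟪φ, B k ψ⟫_ℂ) atTop (𝓝 ⟪φ, A ψ⟫_ℂ) := by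
  have h1 : ∀ i ψ, Tendsto (fun k => ⟪x i, B k ψ⟫_ℂ) atTop (𝓝 ⟪x i, A ψ⟫_ℂ) := fun i ψ =>
    hx.tendsto_apply (f := fun k => innerSL ℂ (x i) ∘L B k) (g := innerSL ℂ (x i) ∘L A)
      (C := ‖x i‖ * C) (fun k => (ContinuousLinearMap.opNorm_comp_le _ _).trans (by
        rw [innerSL_apply_norm]; gcongr; exact hC k)) (h i) ψ
  have h2 := hx.tendsto_apply (f := fun k => innerSL ℂ (B k ψ)) (g := innerSL ℂ (A ψ))
      (C := C * ‖ψ‖) (fun k => by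
        rw [innerSL_apply_norm]; exact (B k).le_of_opNorm_le (hC k) ψ) (fun i => by
        simp only [innerSL_apply_apply]
        simpa only [Function.comp_def, inner_conj_symm] using
          (Complex.continuous_conj.tendsto _).comp (h1 i ψ)) φ
  simp only [innerSL_apply_apply] at h2
  simpa only [Function.comp_def, inner_conj_symm] using (Complex.continuous_conj.tendsto _).comp h2

/-- A weak operator statement for all vectors follows from its diagonal case. -/
theorem tendsto_inner_of_tendsto_diag {α : Type*} {l : Filter α} {B : α → K →L[ℂ] K}
    {A : K →L[ℂ] K} (h : ∀ φ, Tendsto (fun k => ⟪φ, B k φ⟫_ℂ) l (𝓝 ⟪φ, A φ⟫_ℂ)) (φ ψ : K) :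
    Tendsto (fun k => ⟪φ, B k ψ⟫_ℂ) l (𝓝 ⟪φ, A ψ⟫_ℂ) := by
  -- Complex polarization, with the signs dictated by antilinearity in the first slot.
  have key : ∀ T : K →L[ℂ] K, ⟪φ, T ψ⟫_ℂ =
      (⟪φ + ψ, T (φ + ψ)⟫_ℂ - ⟪φ - ψ, T (φ - ψ)⟫_ℂ
        - Complex.I * ⟪φ + Complex.I • ψ, T (φ + Complex.I • ψ)⟫_ℂ
        + Complex.I * ⟪φ - Complex.I • ψ, T (φ - Complex.I • ψ)⟫_ℂ) / 4 := fun T => by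
    simp only [map_add, map_sub, map_smul, inner_add_left, inner_add_right, inner_sub_left,
      inner_sub_right, inner_smul_left, inner_smul_right, Complex.conj_I]
    linear_combination ((⟪φ, T ψ⟫_ℂ - ⟪ψ, T φ⟫_ℂ) / 2) * Complex.I_sq
  simp only [key]
  exact ((((h _).sub (h _)).sub ((h _).const_mul _)).add ((h _).const_mul _)).div_const _

theorem clm_ext_diag {A B : K →L[ℂ] K} (h : ∀ φ, ⟪φ, A φ⟫_ℂ = ⟪φ, B φ⟫_ℂ) : A = B := by
  ext ψ
  refine ext_inner_left ℂ fun φ => ?_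
  -- Convergence along the filter `pure ()` is equality, so polarization is reused instead of
  -- repeated.
  have := tendsto_inner_of_tendsto_diag (l := pure ()) (B := fun _ : Unit => A) (A := B)
    (fun φ => by simp [h]) φ ψ
  simpa using tendsto_nhds_unique this tendsto_const_nhds |>.symm

end Total

/-! ## Diagonal operators -/

section Diagonal

variable {K : Type*} [NormedAddCommGroup K] [InnerProductSpace ℂ K] {ι α : Type*}

theorem HilbertBasis.hasSum_norm_sq (b : HilbertBasis ι ℂ K) (φ : K) :
    HasSum (fun i => ‖⟪b i, φ⟫_ℂ‖ ^ 2) (‖φ‖ ^ 2) := by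
  have h := (b.hasSum_inner_mul_inner φ φ).mapL Complex.reCLM
  have h1 : ∀ i, Complex.reCLM (⟪φ, b i⟫_ℂ * ⟪b i, φ⟫_ℂ) = ‖⟪b i, φ⟫_ℂ‖ ^ 2 := fun i => by
    rw [← inner_conj_symm φ (b i), RCLike.conj_mul]
    norm_cast
  have h2 : Complex.reCLM ⟪φ, φ⟫_ℂ = ‖φ‖ ^ 2 := by
    rw [inner_self_eq_norm_sq_to_K]; norm_cast
  simpa only [h1, h2] using h

theorem exists_diagonal [CompleteSpace K] (b : HilbertBasis ι ℂ K) (s : ι → ℂ) (hs : ∀ i, ‖s i‖ ≤ 1) :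
    ∃ T : K →L[ℂ] K, ‖T‖ ≤ 1 ∧ ∀ i, T (b i) = s i • b i := by
  have hsum : ∀ f : lp (fun _ : ι => ℂ) 2, Summable fun i => ‖f i‖ ^ 2 := fun f => by
    have := (lp.memℓp f).summable (by norm_num)
    simpa using this
  have hle : ∀ (f : lp (fun _ : ι => ℂ) 2) i, ‖s i * f i‖ ^ 2 ≤ ‖f i‖ ^ 2 := fun f i => by
    rw [norm_mul]
    gcongr
    exact mul_le_of_le_one_left (norm_nonneg _) (hs i)
  have hmem : ∀ f : lp (fun _ : ι => ℂ) 2, Memℓp (fun i => s i * f i) 2 := fun f => by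
    rw [memℓp_gen_iff (by norm_num)]
    simpa using Summable.of_nonneg_of_le (fun i => by positivity) (hle f) (hsum f)
  have hnorm : ∀ f : lp (fun _ : ι => ℂ) 2, ‖f‖ ^ 2 = ∑' i, ‖f i‖ ^ 2 := fun f => by
    have := lp.norm_rpow_eq_tsum (p := 2) (by norm_num) f
    simpa using this
  let D : lp (fun _ : ι => ℂ) 2 →L[ℂ] lp (fun _ : ι => ℂ) 2 := LinearMap.mkContinuous
    { toFun := fun f => ⟨fun i => s i * f i, hmem f⟩
      map_add' := fun f g => by ext i; exact mul_add _ _ _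
      map_smul' := fun c f => by ext i; exact mul_left_comm _ _ _ } 1 (fun f => by
        rw [one_mul]
        refine (sq_le_sq₀ (norm_nonneg _) (norm_nonneg _)).1 ?_
        rw [hnorm, hnorm]
        exact Summable.tsum_le_tsum (hle f) (hsum ⟨_, hmem f⟩) (hsum f))
  classical
  refine ⟨b.repr.symm.toLinearIsometry.toContinuousLinearMap ∘L D ∘L
    b.repr.toLinearIsometry.toContinuousLinearMap, ?_, fun i => ?_⟩
  · refine ContinuousLinearMap.opNorm_le_bound _ zero_le_one fun φ => ?_
    have := D.le_of_opNorm_le (LinearMap.mkContinuous_norm_le _ zero_le_one _) (b.repr φ)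
    simpa using this
  · apply b.repr.injective
    ext j
    rw [map_smul]
    simp only [ContinuousLinearMap.comp_apply, LinearIsometry.coe_toContinuousLinearMap,
      LinearIsometryEquiv.coe_toLinearIsometry, LinearIsometryEquiv.apply_symm_apply,
      HilbertBasis.repr_self]
    by_cases hij : j = i
    · subst hij; simp [D]
    · simp [D, hij]

theorem hasSum_inner_diagonal (b : HilbertBasis ι ℂ K) {T : K →L[ℂ] K} {s : ι → ℂ}
    (hT : ∀ i, T (b i) = s i • b i) (φ ψ : K) :
    HasSum (fun i => s i * (⟪φ, b i⟫_ℂ * ⟪b i, ψ⟫_ℂ)) ⟪φ, T ψ⟫_ℂ := by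
  have h := (b.hasSum_repr ψ).mapL (innerSL ℂ φ ∘L T)
  simp only [map_smul, ContinuousLinearMap.comp_apply, hT, HilbertBasis.repr_apply_apply,
    innerSL_apply_apply] at h
  refine h.congr_fun fun i => ?_
  simp only [smul_eq_mul]
  ring

/-- An exchange of two summations. The double family is absolutely summable because the nonnegative
weights add up over `a` to at most one, while `c` is absolutely summable. -/
theorem hasSum_mul_of_hasSum_le_one {d : α → ι → ℝ} {s : ι → ℝ} {c : ι → ℂ}
    (hd : ∀ a i, 0 ≤ d a i) (hs : ∀ i, HasSum (fun a => d a i) (s i)) (hs1 : ∀ i, s i ≤ 1)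
    (hc : Summable c) {t : ℂ} (ht : HasSum (fun i => (s i : ℂ) * c i) t)
    {r : α → ℂ} (hr : ∀ a, HasSum (fun i => (d a i : ℂ) * c i) (r a)) : HasSum r t := by
  have hs0 : ∀ i, 0 ≤ s i := fun i => (hs i).nonneg fun a => hd a i
  have hfib : ∀ i, HasSum (fun a => d a i * ‖c i‖) (s i * ‖c i‖) := fun i => (hs i).mul_right _
  have hsum : Summable fun p : ι × α => d p.2 p.1 * ‖c p.1‖ := by
    rw [summable_prod_of_nonneg fun p => mul_nonneg (hd _ _) (norm_nonneg _)]
    refine ⟨fun i => (hfib i).summable, ?_⟩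
    refine Summable.of_nonneg_of_le (fun i => ?_) (fun i => ?_) hc.norm
    · rw [(hfib i).tsum_eq]; exact mul_nonneg (hs0 i) (norm_nonneg _)
    · rw [(hfib i).tsum_eq]; exact mul_le_of_le_one_left (norm_nonneg _) (hs1 i)
  have hsummable : Summable fun p : ι × α => (d p.2 p.1 : ℂ) * c p.1 := by
    refine Summable.of_norm (hsum.congr fun p => ?_)
    rw [norm_mul, Complex.norm_real, Real.norm_of_nonneg (hd _ _)]
  have h1 : HasSum (fun i => (s i : ℂ) * c i) (∑' p : ι × α, (d p.2 p.1 : ℂ) * c p.1) :=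
    hsummable.hasSum.prod_fiberwise fun i => (Complex.hasSum_ofReal.2 (hs i)).mul_right (c i)
  have h2 : HasSum r (∑' p : ι × α, (d p.2 p.1 : ℂ) * c p.1) :=
    ((Equiv.prodComm α ι).hasSum_iff.2 hsummable.hasSum).prod_fiberwise hr
  rwa [h1.unique ht] at h2

/-- Evaluates the weak operator series that define `detection` and `differenceDetection`. On matrix
elements it is the exchange of sums above, with `c i = ⟪φ, b i⟫ * ⟪b i, ψ⟫`. -/
theorem hasSum_diagonal [CompleteSpace K] (b : HilbertBasis ι ℂ K) {A : α → K →L[ℂ] K} {d : α → ι → ℝ}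
    {s : ι → ℝ} {T : K →L[ℂ] K} (hA : ∀ a i, A a (b i) = (d a i : ℂ) • b i)
    (hd : ∀ a i, 0 ≤ d a i) (hs : ∀ i, HasSum (fun a => d a i) (s i)) (hs1 : ∀ i, s i ≤ 1)
    (hT : ∀ i, T (b i) = (s i : ℂ) • b i) :
    HasSum (fun a => ContinuousLinearMapWOT.ofCLM (A a)) (ContinuousLinearMapWOT.ofCLM T) := by
  refine ContinuousLinearMapWOT.tendsto_iff_forall_inner_apply_tendsto.2 fun ψ φ => ?_
  have hgoal : HasSum (fun a => ⟪φ, A a ψ⟫_ℂ) ⟪φ, T ψ⟫_ℂ :=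
    hasSum_mul_of_hasSum_le_one hd hs hs1 (b.summable_inner_mul_inner φ ψ)
      (hasSum_inner_diagonal b hT φ ψ) fun a => hasSum_inner_diagonal b (hA a) φ ψ
  refine Tendsto.congr (fun t => ?_) hgoal
  induction t using Finset.cons_induction with
  | empty => simp
  | cons a t ha ih => rw [Finset.sum_cons, Finset.sum_cons, ih]; simp [inner_add_right]

end Diagonal

/-! ## Tensor products -/

section TensorFacts

variable {K₁ K₂ L₁ L₂ : Type*}
  [NormedAddCommGroup K₁] [InnerProductSpace ℂ K₁] [NormedAddCommGroup K₂] [InnerProductSpace ℂ K₂]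
  [NormedAddCommGroup L₁] [InnerProductSpace ℂ L₁] [NormedAddCommGroup L₂] [InnerProductSpace ℂ L₂]
  {ι κ : Type*}

/-- The simple tensor as a bounded bilinear map. -/
def htmulL (K₁ K₂ : Type*) [NormedAddCommGroup K₁] [InnerProductSpace ℂ K₁]
    [NormedAddCommGroup K₂] [InnerProductSpace ℂ K₂] : K₁ →L[ℂ] K₂ →L[ℂ] HTensor K₁ K₂ :=
  (ContinuousLinearMap.compL ℂ K₂ (K₁ ⊗[ℂ] K₂) (HTensor K₁ K₂) UniformSpace.Completion.toComplL) ∘L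
    TensorProduct.mkL ℂ K₁ K₂

theorem htmulL_apply (φ : K₁) (ψ : K₂) : htmulL K₁ K₂ φ ψ = htmul φ ψ := rfl

theorem inner_htmul (φ φ' : K₁) (ψ ψ' : K₂) :
    ⟪htmul φ ψ, htmul φ' ψ'⟫_ℂ = ⟪φ, φ'⟫_ℂ * ⟪ψ, ψ'⟫_ℂ := by
  rw [htmul, htmul, UniformSpace.Completion.inner_coe, TensorProduct.inner_tmul]

theorem norm_htmul (φ : K₁) (ψ : K₂) : ‖htmul φ ψ‖ = ‖φ‖ * ‖ψ‖ := by
  rw [htmul, UniformSpace.Completion.norm_coe, TensorProduct.norm_tmul]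

theorem htmul_smul_left (c : ℂ) (φ : K₁) (ψ : K₂) : htmul (c • φ) ψ = c • htmul φ ψ := by
  rw [← htmulL_apply, map_smul]; rfl

theorem htmul_smul_right (c : ℂ) (φ : K₁) (ψ : K₂) : htmul φ (c • ψ) = c • htmul φ ψ := by
  rw [← htmulL_apply, map_smul]; rfl

theorem isTotal_htmul_all : IsTotal fun p : K₁ × K₂ => htmul p.1 p.2 := by
  refine Dense.mono ?_ (UniformSpace.Completion.denseRange_coe (α := K₁ ⊗[ℂ] K₂))
  rintro - ⟨t, rfl⟩
  induction t using TensorProduct.induction_on with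
  | zero => exact Submodule.zero_mem _
  | tmul φ ψ => exact Submodule.subset_span ⟨(φ, ψ), rfl⟩
  | add s t hs ht =>
    rw [UniformSpace.Completion.coe_add]
    exact Submodule.add_mem _ hs ht

/-- One factor is freed at a time: with the other factor fixed, the vectors whose product lies in
the closed span form a closed subspace. -/
theorem IsTotal.htmul {x : ι → K₁} {y : κ → K₂} (hx : IsTotal x) (hy : IsTotal y) :
    IsTotal fun p : ι × κ => htmul (x p.1) (y p.2) := by
  let q := (Submodule.span ℂ (range fun p : ι × κ => Homodyne.htmul (x p.1) (y p.2))).topologicalClosure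
  have hq : IsClosed (q : Set (HTensor K₁ K₂)) := Submodule.isClosed_topologicalClosure _
  have h1 : ∀ i j, Homodyne.htmul (x i) (y j) ∈ q := fun i j =>
    Submodule.le_topologicalClosure _ (Submodule.subset_span ⟨(i, j), rfl⟩)
  have h2 : ∀ φ j, Homodyne.htmul φ (y j) ∈ q := fun φ j =>
    hx.mem_closed (p := q.comap ((htmulL K₁ K₂).flip (y j)).toLinearMap)
      (hq.preimage ((htmulL K₁ K₂).flip (y j)).continuous) (fun i => h1 i j) φ
  have h3 : ∀ φ ψ, Homodyne.htmul φ ψ ∈ q := fun φ ψ =>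
    hy.mem_closed (p := q.comap (htmulL K₁ K₂ φ).toLinearMap)
      (hq.preimage (htmulL K₁ K₂ φ).continuous) (fun j => h2 φ j) ψ
  rw [IsTotal, Submodule.dense_iff_topologicalClosure_eq_top, Submodule.eq_top_iff']
  exact isTotal_htmul_all.mem_closed hq fun p => h3 p.1 p.2

theorem exists_tensorBasis [CompleteSpace K₁] [CompleteSpace K₂] (b : HilbertBasis ι ℂ K₁)
    (c : HilbertBasis κ ℂ K₂) :
    ∃ e : HilbertBasis (ι × κ) ℂ (HTensor K₁ K₂), ∀ p, e p = htmul (b p.1) (c p.2) := by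
  have ho : Orthonormal ℂ fun p : ι × κ => htmul (b p.1) (c p.2) := by
    classical
    rw [orthonormal_iff_ite]
    rintro ⟨i, j⟩ ⟨i', j'⟩
    rw [inner_htmul, orthonormal_iff_ite.1 b.orthonormal, orthonormal_iff_ite.1 c.orthonormal]
    by_cases h1 : i = i' <;> by_cases h2 : j = j' <;> simp [h1, h2]
  exact ⟨HilbertBasis.mk ho (Submodule.dense_iff_topologicalClosure_eq_top.1
    ((HilbertBasis.isTotal b).htmul (HilbertBasis.isTotal c))).ge, fun p => by rw [HilbertBasis.coe_mk]⟩

theorem norm_opTensor_le (A : K₁ →L[ℂ] L₁) (B : K₂ →L[ℂ] L₂) : ‖opTensor A B‖ ≤ ‖A‖ * ‖B‖ := by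
  refine ContinuousLinearMap.opNorm_le_bound _ (by positivity) fun t => ?_
  induction t using UniformSpace.Completion.induction_on with
  | hp => exact isClosed_le (by fun_prop) (by fun_prop)
  | ih s =>
    have h : opTensor A B (s : HTensor K₁ K₂) = (TensorProduct.mapL A B s : HTensor L₁ L₂) :=
      ContinuousLinearMap.extend_eq _ denseRange_toComplL isUniformInducing_toComplL s
    rw [h, UniformSpace.Completion.norm_coe, UniformSpace.Completion.norm_coe]
    exact (TensorProduct.mapL A B).le_of_opNorm_le (TensorProduct.norm_mapL_le A B) s

theorem norm_tensorRight_le (ψ : K₂) : ‖tensorRight K₁ ψ‖ ≤ ‖ψ‖ :=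
  ContinuousLinearMap.opNorm_le_bound _ (norm_nonneg _) fun φ => by
    rw [tensorRight_apply, norm_htmul, mul_comm]

theorem opTensor_rankOne (φ : K₁) (ψ : K₂) :
    opTensor (InnerProductSpace.rankOne ℂ φ φ) (InnerProductSpace.rankOne ℂ ψ ψ) =
      InnerProductSpace.rankOne ℂ (htmul φ ψ) (htmul φ ψ) :=
  isTotal_htmul_all.clm_ext fun p => by
    rw [opTensor_htmul, InnerProductSpace.rankOne_apply, InnerProductSpace.rankOne_apply,
      InnerProductSpace.rankOne_apply, inner_htmul, htmul_smul_left, htmul_smul_right, smul_smul]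

end TensorFacts

/-! ## Trace class operators as sums of rank one operators -/

section RankOne

open InnerProductSpace ContinuousLinearMap

variable {K : Type*} [NormedAddCommGroup K] [InnerProductSpace ℂ K] {ι κ : Type*}

/-- `A = ∑ j, |u j⟩⟨u j|` in norm, with `∑ j, ‖u j‖² < ∞`. -/
structure IsDecomposition (u : κ → K) (A : K →L[ℂ] K) : Prop where
  summable : Summable fun j => ‖u j‖ ^ 2
  hasSum : HasSum (fun j => rankOne ℂ (u j) (u j)) A

theorem summable_rankOne [CompleteSpace K] {u : κ → K} (hu : Summable fun j => ‖u j‖ ^ 2) :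
    Summable fun j => rankOne ℂ (u j) (u j) :=
  Summable.of_norm (by simpa only [norm_rankOne, ← sq] using hu)

theorem norm_inner_le_of_norm_le (B : K →L[ℂ] K) (u : K) : ‖⟪u, B u⟫_ℂ‖ ≤ ‖B‖ * ‖u‖ ^ 2 :=
  calc ‖⟪u, B u⟫_ℂ‖ ≤ ‖u‖ * ‖B u‖ := norm_inner_le_norm _ _
    _ ≤ ‖u‖ * (‖B‖ * ‖u‖) := by gcongr; exact B.le_opNorm u
    _ = ‖B‖ * ‖u‖ ^ 2 := by ring

theorem summable_inner_apply {u : κ → K} (hu : Summable fun j => ‖u j‖ ^ 2) (B : K →L[ℂ] K) :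
    Summable fun j => ⟪u j, B (u j)⟫_ℂ :=
  Summable.of_norm_bounded (hu.mul_left ‖B‖) fun j => norm_inner_le_of_norm_le B (u j)

variable [CompleteSpace K]

/-- Basis independence of the trace. The double series of `g` summed over `i` gives `⟪u j, B (u
j)⟫`, and summed over `j` gives the diagonal of `A B` in the basis `c`. By Parseval it is dominated
by a summable series of squares, so the order is irrelevant. -/
theorem IsDecomposition.hasSum_inner {u : κ → K} {A : K →L[ℂ] K} (h : IsDecomposition u A)
    (B : K →L[ℂ] K) (c : HilbertBasis ι ℂ K) :
    HasSum (fun i => ⟪c i, (A ∘L B) (c i)⟫_ℂ) (∑' j, ⟪u j, B (u j)⟫_ℂ) := by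
  let g : κ × ι → ℂ := fun p => ⟪adjoint B (u p.1), c p.2⟫_ℂ * ⟪c p.2, u p.1⟫_ℂ
  have hrow : ∀ j, HasSum (fun i => g (j, i)) ⟪u j, B (u j)⟫_ℂ := fun j => by
    rw [← adjoint_inner_left B (u j) (u j)]
    exact c.hasSum_inner_mul_inner (adjoint B (u j)) (u j)
  have hbd : ∀ p, ‖g p‖ ≤ (‖⟪c p.2, adjoint B (u p.1)⟫_ℂ‖ ^ 2 + ‖⟪c p.2, u p.1⟫_ℂ‖ ^ 2) := fun p => by
    rw [norm_mul, norm_inner_symm]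
    nlinarith [sq_nonneg (‖⟪c p.2, adjoint B (u p.1)⟫_ℂ‖ - ‖⟪c p.2, u p.1⟫_ℂ‖),
      sq_nonneg (‖⟪c p.2, adjoint B (u p.1)⟫_ℂ‖ + ‖⟪c p.2, u p.1⟫_ℂ‖)]
  have hbs : ∀ j, HasSum (fun i => ‖⟪c i, adjoint B (u j)⟫_ℂ‖ ^ 2 + ‖⟪c i, u j⟫_ℂ‖ ^ 2)
      (‖adjoint B (u j)‖ ^ 2 + ‖u j‖ ^ 2) := fun j =>
    (HilbertBasis.hasSum_norm_sq c _).add (HilbertBasis.hasSum_norm_sq c _)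
  have hg : Summable g := by
    suffices hsum : Summable fun p : κ × ι =>
      ‖⟪c p.2, adjoint B (u p.1)⟫_ℂ‖ ^ 2 + ‖⟪c p.2, u p.1⟫_ℂ‖ ^ 2 from
      Summable.of_norm_bounded hsum hbd
    rw [summable_prod_of_nonneg fun p => add_nonneg (sq_nonneg _) (sq_nonneg _)]
    refine ⟨fun j => (hbs j).summable, ?_⟩
    refine Summable.of_nonneg_of_le (fun j => ?_) (fun j => ?_)
      (h.summable.mul_left (‖adjoint B‖ ^ 2 + 1))
    · exact tsum_nonneg fun i => add_nonneg (sq_nonneg _) (sq_nonneg _)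
    · rw [(hbs j).tsum_eq, add_mul, one_mul, ← mul_pow]
      gcongr
      exact le_opNorm _ _
  have h1 : HasSum (fun j => ⟪u j, B (u j)⟫_ℂ) (∑' p, g p) := hg.hasSum.prod_fiberwise hrow
  rw [h1.tsum_eq]
  refine ((Equiv.prodComm ι κ).hasSum_iff.2 hg.hasSum).prod_fiberwise fun i => ?_
  have h2 := h.hasSum.mapL ((innerSL ℂ (c i)) ∘L (ContinuousLinearMap.apply ℂ K (B (c i))))
  refine h2.congr_fun fun j => ?_
  simp only [Function.comp, Equiv.prodComm_apply, Prod.swap, g, ContinuousLinearMap.comp_apply,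
    ContinuousLinearMap.apply_apply, rankOne_apply, innerSL_apply_apply, inner_smul_right,
    adjoint_inner_left]

theorem IsDecomposition.trace_comp {u : κ → K} {A : K →L[ℂ] K} (h : IsDecomposition u A)
    (B : K →L[ℂ] K) : trace (A ∘L B) = ∑' j, ⟪u j, B (u j)⟫_ℂ :=
  (h.hasSum_inner B _).tsum_eq

/-- The vectors are `u j = √ρ (b j)`: then `‖u j‖² = ⟪b j, ρ (b j)⟫`, and Parseval for `√ρ φ` and
`√ρ ψ` shows that the rank one operators add up to `ρ`. No eigenvectors are needed. -/
theorem isDecomposition_sqrt {ρ : K →L[ℂ] K} (hρ : ρ.IsPositive) (b : HilbertBasis κ ℂ K)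
    (hb : Summable fun j => ⟪b j, ρ (b j)⟫_ℂ) :
    ∃ u : κ → K, IsDecomposition u ρ := by
  have h0 : 0 ≤ ρ := (nonneg_iff_isPositive ρ).2 hρ
  let R := CFC.sqrt ρ
  have hR : R ∘L R = ρ := CFC.sqrt_mul_sqrt_self ρ h0
  have hRs : ∀ φ ψ, ⟪R φ, ψ⟫_ℂ = ⟪φ, R ψ⟫_ℂ :=
    ((nonneg_iff_isPositive R).1 (CFC.sqrt_nonneg ρ)).isSymmetric
  have hn : ∀ j, ⟪b j, ρ (b j)⟫_ℂ = ((‖R (b j)‖ ^ 2 : ℝ) : ℂ) := fun j => by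
    rw [← hR, ContinuousLinearMap.comp_apply, ← hRs, inner_self_eq_norm_sq_to_K]
    norm_cast
  simp only [hn] at hb
  have hs : Summable fun j => ‖R (b j)‖ ^ 2 := Complex.summable_ofReal.1 hb
  refine ⟨fun j => R (b j), hs, ?_⟩
  have h1 := (summable_rankOne hs).hasSum
  convert! h1
  ext ψ
  refine ext_inner_left ℂ fun φ => ?_
  have h2 := h1.mapL ((innerSL ℂ φ) ∘L (ContinuousLinearMap.apply ℂ K ψ))
  have h3 := b.hasSum_inner_mul_inner (R φ) (R ψ)
  rw [hRs, ← ContinuousLinearMap.comp_apply, hR] at h3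
  refine h3.unique (h2.congr_fun fun j => ?_)
  simp only [ContinuousLinearMap.comp_apply, ContinuousLinearMap.apply_apply, rankOne_apply,
    innerSL_apply_apply, inner_smul_right, hRs]
  ring

/-- A state is a sum of rank one operators whose norms add up to one, indexed by any given Hilbert
basis. -/
theorem IsState.exists_decomposition {ρ : K →L[ℂ] K} (hρ : IsState ρ) (b : HilbertBasis κ ℂ K) :
    ∃ u : κ → K, IsDecomposition u ρ ∧ HasSum (fun j => ‖u j‖ ^ 2) 1 := by
  obtain ⟨u, hu⟩ := isDecomposition_sqrt hρ.1 (exists_hilbertBasis ℂ K).choose_spec.choose (by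
    -- A divergent diagonal series would have the default sum `0`, against trace one.
    by_contra hcon
    have h1 := hρ.2
    rw [trace, tsum_eq_zero_of_not_summable hcon] at h1
    exact zero_ne_one h1)
  -- Summability is known only in the basis chosen inside `trace`; basis independence carries it
  -- over to `b`.
  have h2 := hu.hasSum_inner (ContinuousLinearMap.id ℂ K) b
  obtain ⟨v, hv⟩ := isDecomposition_sqrt hρ.1 b h2.summable
  refine ⟨v, hv, ?_⟩
  have h3 := hv.summable.hasSum
  have h4 : ∑' j, ‖v j‖ ^ 2 = 1 := by
    have h5 := hv.trace_comp (ContinuousLinearMap.id ℂ K)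
    rw [ContinuousLinearMap.comp_id, hρ.2] at h5
    have h6 : ∀ j, ⟪v j, ContinuousLinearMap.id ℂ K (v j)⟫_ℂ = ((‖v j‖ ^ 2 : ℝ) : ℂ) := fun j => by
      rw [ContinuousLinearMap.id_apply, inner_self_eq_norm_sq_to_K]; norm_cast
    simp only [h6, ← Complex.ofReal_tsum] at h5
    exact_mod_cast h5.symm
  rwa [h4] at h3

omit [CompleteSpace K] in
theorem isDecomposition_rankOne (φ : K) :
    IsDecomposition (fun _ : Unit => φ) (rankOne ℂ φ φ) :=
  ⟨Summable.of_finite, hasSum_unique fun _ : Unit => rankOne ℂ φ φ⟩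

theorem isState_rankOne {φ : K} (hφ : ‖φ‖ = 1) : IsState (rankOne ℂ φ φ) := by
  refine ⟨isPositive_rankOne_self φ, ?_⟩
  have := (isDecomposition_rankOne φ).trace_comp (ContinuousLinearMap.id ℂ K)
  rw [ContinuousLinearMap.comp_id] at this
  rw [this]
  simp [inner_self_eq_norm_sq_to_K, hφ]

theorem IsDecomposition.conj {L : Type*} [NormedAddCommGroup L] [InnerProductSpace ℂ L]
    [CompleteSpace L] {u : κ → K} {A : K →L[ℂ] K} (h : IsDecomposition u A) (W : K →L[ℂ] L) :
    IsDecomposition (fun j => W (u j)) (W ∘L A ∘L adjoint W) := by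
  constructor
  · refine Summable.of_nonneg_of_le (fun j => by positivity) (fun j => ?_)
      (h.summable.mul_left (‖W‖ ^ 2))
    rw [← mul_pow]
    gcongr
    exact W.le_opNorm _
  · have h1 := h.hasSum.mapL ((compL ℂ L K L W) ∘L ((compL ℂ L K K).flip (adjoint W)))
    refine h1.congr_fun fun j => ?_
    ext ψ
    simp [adjoint_inner_right]

omit [CompleteSpace K] in
theorem IsDecomposition.opTensor {L : Type*} [NormedAddCommGroup L] [InnerProductSpace ℂ L]
    [CompleteSpace L] {u : ι → K} {v : κ → L} {A : K →L[ℂ] K} {B : L →L[ℂ] L}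
    (hA : IsDecomposition u A) (hB : IsDecomposition v B) :
    IsDecomposition (fun p : ι × κ => htmul (u p.1) (v p.2)) (opTensor A B) := by
  have hs : Summable fun p : ι × κ => ‖htmul (u p.1) (v p.2)‖ ^ 2 := by
    simp only [norm_htmul, mul_pow]
    exact hA.summable.mul_of_nonneg hB.summable (fun _ => by positivity) fun _ => by positivity
  refine ⟨hs, ?_⟩
  have h1 := (summable_rankOne hs).hasSum
  convert! h1
  refine isTotal_htmul_all.clm_ext fun ⟨φ, ψ⟩ => ?_
  have h2 := h1.mapL (ContinuousLinearMap.apply ℂ _ (htmul φ ψ))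
  have hAφ := hA.hasSum.mapL (ContinuousLinearMap.apply ℂ K φ)
  have hBψ := hB.hasSum.mapL (ContinuousLinearMap.apply ℂ L ψ)
  have h3 := h2.prod_fiberwise (fun j => by
    have h4 := hBψ.mapL (htmulL K L (rankOne ℂ (u j) (u j) φ))
    refine h4.congr_fun fun k => ?_
    simp only [ContinuousLinearMap.apply_apply, ← opTensor_rankOne, opTensor_htmul, htmulL_apply])
  have h5 := hAφ.mapL ((htmulL K L).flip (B ψ))
  rw [opTensor_htmul]
  exact h5.unique h3

end RankOne

/-! ## Exponential vectors -/

section ExpVec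

/-- The wave function of the exponential vector `e(z) = exp(|z|² / 2) |z⟩`. -/
def expFun (z : ℂ) (x : ℝ) : ℂ :=
  ((Real.pi ^ (-(1 / 4) : ℝ) : ℝ) : ℂ) *
    Complex.exp (-(x : ℂ) ^ 2 / 2 + (Real.sqrt 2 : ℂ) * z * x - z ^ 2 / 2)

/-- The exponential vector `e(z) = exp(|z|² / 2) |z⟩`. -/
def expVec (z : ℂ) : Mode := Complex.exp ((starRingEnd ℂ) z * z / 2) • coherentState z

theorem sqrt_two_sq : (Real.sqrt 2 : ℂ) ^ 2 = 2 := by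
  rw [← Complex.ofReal_pow, Real.sq_sqrt (by norm_num)]; norm_num

theorem coeFn_expVec (z : ℂ) : expVec z =ᵐ[volume] expFun z := by
  have h1 : coherentState z =ᵐ[volume] coherentFun z := MemLp.coeFn_toLp _
  filter_upwards [Lp.coeFn_smul (Complex.exp ((starRingEnd ℂ) z * z / 2)) (coherentState z), h1]
    with x h2 h3
  rw [expVec, h2, Pi.smul_apply, h3, smul_eq_mul, coherentFun, expFun]
  have hz : (z.re : ℂ) + z.im * Complex.I = z := Complex.re_add_im z
  have hc : (starRingEnd ℂ) z = (z.re : ℂ) - z.im * Complex.I := by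
    apply Complex.ext <;> simp
  have hexp : ∀ a x₁ x₂ x₃ x₄ : ℂ, Complex.exp x₁ * (a * Complex.exp x₂ * Complex.exp x₃ *
      Complex.exp x₄) = a * Complex.exp (x₁ + x₂ + x₃ + x₄) := fun a x₁ x₂ x₃ x₄ => by
    simp only [Complex.exp_add]; ring
  rw [hexp]
  congr 2
  rw [hc]
  have hI := Complex.I_sq
  have h2 := sqrt_two_sq
  simp only [Complex.ofReal_mul]
  generalize (z.re : ℂ) = a at *
  generalize (z.im : ℂ) = b at *
  generalize (Real.sqrt 2 : ℂ) = s at *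
  rw [← hz]
  linear_combination (-Complex.I * a * b / 2 - a ^ 2 / 2) * h2 + (0 : ℂ) * hI

theorem memLp_expFun (z : ℂ) : MemLp (expFun z) 2 (volume : Measure ℝ) :=
  (memLp_congr_ae (coeFn_expVec z)).1 (Lp.memLp _)

theorem conj_expFun (z : ℂ) (x : ℝ) : (starRingEnd ℂ) (expFun z x) = expFun ((starRingEnd ℂ) z) x := by
  simp only [expFun, map_mul, Complex.conj_ofReal, ← Complex.exp_conj, map_sub, map_add, map_div₀,
    map_neg, map_pow, map_ofNat]

theorem pi_rpow_sq : ((Real.pi ^ (-(1 / 4) : ℝ) : ℝ) : ℂ) * ((Real.pi ^ (-(1 / 4) : ℝ) : ℝ) : ℂ) *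
    ((Real.sqrt Real.pi : ℝ) : ℂ) = 1 := by
  rw [← Complex.ofReal_mul, ← Complex.ofReal_mul, Real.sqrt_eq_rpow, ← Real.rpow_add Real.pi_pos,
    ← Real.rpow_add Real.pi_pos]
  norm_num

theorem integral_exp_neg_sq (c d : ℂ) :
    ∫ x : ℝ, Complex.exp (-(x : ℂ) ^ 2 + c * x + d) =
      (Real.sqrt Real.pi : ℝ) * Complex.exp (d + c ^ 2 / 4) := by
  have h := integral_cexp_quadratic (b := -1) (by simp) c d
  simp only [neg_one_mul] at h
  rw [h, neg_neg, div_one, Real.sqrt_eq_rpow, Complex.ofReal_cpow Real.pi_pos.le]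
  congr 2
  · push_cast; rfl
  · ring

/-- A Gaussian integral by completing the square. This kernel turns the later matrix elements into
single exponentials, whose identities are polynomial identities between exponents. -/
theorem inner_expVec (z w : ℂ) : ⟪expVec z, expVec w⟫_ℂ = Complex.exp ((starRingEnd ℂ) z * w) := by
  rw [L2.inner_def]
  have h : ∀ᵐ x, ⟪expVec z x, expVec w x⟫_ℂ =
      (((Real.pi ^ (-(1 / 4) : ℝ) : ℝ) : ℂ) * ((Real.pi ^ (-(1 / 4) : ℝ) : ℝ) : ℂ)) *
        Complex.exp (-(x : ℂ) ^ 2 + ((Real.sqrt 2 : ℂ) * ((starRingEnd ℂ) z + w)) * x +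
          (-((starRingEnd ℂ) z ^ 2 / 2) - w ^ 2 / 2)) := by
    filter_upwards [coeFn_expVec z, coeFn_expVec w] with x h1 h2
    rw [h1, h2, RCLike.inner_apply, conj_expFun, expFun, expFun]
    rw [mul_mul_mul_comm, ← Complex.exp_add]
    congr 2
    ring
  rw [integral_congr_ae h, integral_const_mul, integral_exp_neg_sq, ← mul_assoc, pi_rpow_sq,
    one_mul]
  congr 1
  linear_combination (((starRingEnd ℂ) z + w) ^ 2 / 4) * sqrt_two_sq

theorem coherentState_eq_smul (z : ℂ) :
    coherentState z = Complex.exp (-((starRingEnd ℂ) z * z / 2)) • expVec z := by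
  rw [expVec, smul_smul, ← Complex.exp_add, neg_add_cancel, Complex.exp_zero, one_smul]

/-- The normalizing factors agree because `|α|² + |β|²` is invariant under the rotation of
amplitudes. -/
theorem beamSplitter_expVec (α β : ℂ) :
    beamSplitter (htmul (expVec α) (expVec β)) =
      htmul (expVec ((α - β) / Real.sqrt 2)) (expVec ((α + β) / Real.sqrt 2)) := by
  simp only [expVec, htmul_smul_left, htmul_smul_right, map_smul, beamSplitter_coherentState,
    smul_smul, ← Complex.exp_add]
  congr 2
  simp only [map_div₀, map_sub, map_add, Complex.conj_ofReal]
  have h := sqrt_two_sq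
  have h0 : (Real.sqrt 2 : ℂ) ≠ 0 := fun h0 => by simp [h0] at h
  field_simp
  rw [h]
  ring

/-- An integrable function with vanishing Fourier transform vanishes. -/
theorem ae_eq_zero_of_fourier_eq_zero {g : ℝ → ℂ} (hg : Integrable g)
    (h : ∀ y : ℝ, FourierTransform.fourier g y = 0) : g =ᵐ[volume] 0 := by
  refine ae_eq_zero_of_integral_contDiff_smul_eq_zero hg.locallyIntegrable fun k hk hc => ?_
  have hk' : ContDiff ℝ (⊤ : ℕ∞) fun x => (k x : ℂ) := Complex.ofRealCLM.contDiff.comp hk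
  have hc' : HasCompactSupport fun x => (k x : ℂ) := hc.comp_left Complex.ofReal_zero
  let s : SchwartzMap ℝ ℂ := hc'.toSchwartzMap hk'
  have h1 : ∀ x, (k x : ℂ) = FourierTransform.fourier (FourierTransformInv.fourierInv s) x :=
    fun x => by rw [FourierTransform.fourier_fourierInv_eq]; rfl
  -- The test function is the Fourier transform of a Schwartz function, so the transform can be
  -- moved onto `g`, where it vanishes.
  have h2 := VectorFourier.integral_fourierIntegral_smul_eq_flip (L := innerₗ ℝ)
    (μ := volume) (ν := volume) Real.continuous_fourierChar continuous_inner
    (FourierTransformInv.fourierInv s).integrable hg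
  have h3 : ∫ x, k x • g x = ∫ x, (k x : ℂ) • g x := by simp
  rw [h3]
  simp only [h1]
  refine h2.trans ?_
  rw [flip_innerₗ]
  refine integral_eq_zero_of_ae (.of_forall fun x => ?_)
  have h4 : VectorFourier.fourierIntegral Real.fourierChar volume (innerₗ ℝ) g x = 0 := h x
  simp only [h4, smul_zero, Pi.zero_apply]

/-- Imaginary `z` already suffice: orthogonality of `f` to these `e(z)` says that the Fourier
transform of `f` times a Gaussian vanishes, and the Gaussian has no zeros. -/
theorem isTotal_expVec : IsTotal expVec := by
  refine isTotal_of_forall_inner_eq_zero fun f hf => ?_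
  let g : ℝ → ℂ := fun x => expFun 0 x * f x
  have hg : Integrable g := (memLp_expFun 0).integrable_mul (Lp.memLp f)
  have h0 : g =ᵐ[volume] 0 := by
    refine ae_eq_zero_of_fourier_eq_zero hg fun y => ?_
    -- Chosen so that the term `√2 * w * x` in the exponent of `expFun` equals `-2πi x y`.
    let w : ℂ := -(Real.sqrt 2 * Real.pi * y * Complex.I)
    have h1 := hf ((starRingEnd ℂ) w)
    rw [L2.inner_def] at h1
    have h2 : ∀ᵐ x, ⟪expVec ((starRingEnd ℂ) w) x, f x⟫_ℂ =
        Complex.exp (-(w ^ 2 / 2)) * (Real.fourierChar (-(x * y)) • g x) := by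
      filter_upwards [coeFn_expVec ((starRingEnd ℂ) w)] with x h3
      rw [h3, RCLike.inner_apply, conj_expFun, Complex.conj_conj]
      simp only [g, expFun, Circle.smul_def, Real.fourierChar_apply, smul_eq_mul]
      have h4 : ∀ a b c d e : ℂ, Complex.exp a * (Complex.exp b * (c * Complex.exp d * e)) =
          e * (c * Complex.exp (a + b + d)) := fun a b c d e => by
        simp only [Complex.exp_add]; ring
      rw [h4]
      congr 3
      simp only [w]
      push_cast
      linear_combination (-Real.pi * y * Complex.I * x) * sqrt_two_sq
    rw [integral_congr_ae h2, integral_const_mul] at h1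
    have h5 := (mul_eq_zero.1 h1).resolve_left (Complex.exp_ne_zero _)
    rw [Real.fourier_real_eq]
    exact h5
  refine (Lp.eq_zero_iff_ae_eq_zero).2 ?_
  filter_upwards [h0] with x hx
  have : expFun 0 x ≠ 0 := mul_ne_zero
    (by exact_mod_cast (Real.rpow_pos_of_pos Real.pi_pos _).ne') (Complex.exp_ne_zero _)
  exact (mul_eq_zero.1 hx).resolve_left this

end ExpVec

/-! ## Number states -/

section NumberStates

open Polynomial

/-- The probabilists' Hermite polynomial with real coefficients. -/
def hermiteReal (n : ℕ) : ℝ[X] := (hermite n).map (Int.castRingHom ℝ)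

theorem hermiteReal_zero : hermiteReal 0 = 1 := by simp [hermiteReal]

theorem hermiteReal_succ (n : ℕ) :
    hermiteReal (n + 1) = X * hermiteReal n - derivative (hermiteReal n) := by
  simp [hermiteReal, hermite_succ, Polynomial.derivative_map]

theorem aeval_hermite (n : ℕ) (x : ℝ) : aeval x (hermite n) = (hermiteReal n).eval x := by
  rw [hermiteReal, eval_map, aeval_def]; rfl

theorem memLp_eval_mul_gaussian (p : ℝ[X]) :
    MemLp (fun x : ℝ => ((p.eval (Real.sqrt 2 * x) * Real.exp (-x ^ 2 / 2) : ℝ) : ℂ)) 2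
      (volume : Measure ℝ) := by
  refine MemLp.ofReal (K := ℂ) (f := fun x : ℝ => p.eval (Real.sqrt 2 * x) *
    Real.exp (-x ^ 2 / 2)) ?_
  have h : MemLp (fun x : ℝ => ∑ k ∈ Finset.range (p.natDegree + 1),
      (p.coeff k * Real.sqrt 2 ^ k) * (x ^ k * Real.exp (-x ^ 2 / 2))) 2 (volume : Measure ℝ) :=
    memLp_finsetSum _ fun k _ => (memLp_pow_mul_gaussian k).const_mul _
  refine h.ae_eq (.of_forall fun x => ?_)
  simp only [eval_eq_sum_range, Finset.sum_mul, mul_pow]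
  exact Finset.sum_congr rfl fun k _ => by ring

/-- The Gaussian integral of a polynomial against an exponential. -/
def gaussPair (p : ℝ[X]) (z : ℂ) : ℂ :=
  ∫ x : ℝ, ((p.eval (Real.sqrt 2 * x) : ℝ) : ℂ) * Complex.exp (-(x : ℂ) ^ 2 + (Real.sqrt 2 : ℂ) * z * x)

theorem integrable_gaussPair (p : ℝ[X]) (z : ℂ) :
    Integrable fun x : ℝ => ((p.eval (Real.sqrt 2 * x) : ℝ) : ℂ) *
      Complex.exp (-(x : ℂ) ^ 2 + (Real.sqrt 2 : ℂ) * z * x) := by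
  have h := ((memLp_eval_mul_gaussian p).integrable_mul (memLp_expFun z)).const_mul
    (((Real.pi ^ (-(1 / 4) : ℝ) : ℝ) : ℂ)⁻¹ * Complex.exp (z ^ 2 / 2))
  refine h.congr (.of_forall fun x => ?_)
  have hpi : ((Real.pi ^ (-(1 / 4) : ℝ) : ℝ) : ℂ) ≠ 0 := by
    exact_mod_cast (Real.rpow_pos_of_pos Real.pi_pos _).ne'
  have h4 : ∀ P a b c d : ℂ, P ≠ 0 → P⁻¹ * Complex.exp a * (b * Complex.exp c * (P * Complex.exp d)) =
      b * Complex.exp (a + c + d) := fun P a b c d hP => by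
    simp only [Complex.exp_add]; field_simp
  simp only [Pi.mul_apply, expFun, Complex.ofReal_mul, Complex.ofReal_exp]
  rw [h4 _ _ _ _ _ hpi]
  congr 2
  push_cast
  ring

theorem gaussPair_sub (p q : ℝ[X]) (z : ℂ) : gaussPair (p - q) z = gaussPair p z - gaussPair q z := by
  rw [gaussPair, gaussPair, gaussPair, ← integral_sub (integrable_gaussPair p z)
    (integrable_gaussPair q z)]
  simp [sub_mul]

/-- Integration by parts: the derivative of `p(√2 x) exp(-x² + √2 z x)` has integral zero. Since `X
* p - p'` is the Hermite recursion, each step from `n` to `n + 1` contributes a factor `z`. -/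
theorem gaussPair_X_mul (p : ℝ[X]) (z : ℂ) :
    gaussPair (X * p - derivative p) z = z * gaussPair p z := by
  have hd : ∀ x : ℝ, HasDerivAt (fun x : ℝ => ((p.eval (Real.sqrt 2 * x) : ℝ) : ℂ) *
      Complex.exp (-(x : ℂ) ^ 2 + (Real.sqrt 2 : ℂ) * z * x))
      ((Real.sqrt 2 : ℂ) * (z * (((p.eval (Real.sqrt 2 * x) : ℝ) : ℂ) *
        Complex.exp (-(x : ℂ) ^ 2 + (Real.sqrt 2 : ℂ) * z * x)) -
        (((X * p - derivative p).eval (Real.sqrt 2 * x) : ℝ) : ℂ) *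
          Complex.exp (-(x : ℂ) ^ 2 + (Real.sqrt 2 : ℂ) * z * x))) x := fun x => by
    have h1 : HasDerivAt (fun x : ℝ => Real.sqrt 2 * x) (Real.sqrt 2) x := by
      simpa using (hasDerivAt_id x).const_mul (Real.sqrt 2)
    have h2 := ((p.hasDerivAt (Real.sqrt 2 * x)).comp x h1).ofReal_comp
    have h3 : HasDerivAt (fun x : ℝ => -(x : ℂ) ^ 2 + (Real.sqrt 2 : ℂ) * z * x)
        (-(2 * (x : ℂ)) + (Real.sqrt 2 : ℂ) * z) x := by
      have h4 := (hasDerivAt_id x).ofReal_comp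
      refine ((h4.pow 2).neg.add (h4.const_mul ((Real.sqrt 2 : ℂ) * z))).congr_deriv ?_
      simp
    refine (h2.mul h3.cexp).congr_deriv ?_
    simp only [eval_sub, eval_mul, eval_X, Complex.ofReal_sub, Complex.ofReal_mul, Function.comp]
    linear_combination (((p.eval (Real.sqrt 2 * x) : ℝ) : ℂ) * x *
      Complex.exp (-(x : ℂ) ^ 2 + (Real.sqrt 2 : ℂ) * z * x)) * sqrt_two_sq
  have h5 := integral_eq_zero_of_hasDerivAt_of_integrable hd
    ((((integrable_gaussPair p z).const_mul z).sub (integrable_gaussPair _ z)).const_mul _)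
    (integrable_gaussPair p z)
  rw [integral_const_mul, integral_sub ((integrable_gaussPair p z).const_mul z)
    (integrable_gaussPair _ z), integral_const_mul] at h5
  have h0 : (Real.sqrt 2 : ℂ) ≠ 0 := fun h0 => by simpa [h0] using sqrt_two_sq
  exact (sub_eq_zero.1 ((mul_eq_zero.1 h5).resolve_left h0)).symm

theorem gaussPair_one (z : ℂ) : gaussPair 1 z = Real.sqrt Real.pi * Complex.exp (z ^ 2 / 2) := by
  have h := integral_exp_neg_sq ((Real.sqrt 2 : ℂ) * z) 0
  simp only [gaussPair, eval_one, Complex.ofReal_one, one_mul]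
  simp only [add_zero, zero_add] at h
  rw [h]
  congr 2
  linear_combination (z ^ 2 / 4) * sqrt_two_sq

theorem gaussPair_hermite (n : ℕ) (z : ℂ) :
    gaussPair (hermiteReal n) z = z ^ n * (Real.sqrt Real.pi * Complex.exp (z ^ 2 / 2)) := by
  induction n with
  | zero => rw [hermiteReal_zero, gaussPair_one, pow_zero, one_mul]
  | succ n ih => rw [hermiteReal_succ, gaussPair_X_mul, ih, pow_succ']; ring

/-- The same integration by parts at `z = 0` moves derivatives onto the other factor. Orthogonality
follows, since `n` derivatives annihilate polynomials of lower degree and leave `n!` from a monic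
one of degree `n`. -/
theorem gaussPair_hermite_mul (n : ℕ) (q : ℝ[X]) :
    gaussPair (hermiteReal n * q) 0 = gaussPair (derivative^[n] q) 0 := by
  induction n generalizing q with
  | zero => rw [hermiteReal_zero, one_mul]; rfl
  | succ n ih =>
    have h1 := gaussPair_X_mul (hermiteReal n * q) 0
    have h2 : X * (hermiteReal n * q) - derivative (hermiteReal n * q) =
        hermiteReal (n + 1) * q - hermiteReal n * derivative q := by
      rw [hermiteReal_succ, derivative_mul]; ring
    rw [h2, gaussPair_sub, zero_mul, sub_eq_zero] at h1
    rw [h1, ih, Function.iterate_succ_apply]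

theorem monic_hermiteReal (n : ℕ) : (hermiteReal n).Monic := (hermite_monic n).map _

theorem natDegree_hermiteReal (n : ℕ) : (hermiteReal n).natDegree = n := by
  rw [hermiteReal, (hermite_monic n).natDegree_map, natDegree_hermite]

theorem gaussPair_hermite_hermite (n m : ℕ) :
    gaussPair (hermiteReal n * hermiteReal m) 0 =
      if n = m then (n.factorial : ℂ) * Real.sqrt Real.pi else 0 := by
  have hlt : ∀ {n m : ℕ}, m < n → gaussPair (hermiteReal n * hermiteReal m) 0 = 0 := fun {n m} h => by
    rw [gaussPair_hermite_mul, iterate_derivative_eq_zero (by rwa [natDegree_hermiteReal])]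
    simp [gaussPair]
  rcases lt_trichotomy n m with h | h | h
  · rw [mul_comm, hlt h, if_neg h.ne]
  · subst h
    have h1 : derivative^[n] (hermiteReal n) = C (n.factorial : ℝ) := by
      have h2 : (derivative^[n] (hermiteReal n)).natDegree = 0 := by
        have := natDegree_iterate_derivative (hermiteReal n) n
        rw [natDegree_hermiteReal] at this
        omega
      rw [eq_C_of_natDegree_eq_zero h2, coeff_iterate_derivative, zero_add,
        Nat.descFactorial_self]
      have h3 : (hermiteReal n).coeff n = 1 := by
        have := monic_hermiteReal n
        rwa [Monic, leadingCoeff, natDegree_hermiteReal] at this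
      rw [h3]; simp
    have h4 : gaussPair (C (n.factorial : ℝ)) 0 = (n.factorial : ℂ) * gaussPair 1 0 := by
      rw [gaussPair, gaussPair, ← integral_const_mul]
      simp
    rw [gaussPair_hermite_mul, h1, h4, gaussPair_one, if_pos rfl]
    simp
  · rw [hlt h, if_neg h.ne']

theorem coeFn_numberState (n : ℕ) : numberState n =ᵐ[volume] fun x =>
    (((Real.sqrt (n.factorial * Real.sqrt Real.pi))⁻¹ : ℝ) : ℂ) *
      (((hermiteReal n).eval (Real.sqrt 2 * x) : ℝ) : ℂ) * Complex.exp (-(x : ℂ) ^ 2 / 2) := by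
  filter_upwards [(memLp_hermiteFun n).coeFn_toLp] with x hx
  rw [numberState, hx, hermiteFun, aeval_hermite]
  push_cast
  rfl

theorem inner_numberState_expVec (n : ℕ) (z : ℂ) :
    ⟪numberState n, expVec z⟫_ℂ = z ^ n / (Real.sqrt n.factorial : ℝ) := by
  rw [L2.inner_def]
  let A : ℂ := (((Real.sqrt (n.factorial * Real.sqrt Real.pi))⁻¹ : ℝ) : ℂ)
  let P : ℂ := ((Real.pi ^ (-(1 / 4) : ℝ) : ℝ) : ℂ)
  have h : ∀ᵐ x, ⟪numberState n x, expVec z x⟫_ℂ =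
      (A * P * Complex.exp (-(z ^ 2 / 2))) * ((((hermiteReal n).eval (Real.sqrt 2 * x) : ℝ) : ℂ) *
        Complex.exp (-(x : ℂ) ^ 2 + (Real.sqrt 2 : ℂ) * z * x)) := by
    filter_upwards [coeFn_numberState n, coeFn_expVec z] with x h1 h2
    rw [h1, h2, RCLike.inner_apply, expFun]
    simp only [map_mul, Complex.conj_ofReal, ← Complex.exp_conj, map_neg, map_div₀, map_pow,
      map_ofNat]
    have h4 : ∀ a b c d e f : ℂ, c * Complex.exp d * (a * b * Complex.exp e) =
        a * c * b * Complex.exp (d + e) := fun a b c d e f => by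
      simp only [Complex.exp_add]; ring
    have h5 : ∀ a b c d e : ℂ, a * b * Complex.exp c * (d * Complex.exp e) =
        a * b * d * Complex.exp (c + e) := fun a b c d e => by
      simp only [Complex.exp_add]; ring
    rw [h4 _ _ _ _ _ 0, h5]
    congr 2
    ring
  rw [integral_congr_ae h, integral_const_mul]
  change _ * gaussPair (hermiteReal n) z = _
  rw [gaussPair_hermite]
  have h6 : A = ((Real.sqrt n.factorial : ℝ) : ℂ)⁻¹ * P := by
    simp only [A, P]
    rw [← Complex.ofReal_inv, ← Complex.ofReal_mul, Real.sqrt_mul (by positivity), mul_inv,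
      Real.sqrt_eq_rpow (Real.sqrt Real.pi), Real.sqrt_eq_rpow Real.pi,
      ← Real.rpow_mul Real.pi_pos.le, ← Real.rpow_neg Real.pi_pos.le]
    norm_num
  rw [h6]
  have h7 : P * P * ((Real.sqrt Real.pi : ℝ) : ℂ) = 1 := pi_rpow_sq
  have h8 : Complex.exp (-(z ^ 2 / 2)) * Complex.exp (z ^ 2 / 2) = 1 := by
    rw [← Complex.exp_add, neg_add_cancel, Complex.exp_zero]
  calc _ = z ^ n * ((Real.sqrt n.factorial : ℝ) : ℂ)⁻¹ * (P * P * ((Real.sqrt Real.pi : ℝ) : ℂ)) *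
        (Complex.exp (-(z ^ 2 / 2)) * Complex.exp (z ^ 2 / 2)) := by ring
    _ = _ := by rw [h7, h8, mul_one, mul_one, div_eq_mul_inv]

theorem orthonormal_numberState : Orthonormal ℂ numberState := by
  rw [orthonormal_iff_ite]
  intro n m
  rw [L2.inner_def]
  let A : ℕ → ℂ := fun n => (((Real.sqrt (n.factorial * Real.sqrt Real.pi))⁻¹ : ℝ) : ℂ)
  have h : ∀ᵐ x, ⟪numberState n x, numberState m x⟫_ℂ =
      (A n * A m) * ((((hermiteReal n * hermiteReal m).eval (Real.sqrt 2 * x) : ℝ) : ℂ) *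
        Complex.exp (-(x : ℂ) ^ 2 + (Real.sqrt 2 : ℂ) * 0 * x)) := by
    filter_upwards [coeFn_numberState n, coeFn_numberState m] with x h1 h2
    rw [h1, h2, RCLike.inner_apply]
    simp only [map_mul, Complex.conj_ofReal, ← Complex.exp_conj, map_neg, map_div₀, map_pow,
      map_ofNat, eval_mul, Complex.ofReal_mul]
    have h4 : -(x : ℂ) ^ 2 + (Real.sqrt 2 : ℂ) * 0 * x = -(x : ℂ) ^ 2 / 2 + -(x : ℂ) ^ 2 / 2 := by
      ring
    rw [h4, Complex.exp_add]
    simp only [A]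
    ring
  rw [integral_congr_ae h, integral_const_mul]
  change _ * gaussPair (hermiteReal n * hermiteReal m) 0 = _
  rw [gaussPair_hermite_hermite]
  split_ifs with hnm
  · subst hnm
    simp only [A]
    have hp : 0 < (n.factorial : ℝ) * Real.sqrt Real.pi := by positivity
    rw [← Complex.ofReal_mul, ← mul_inv, Real.mul_self_sqrt hp.le]
    exact_mod_cast inv_mul_cancel₀ hp.ne'
  · simp

/-- Completeness of the Hermite functions, deduced from totality of the exponential vectors. The
sequences `z ^ n / √n!` in `ℓ²` have the Gram kernel `exp(conj z * w)` too, so an isometry `J` sends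
`e(z)` to them. Its `n`-th coordinate is the pairing with `numberState n`; hence vanishing
coefficients give `J f = 0`. -/
theorem eq_zero_of_inner_numberState {f : Mode} (hf : ∀ n, ⟪numberState n, f⟫_ℂ = 0) : f = 0 := by
  have hterm : ∀ z w : ℂ, HasSum (fun n : ℕ => (starRingEnd ℂ) (z ^ n / (Real.sqrt n.factorial : ℝ)) *
      (w ^ n / (Real.sqrt n.factorial : ℝ))) (Complex.exp ((starRingEnd ℂ) z * w)) := fun z w => by
    have h1 := NormedSpace.expSeries_div_hasSum_exp ((starRingEnd ℂ) z * w)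
    rw [← Complex.exp_eq_exp_ℂ] at h1
    refine h1.congr_fun fun n => ?_
    have h2 : ((Real.sqrt n.factorial : ℝ) : ℂ) * ((Real.sqrt n.factorial : ℝ) : ℂ) = n.factorial := by
      rw [← Complex.ofReal_mul, Real.mul_self_sqrt (by positivity)]; simp
    rw [map_div₀, Complex.conj_ofReal, div_mul_div_comm, h2, map_pow, mul_pow]
  have hmem : ∀ z : ℂ, Memℓp (fun n : ℕ => z ^ n / ((Real.sqrt n.factorial : ℝ) : ℂ)) 2 := fun z => by
    rw [memℓp_gen_iff (by norm_num)]
    have h1 := (hterm z z).summable.norm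
    refine h1.congr fun n => ?_
    rw [norm_mul, RCLike.norm_conj, ← sq]
    simp
  obtain ⟨J, hJ⟩ := exists_isometry_of_gram isTotal_expVec
    (fun z => (⟨_, hmem z⟩ : lp (fun _ : ℕ => ℂ) 2)) fun z w => by
      rw [inner_expVec, lp.inner_eq_tsum, ← (hterm z w).tsum_eq]
      refine tsum_congr fun n => ?_
      rw [RCLike.inner_apply, mul_comm]
  have hn : ∀ n, innerSL ℂ (numberState n) =
      (innerSL ℂ (lp.single 2 n (1 : ℂ) : lp (fun _ : ℕ => ℂ) 2)) ∘L J.toContinuousLinearMap :=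
    fun n => isTotal_expVec.clm_ext fun z => by
      rw [innerSL_apply_apply, inner_numberState_expVec, ContinuousLinearMap.comp_apply,
        innerSL_apply_apply, LinearIsometry.coe_toContinuousLinearMap, hJ, lp.inner_single_left]
      simp
  have h0 : J f = 0 := by
    ext n
    have h1 := congrArg (fun T : Mode →L[ℂ] ℂ => T f) (hn n)
    simp only [innerSL_apply_apply, hf n, ContinuousLinearMap.comp_apply,
      LinearIsometry.coe_toContinuousLinearMap, lp.inner_single_left] at h1
    simpa using h1.symm
  exact (map_eq_zero_iff J J.injective).1 h0

/-- The Hilbert basis of number states. -/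
def numberBasis : HilbertBasis ℕ ℂ Mode :=
  HilbertBasis.mk orthonormal_numberState
    (Submodule.dense_iff_topologicalClosure_eq_top.1
      (isTotal_of_forall_inner_eq_zero fun _ => eq_zero_of_inner_numberState)).ge

theorem numberBasis_apply (n : ℕ) : numberBasis n = numberState n := by
  rw [numberBasis, HilbertBasis.coe_mk]

/-- The operator `c^N`. It rescales the argument of `e(z)` because the `n`-th coefficient of `e(z)`
is `z ^ n / √n!`. -/
theorem exists_numberDiagonal (c : ℂ) (hc : ‖c‖ ≤ 1) : ∃ T : Mode →L[ℂ] Mode, ‖T‖ ≤ 1 ∧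
    (∀ n, T (numberState n) = c ^ n • numberState n) ∧ ∀ z, T (expVec z) = expVec (c * z) := by
  obtain ⟨T, hT, h⟩ := exists_diagonal numberBasis (fun n => c ^ n) fun n => by
    rw [norm_pow]; exact pow_le_one₀ (norm_nonneg _) hc
  refine ⟨T, hT, fun n => by simpa only [numberBasis_apply] using h n, fun z => ?_⟩
  rw [← sub_eq_zero]
  refine eq_zero_of_inner_numberState fun n => ?_
  have h1 := hasSum_inner_diagonal numberBasis h (numberState n) (expVec z)
  have h2 := hasSum_ite_eq n (c ^ n * ⟪numberState n, expVec z⟫_ℂ)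
  have h3 := h1.unique (h2.congr_fun fun m => by
    rw [numberBasis_apply, orthonormal_iff_ite.1 orthonormal_numberState]
    by_cases hm : m = n
    · subst hm; simp
    · simp [hm, Ne.symm hm])
  rw [inner_sub_right, h3, inner_numberState_expVec, inner_numberState_expVec, mul_pow]
  ring

end NumberStates

/-! ## Partial expectations and observables -/

section Reduction

open ContinuousLinearMap

variable {Ω : Type*} [MeasurableSpace Ω]

/-- The series converges in operator norm, its terms being bounded by `‖B‖ * ‖v j‖²`. -/
theorem exists_reduced {v : ℕ → Mode} (hv : Summable fun j => ‖v j‖ ^ 2)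
    (B : HTensor Mode Mode →L[ℂ] HTensor Mode Mode) :
    ∃ R : Mode →L[ℂ] Mode, ∀ φ ψ,
      HasSum (fun j => ⟪htmul φ (v j), B (htmul ψ (v j))⟫_ℂ) ⟪φ, R ψ⟫_ℂ := by
  let T : ℕ → Mode →L[ℂ] Mode := fun j =>
    adjoint (tensorRight Mode (v j)) ∘L B ∘L tensorRight Mode (v j)
  have hT : Summable T := by
    refine Summable.of_norm_bounded (hv.mul_left ‖B‖) fun j => ?_
    have h1 := norm_tensorRight_le (K₁ := Mode) (v j)
    calc ‖T j‖ ≤ ‖adjoint (tensorRight Mode (v j))‖ * (‖B‖ * ‖tensorRight Mode (v j)‖) :=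
          (opNorm_comp_le _ _).trans (by gcongr; exact opNorm_comp_le _ _)
      _ = ‖tensorRight Mode (v j)‖ * (‖B‖ * ‖tensorRight Mode (v j)‖) := by
          rw [LinearIsometryEquiv.norm_map]
      _ ≤ ‖v j‖ * (‖B‖ * ‖v j‖) := by gcongr
      _ = ‖B‖ * ‖v j‖ ^ 2 := by ring
  refine ⟨∑' j, T j, fun φ ψ => ?_⟩
  have h := hT.hasSum.mapL ((innerSL ℂ φ) ∘L (ContinuousLinearMap.apply ℂ Mode ψ))
  refine h.congr_fun fun j => ?_
  simp only [T, ContinuousLinearMap.comp_apply, ContinuousLinearMap.apply_apply,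
    innerSL_apply_apply, adjoint_inner_right, tensorRight_apply]

/-- `P` is a positive operator measure with diagonal measures `lam`. -/
structure IsPOVM (P : Set Ω → HTensor Mode Mode →L[ℂ] HTensor Mode Mode)
    (lam : HTensor Mode Mode → Measure Ω) : Prop where
  inner_eq : ∀ Z, MeasurableSet Z → ∀ Φ, ⟪Φ, P Z Φ⟫_ℂ = ((lam Φ Z).toReal : ℂ)
  total : ∀ Φ, lam Φ univ = ENNReal.ofReal (‖Φ‖ ^ 2)

/-- `E` is the partial expectation of `P` with respect to the vectors `v j` of the second mode. -/
def IsReduction (v : ℕ → Mode) (P : Set Ω → HTensor Mode Mode →L[ℂ] HTensor Mode Mode)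
    (E : Observable Ω) : Prop :=
  ∀ Z, MeasurableSet Z → ∀ φ ψ,
    HasSum (fun j => ⟪htmul φ (v j), P Z (htmul ψ (v j))⟫_ℂ) ⟪φ, E.effect Z ψ⟫_ℂ

variable {P : Set Ω → HTensor Mode Mode →L[ℂ] HTensor Mode Mode}
  {lam : HTensor Mode Mode → Measure Ω} {v : ℕ → Mode}

/-- The sum of the diagonal measures over the vectors of the second mode. -/
def reducedLaw (lam : HTensor Mode Mode → Measure Ω) (v : ℕ → Mode) (φ : Mode) : Measure Ω :=
  Measure.sum fun j => lam (htmul φ (v j))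

theorem IsPOVM.reducedLaw_univ (h : IsPOVM P lam) (hv : HasSum (fun j => ‖v j‖ ^ 2) 1) (φ : Mode) :
    reducedLaw lam v φ univ = ENNReal.ofReal (‖φ‖ ^ 2) := by
  have h1 : HasSum (fun j => ‖htmul φ (v j)‖ ^ 2) (‖φ‖ ^ 2) := by
    simpa only [norm_htmul, mul_pow, mul_one] using hv.mul_left (‖φ‖ ^ 2)
  rw [reducedLaw, Measure.sum_apply _ MeasurableSet.univ]
  simp only [h.total]
  rw [← ENNReal.ofReal_tsum_of_nonneg (fun j => by positivity) h1.summable, h1.tsum_eq]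

theorem IsPOVM.isFiniteMeasure_reducedLaw (h : IsPOVM P lam) (hv : HasSum (fun j => ‖v j‖ ^ 2) 1)
    (φ : Mode) : IsFiniteMeasure (reducedLaw lam v φ) :=
  ⟨by rw [h.reducedLaw_univ hv]; exact ENNReal.ofReal_lt_top⟩

theorem IsPOVM.hasSum_reducedLaw (h : IsPOVM P lam) (hv : HasSum (fun j => ‖v j‖ ^ 2) 1) (φ : Mode)
    {Z : Set Ω} (hZ : MeasurableSet Z) :
    HasSum (fun j => ⟪htmul φ (v j), P Z (htmul φ (v j))⟫_ℂ)
      ((reducedLaw lam v φ Z).toReal : ℂ) := by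
  have := h.isFiniteMeasure_reducedLaw hv φ
  simp only [h.inner_eq Z hZ]
  rw [Complex.hasSum_ofReal]
  have h1 : reducedLaw lam v φ Z = ∑' j, lam (htmul φ (v j)) Z := Measure.sum_apply _ hZ
  have h2 := measure_ne_top (reducedLaw lam v φ) Z
  rw [h1] at h2 ⊢
  rw [ENNReal.tsum_toReal_eq (ENNReal.ne_top_of_tsum_ne_top h2)]
  exact (ENNReal.summable_toReal h2).hasSum

/-- On the diagonal the reduced operators are values of the finite measure `reducedLaw`, which gives
positivity, normalization and σ-additivity there; polarization extends σ-additivity to the weak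
operator topology. -/
theorem IsPOVM.exists_observable (h : IsPOVM P lam) (hv : HasSum (fun j => ‖v j‖ ^ 2) 1) :
    ∃ E : Observable Ω, IsReduction v P E := by
  classical
  choose R hR using fun Z => exists_reduced hv.summable (P Z)
  have hdiag : ∀ Z, MeasurableSet Z → ∀ φ,
      ⟪φ, R Z φ⟫_ℂ = ((reducedLaw lam v φ Z).toReal : ℂ) := fun Z hZ φ =>
    (hR Z φ φ).unique (h.hasSum_reducedLaw hv φ hZ)
  let m : VectorMeasure Ω (Mode →WOT[ℂ] Mode) :=
    -- A vector measure must vanish on nonmeasurable sets, where `R` is arbitrary.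
    { measureOf' := fun Z => if MeasurableSet Z then ContinuousLinearMapWOT.ofCLM (R Z) else 0
      empty' := by
        rw [if_pos MeasurableSet.empty]
        have : R ∅ = 0 := clm_ext_diag fun φ => by
          rw [hdiag ∅ MeasurableSet.empty]; simp
        rw [this]; rfl
      not_measurable' := fun Z hZ => if_neg hZ
      m_iUnion' := fun f hf hd => by
        simp only [hf, MeasurableSet.iUnion hf, if_true]
        refine ContinuousLinearMapWOT.tendsto_iff_forall_inner_apply_tendsto.2 fun ψ φ => ?_
        have key := tendsto_inner_of_tendsto_diag (l := (SummationFilter.unconditional ℕ).filter)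
          (B := fun t : Finset ℕ => ∑ i ∈ t, R (f i)) (A := R (⋃ i, f i)) (fun φ => by
            have hfin := h.isFiniteMeasure_reducedLaw hv φ
            have h1 : HasSum (fun i => (reducedLaw lam v φ (f i)).toReal)
                (reducedLaw lam v φ (⋃ i, f i)).toReal := by
              have h2 := measure_ne_top (reducedLaw lam v φ) (⋃ i, f i)
              rw [measure_iUnion hd hf] at h2 ⊢
              rw [ENNReal.tsum_toReal_eq (ENNReal.ne_top_of_tsum_ne_top h2)]
              exact (ENNReal.summable_toReal h2).hasSum
            have h3 : HasSum (fun i => ⟪φ, R (f i) φ⟫_ℂ) ⟪φ, R (⋃ i, f i) φ⟫_ℂ := by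
              rw [hdiag _ (MeasurableSet.iUnion hf)]
              simp only [hdiag _ (hf _)]
              exact Complex.hasSum_ofReal.2 h1
            refine Tendsto.congr (fun t => ?_) h3
            rw [_root_.sum_apply, inner_sum]) φ ψ
        refine Tendsto.congr (fun t => ?_) key
        induction t using Finset.cons_induction with
        | empty => simp
        | cons a t ha ih =>
          rw [Finset.sum_cons, Finset.sum_cons, _root_.add_apply,
            ContinuousLinearMapWOT.add_apply, inner_add_right, inner_add_right, ih]
          rfl }
  have hm : ∀ Z, MeasurableSet Z → (m Z).toCLM = R Z := fun Z hZ => by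
    change (if MeasurableSet Z then ContinuousLinearMapWOT.ofCLM (R Z) else 0).toCLM = _
    rw [if_pos hZ]
  refine ⟨⟨m, fun X => ?_, ?_⟩, fun Z hZ φ ψ => ?_⟩
  · by_cases hX : MeasurableSet X
    · rw [hm X hX, ContinuousLinearMap.isPositive_iff_complex]
      intro φ
      rw [← inner_conj_symm, hdiag X hX, Complex.conj_ofReal]
      exact ⟨rfl, ENNReal.toReal_nonneg⟩
    · rw [VectorMeasure.not_measurable m hX]
      exact ContinuousLinearMap.isPositive_zero
  · rw [hm _ MeasurableSet.univ]
    refine clm_ext_diag fun φ => ?_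
    rw [hdiag _ MeasurableSet.univ, h.reducedLaw_univ hv, ENNReal.toReal_ofReal (by positivity),
      ContinuousLinearMap.id_apply, inner_self_eq_norm_sq_to_K]
    norm_cast
  · change HasSum _ ⟪φ, (m Z).toCLM ψ⟫_ℂ
    rw [hm Z hZ]
    exact hR Z φ ψ

theorem IsReduction.law_apply {E : Observable Ω} (hE : IsReduction v P E) (h : IsPOVM P lam)
    (hv : HasSum (fun j => ‖v j‖ ^ 2) 1) (φ : Mode) : E.law φ = reducedLaw lam v φ := by
  ext Z hZ
  rw [Observable.law, Measure.ofMeasurable_apply _ hZ,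
    (hE Z hZ φ φ).unique (h.hasSum_reducedLaw hv φ hZ), Complex.ofReal_re]
  have := h.isFiniteMeasure_reducedLaw hv φ
  exact ENNReal.ofReal_toReal (measure_ne_top _ _)

/-! ### Uniqueness of observables -/

theorem Observable.law_eq (E : Observable Ω) (φ : Mode) {Z : Set Ω} (hZ : MeasurableSet Z) :
    E.law φ Z = ENNReal.ofReal (⟪φ, E.effect Z φ⟫_ℂ).re := by
  rw [Observable.law, Measure.ofMeasurable_apply _ hZ]

theorem Observable.ext_of_effect {E F : Observable Ω}
    (h : ∀ Z, MeasurableSet Z → E.effect Z = F.effect Z) : E = F := by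
  refine Observable.ext (VectorMeasure.ext fun Z hZ => ?_)
  exact ContinuousLinearMapWOT.toCLM_injective (h Z hZ)

theorem Observable.ext_of_law {E F : Observable Ω} (h : ∀ φ, E.law φ = F.law φ) : E = F := by
  refine Observable.ext_of_effect fun Z hZ => clm_ext_diag fun φ => ?_
  have h1 := congrArg (fun μ : Measure Ω => μ Z) (h φ)
  simp only [Observable.law_eq _ φ hZ] at h1
  have hre : ∀ G : Observable Ω, ((⟪φ, G.effect Z φ⟫_ℂ).re : ℂ) = ⟪φ, G.effect Z φ⟫_ℂ ∧
      0 ≤ (⟪φ, G.effect Z φ⟫_ℂ).re := fun G => by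
    have h2 := (ContinuousLinearMap.isPositive_iff_complex _).1 (G.isPositive Z) φ
    have h3 : ⟪φ, G.effect Z φ⟫_ℂ = (starRingEnd ℂ) ⟪G.effect Z φ, φ⟫_ℂ :=
      (inner_conj_symm _ _).symm
    have h4 : (((⟪G.effect Z φ, φ⟫_ℂ).re : ℝ) : ℂ) = ⟪G.effect Z φ, φ⟫_ℂ := h2.1
    rw [h3, ← h4, Complex.conj_ofReal, Complex.ofReal_re]
    exact ⟨rfl, h2.2⟩
  rw [ENNReal.ofReal_eq_ofReal_iff (hre E).2 (hre F).2] at h1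
  rw [← (hre E).1, ← (hre F).1, h1]

theorem Observable.ext_of_prod {E F : Observable (ℝ × ℝ)}
    (h : ∀ X Y : Set ℝ, MeasurableSet X → MeasurableSet Y → E.effect (X ×ˢ Y) = F.effect (X ×ˢ Y)) :
    E = F := by
  refine Observable.ext (VectorMeasure.ext_of_generateFrom _ ?_ generateFrom_prod.symm
    isPiSystem_prod ?_)
  · rintro - ⟨X, hX, Y, hY, rfl⟩
    exact ContinuousLinearMapWOT.toCLM_injective (h X Y hX hY)
  · refine ContinuousLinearMapWOT.toCLM_injective ?_
    rw [E.apply_univ, F.apply_univ]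

/-- Pure states already determine the quadratic forms of the effects on unit vectors, hence the
effects of rectangles, and rectangles form a generating π-system. -/
theorem IsSignalObservable.unique {ε₁ ε₂ ε₃ ε₄ : ℝ} {S : Mode →L[ℂ] Mode} {z : ℂ} {ϕ : ℝ}
    {E F : Observable (ℝ × ℝ)} (hE : IsSignalObservable ε₁ ε₂ ε₃ ε₄ S z ϕ E)
    (hF : IsSignalObservable ε₁ ε₂ ε₃ ε₄ S z ϕ F) : E = F := by
  refine Observable.ext_of_prod fun X Y hX hY => clm_ext_diag fun φ => ?_
  have hunit : ∀ ψ : Mode, ‖ψ‖ = 1 →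
      ⟪ψ, E.effect (X ×ˢ Y) ψ⟫_ℂ = ⟪ψ, F.effect (X ×ˢ Y) ψ⟫_ℂ := fun ψ hψ => by
    have h1 := (hE _ (isState_rankOne hψ) X Y hX hY).trans
      (hF _ (isState_rankOne hψ) X Y hX hY).symm
    rw [(isDecomposition_rankOne ψ).trace_comp, (isDecomposition_rankOne ψ).trace_comp] at h1
    simpa using h1
  by_cases h0 : φ = 0
  · simp [h0]
  have h2 := hunit (((‖φ‖⁻¹ : ℝ) : ℂ) • φ) (by
    rw [norm_smul, Complex.norm_real, norm_inv, norm_norm, inv_mul_cancel₀ (norm_ne_zero_iff.2 h0)])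
  simp only [map_smul, inner_smul_left, inner_smul_right] at h2
  have h3 : ((‖φ‖⁻¹ : ℝ) : ℂ) ≠ 0 := by
    exact_mod_cast inv_ne_zero (norm_ne_zero_iff.2 h0)
  rw [Complex.conj_ofReal] at h2
  exact mul_left_cancel₀ h3 (mul_left_cancel₀ h3 h2)

/-- Weak convergence of all diagonal measures implies convergence of the partial expectations weakly
in the sense of probabilities. -/
theorem tendstoWeaklyInProbability_of_measure [TopologicalSpace Ω] [OpensMeasurableSpace Ω]
    {Pk : ℕ → Set Ω → HTensor Mode Mode →L[ℂ] HTensor Mode Mode}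
    {lamk : ℕ → HTensor Mode Mode → Measure Ω} {E : ℕ → Observable Ω} {M : Observable Ω}
    (hv : HasSum (fun j => ‖v j‖ ^ 2) 1)
    (hk : ∀ k, IsPOVM (Pk k) (lamk k)) (h : IsPOVM P lam)
    (hE : ∀ k, IsReduction v (Pk k) (E k)) (hM : IsReduction v P M)
    (hconv : ∀ Φ Z, MeasurableSet Z → lam Φ (frontier Z) = 0 →
      Tendsto (fun k => (lamk k Φ Z).toReal) atTop (𝓝 (lam Φ Z).toReal)) :
    Observable.TendstoWeaklyInProbability E M := by
  intro Z hZ h0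
  refine ContinuousLinearMapWOT.tendsto_iff_forall_inner_apply_tendsto.2 fun ψ φ => ?_
  refine tendsto_inner_of_tendsto_diag (B := fun k => (E k).effect Z) (A := M.effect Z)
    (fun φ => ?_) φ ψ
  -- A vanishing sum of nonnegative terms: the boundary is null for every component, so convergence
  -- applies to each `j`.
  have hfr : ∀ j, lam (htmul φ (v j)) (frontier Z) = 0 := fun j => by
    have h1 := hM.law_apply h hv φ
    have h2 := M.law_eq φ (isClosed_frontier (s := Z)).measurableSet
    rw [h0, h1, reducedLaw, Measure.sum_apply _ isClosed_frontier.measurableSet] at h2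
    simp only [_root_.zero_apply, inner_zero_right, Complex.zero_re, ENNReal.ofReal_zero,
      ENNReal.tsum_eq_zero] at h2
    exact h2 j
  have e1 : ∀ k, ⟪φ, (E k).effect Z φ⟫_ℂ =
      ∑' j, ((lamk k (htmul φ (v j)) Z).toReal : ℂ) := fun k => by
    rw [← (hE k Z hZ φ φ).tsum_eq]
    exact tsum_congr fun j => (hk k).inner_eq Z hZ _
  have e2 : ⟪φ, M.effect Z φ⟫_ℂ = ∑' j, ((lam (htmul φ (v j)) Z).toReal : ℂ) := by
    rw [← (hM Z hZ φ φ).tsum_eq]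
    exact tsum_congr fun j => h.inner_eq Z hZ _
  simp only [e1, e2]
  -- The bound is the total mass of the `j`-th law, the same for all `k`.
  refine tendsto_tsum_of_dominated_convergence (bound := fun j => ‖φ‖ ^ 2 * ‖v j‖ ^ 2)
    (hv.summable.mul_left _) (fun j => ?_) (.of_forall fun k j => ?_)
  · exact (Complex.continuous_ofReal.tendsto _).comp (hconv _ Z hZ (hfr j))
  · rw [Complex.norm_real, Real.norm_of_nonneg ENNReal.toReal_nonneg, ← mul_pow, ← norm_htmul]
    refine ENNReal.toReal_le_of_le_ofReal (by positivity) ?_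
    rw [← (hk k).total]
    exact measure_mono (subset_univ _)

end Reduction

/-! ## Multiplication operators -/

section Multiplication

variable {Ω : Type*} [MeasurableSpace Ω] {μ : Measure Ω}

theorem exists_mulOp (f : Ω → ℂ) (hf : AEStronglyMeasurable f μ) (h1 : ∀ x, ‖f x‖ ≤ 1) :
    ∃ T : Lp ℂ 2 μ →L[ℂ] Lp ℂ 2 μ, ‖T‖ ≤ 1 ∧ ∀ ψ, T ψ =ᵐ[μ] fun x => f x * ψ x := by
  have hle : ∀ (ψ : Lp ℂ 2 μ) x, ‖f x * ψ x‖ ≤ ‖ψ x‖ := fun ψ x => by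
    rw [norm_mul]; exact mul_le_of_le_one_left (norm_nonneg _) (h1 x)
  have hmem : ∀ ψ : Lp ℂ 2 μ, MemLp (fun x => f x * ψ x) 2 μ := fun ψ =>
    (Lp.memLp ψ).of_le (hf.mul (Lp.aestronglyMeasurable ψ)) (.of_forall (hle ψ))
  have hlin : ∀ ψ : Lp ℂ 2 μ, ‖(hmem ψ).toLp _‖ ≤ 1 * ‖ψ‖ := fun ψ => by
    rw [one_mul]
    refine Lp.norm_le_norm_of_ae_le ?_
    filter_upwards [(hmem ψ).coeFn_toLp] with x hx
    rw [hx]; exact hle ψ x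
  refine ⟨LinearMap.mkContinuous
    { toFun := fun ψ => (hmem ψ).toLp _
      map_add' := fun φ ψ => by
        apply Lp.ext
        filter_upwards [(hmem (φ + ψ)).coeFn_toLp, (hmem φ).coeFn_toLp, (hmem ψ).coeFn_toLp,
          Lp.coeFn_add φ ψ, Lp.coeFn_add ((hmem φ).toLp _) ((hmem ψ).toLp _)] with x h1 h2 h3 h4 h5
        rw [h1, h5, Pi.add_apply, h2, h3, h4, Pi.add_apply, mul_add]
      map_smul' := fun c ψ => by
        apply Lp.ext
        filter_upwards [(hmem (c • ψ)).coeFn_toLp, (hmem ψ).coeFn_toLp, Lp.coeFn_smul c ψ,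
          Lp.coeFn_smul c ((hmem ψ).toLp _)] with x h1 h2 h3 h4
        rw [h1, RingHom.id_apply, h4, Pi.smul_apply, h2, h3, Pi.smul_apply, smul_eq_mul,
          smul_eq_mul, mul_left_comm] } 1 hlin, ?_, fun ψ => ?_⟩
  · exact LinearMap.mkContinuous_norm_le _ zero_le_one _
  · exact (hmem ψ).coeFn_toLp

/-- A pointwise formula for a bounded operator into `L²` can be tested on a total family. -/
theorem IsTotal.ae_eq_of_forall {K ι : Type*} [NormedAddCommGroup K] [InnerProductSpace ℂ K]
    {x : ι → K} (hx : IsTotal x) (L : K →L[ℂ] Lp ℂ 2 μ) (g : Ω → K →L[ℂ] ℂ)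
    (h : ∀ i, L (x i) =ᵐ[μ] fun w => g w (x i)) (φ : K) : L φ =ᵐ[μ] fun w => g w φ := by
  let p : Submodule ℂ K :=
    { carrier := {φ | L φ =ᵐ[μ] fun w => g w φ}
      add_mem' := fun {a b} ha hb => by
        simp only [Set.mem_ofPred_eq, map_add] at *
        exact (Lp.coeFn_add _ _).trans (ha.add hb)
      zero_mem' := by
        simp only [Set.mem_ofPred_eq, map_zero]
        exact Lp.coeFn_zero _ _ _
      smul_mem' := fun c a ha => by
        simp only [Set.mem_ofPred_eq, map_smul] at *
        exact (Lp.coeFn_smul _ _).trans (ha.const_smul c) }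
  refine hx.mem_closed (p := p) ?_ h φ
  rw [← closure_subset_iff_isClosed]
  intro ψ hψ
  obtain ⟨u, hu, hlim⟩ := mem_closure_iff_seq_limit.1 hψ
  have h1 : Tendsto (fun n => L (u n)) atTop (𝓝 (L ψ)) := (L.continuous.tendsto ψ).comp hlim
  -- Convergence in `L²` gives almost everywhere convergence only along a subsequence, which is
  -- enough to identify the limit.
  have h2 := tendstoInMeasure_of_tendsto_Lp (p := 2) h1
  obtain ⟨ns, hns, h3⟩ := h2.exists_seq_tendsto_ae
  change L ψ =ᵐ[μ] fun w => g w ψ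
  have h4 : ∀ᵐ w ∂μ, ∀ n, L (u n) w = g w (u n) := ae_all_iff.2 fun n => hu n
  filter_upwards [h3, h4] with w h5 h6
  refine tendsto_nhds_unique h5 ?_
  simp only [h6]
  exact (((g w).continuous.tendsto ψ).comp hlim).comp hns.tendsto_atTop

end Multiplication

/-! ## The phase space transform -/

section PhaseSpace

open ContinuousLinearMap

theorem conjugation_expVec (β : ℂ) : conjugation (expVec β) = expVec ((starRingEnd ℂ) β) := by
  apply Lp.ext
  change (star (expVec β) : Mode) =ᵐ[volume] _
  filter_upwards [Lp.coeFn_star (expVec β), coeFn_expVec β, coeFn_expVec ((starRingEnd ℂ) β)]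
    with x h1 h2 h3
  rw [h1, Pi.star_apply, h2, h3, ← conj_expFun]
  rfl

/-- Both sides are the symmetric bilinear integral `∫ φ ψ`. -/
theorem inner_conjugation (φ ψ : Mode) : ⟪conjugation φ, ψ⟫_ℂ = ⟪conjugation ψ, φ⟫_ℂ := by
  rw [L2.inner_def, L2.inner_def]
  refine integral_congr_ae ?_
  have h1 : ∀ χ : Mode, conjugation χ =ᵐ[volume] fun x => (starRingEnd ℂ) (χ x) :=
    fun χ => Lp.coeFn_star χ
  filter_upwards [h1 φ, h1 ψ] with x h2 h3
  rw [h2, h3, RCLike.inner_apply, RCLike.inner_apply, Complex.conj_conj, Complex.conj_conj, mul_comm]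

theorem coeFn_weyl (q p : ℝ) (ψ : Mode) : weyl q p ψ =ᵐ[volume] fun x : ℝ =>
    Complex.exp (Complex.I * q * p / 2) *
      (Complex.exp (Complex.I * p * ((x - q : ℝ) : ℂ)) * ψ (x - q)) := by
  have hq := measurePreserving_sub_right (volume : Measure ℝ) q
  have h1 : modulation p ψ =ᵐ[volume] fun x : ℝ => Complex.exp (Complex.I * p * x) * ψ x :=
    (memLp_modulation p ψ).coeFn_toLp
  have h2 : translation q (modulation p ψ) =ᵐ[volume] (modulation p ψ) ∘ fun x : ℝ => x - q :=
    Lp.coeFn_compMeasurePreserving _ hq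
  filter_upwards [Lp.coeFn_smul (Complex.exp (Complex.I * q * p / 2))
    (translation q (modulation p ψ)), h2, hq.quasiMeasurePreserving.ae_eq_comp h1] with x h3 h4 h5
  have h6 : weyl q p ψ = Complex.exp (Complex.I * q * p / 2) • translation q (modulation p ψ) := rfl
  rw [h6, h3, Pi.smul_apply, h4, h5, smul_eq_mul]
  rfl

/-- The complex phase space coordinate `(q + i p) / √2`. -/
def phasePoint (w : ℝ × ℝ) : ℂ := (w.1 + Complex.I * w.2) / Real.sqrt 2

theorem weyl_expVec (w : ℝ × ℝ) (z : ℂ) : weyl w.1 w.2 (expVec z) =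
    Complex.exp (-((starRingEnd ℂ) (phasePoint w) * phasePoint w / 2)
      - (starRingEnd ℂ) (phasePoint w) * z) • expVec (z + phasePoint w) := by
  obtain ⟨q, p⟩ := w
  have hq := measurePreserving_sub_right (volume : Measure ℝ) q
  apply Lp.ext
  filter_upwards [coeFn_weyl q p (expVec z), hq.quasiMeasurePreserving.ae_eq_comp (coeFn_expVec z),
    Lp.coeFn_smul (Complex.exp (-((starRingEnd ℂ) (phasePoint (q, p)) * phasePoint (q, p) / 2)
      - (starRingEnd ℂ) (phasePoint (q, p)) * z)) (expVec (z + phasePoint (q, p))),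
    coeFn_expVec (z + phasePoint (q, p))] with x h1 h2 h3 h4
  simp only [Function.comp] at h2
  rw [h1, h2, h3, Pi.smul_apply, h4, smul_eq_mul, expFun, expFun]
  have hexp : ∀ P a b c d e : ℂ, a + b + c = d + e → Complex.exp a * (Complex.exp b *
      (P * Complex.exp c)) = Complex.exp d * (P * Complex.exp e) := fun P a b c d e h => by
    have h1 : Complex.exp a * (Complex.exp b * (P * Complex.exp c)) =
      P * Complex.exp (a + b + c) := by simp only [Complex.exp_add]; ring
    rw [h1, h, Complex.exp_add]; ring
  refine hexp _ _ _ _ _ _ ?_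
  have hs := sqrt_two_sq
  have h0 : (Real.sqrt 2 : ℂ) ≠ 0 := fun h0 => by simp [h0] at hs
  have hI := Complex.I_sq
  simp only [phasePoint, map_div₀, map_add, map_mul, Complex.conj_ofReal, Complex.conj_I,
    Complex.ofReal_sub]
  generalize (Real.sqrt 2 : ℂ) = s at *
  have h6 : ∀ a : ℂ, a / s = a * s / 2 := fun a => by
    rw [div_eq_div_iff h0 two_ne_zero, ← hs]; ring
  simp only [h6]
  linear_combination ( (1/4)*(q:ℂ)^2 + (-1/2)*(q:ℂ)*(x:ℂ) + (-1/2)*(p:ℂ)*(x:ℂ)*Complex.I +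
    (1/4)*(p:ℂ)*(q:ℂ)*Complex.I ) * hs + ( 0 ) * hI

/-- The function `(q, p) ↦ ⟪W_{qp} C v, φ⟫`, as a bounded linear functional of `φ`. -/
def phaseFunctional (v : Mode) (w : ℝ × ℝ) : Mode →L[ℂ] ℂ :=
  ((Real.sqrt (2 * Real.pi) : ℝ) : ℂ)⁻¹ • innerSL ℂ (weyl w.1 w.2 (conjugation v))

theorem phaseFunctional_apply (v φ : Mode) (w : ℝ × ℝ) : phaseFunctional v w φ =
    ((Real.sqrt (2 * Real.pi) : ℝ) : ℂ)⁻¹ * ⟪weyl w.1 w.2 (conjugation v), φ⟫_ℂ := rfl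

/-- The function `(q, p) ↦ ⟪W_{qp} C v, φ⟫`, as a bounded linear functional of `v`. -/
def phaseFunctional' (φ : Mode) (w : ℝ × ℝ) : Mode →L[ℂ] ℂ :=
  ((Real.sqrt (2 * Real.pi) : ℝ) : ℂ)⁻¹ • innerSL ℂ (conjugation (adjoint (weyl w.1 w.2) φ))

theorem phaseFunctional'_apply (v φ : Mode) (w : ℝ × ℝ) :
    phaseFunctional' φ w v = phaseFunctional v w φ := by
  change ((Real.sqrt (2 * Real.pi) : ℝ) : ℂ)⁻¹ * ⟪conjugation (adjoint (weyl w.1 w.2) φ), v⟫_ℂ = _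
  rw [inner_conjugation, adjoint_inner_right, phaseFunctional_apply]

theorem memLp_wideGauss (a : ℂ) :
    MemLp (fun x : ℝ => Complex.exp (-(x : ℂ) ^ 2 / 4 + a * x)) 2 (volume : Measure ℝ) := by
  rw [memLp_two_iff_integrable_sq_norm (Continuous.aestronglyMeasurable (by fun_prop))]
  have h := (integrable_cexp_quadratic' (b := -(1 / 2)) (by norm_num) (2 * a) 0).norm
  refine h.congr (.of_forall fun x => ?_)
  simp only [Complex.norm_exp, ← Real.exp_nat_mul]
  congr 1
  have h2 : ∀ y : ℂ, ((2 : ℕ) : ℝ) * y.re = (2 * y).re := fun y => by simp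
  rw [h2]
  congr 1
  ring

/-- The function `exp(-x² / 4 + a x)` in `L²(ℝ)`. -/
def wideGauss (a : ℂ) : Mode := (memLp_wideGauss a).toLp _

theorem coeFn_wideGauss (a : ℂ) :
    wideGauss a =ᵐ[volume] fun x : ℝ => Complex.exp (-(x : ℂ) ^ 2 / 4 + a * x) :=
  MemLp.coeFn_toLp _

theorem inner_wideGauss (a b : ℂ) : ⟪wideGauss a, wideGauss b⟫_ℂ =
    (Real.sqrt (2 * Real.pi) : ℝ) * Complex.exp (((starRingEnd ℂ) a + b) ^ 2 / 2) := by
  rw [L2.inner_def]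
  have h : ∀ᵐ x, ⟪wideGauss a x, wideGauss b x⟫_ℂ =
      Complex.exp (-(1 / 2) * (x : ℂ) ^ 2 + ((starRingEnd ℂ) a + b) * x + 0) := by
    filter_upwards [coeFn_wideGauss a, coeFn_wideGauss b] with x h1 h2
    rw [h1, h2, RCLike.inner_apply, ← Complex.exp_conj, ← Complex.exp_add]
    congr 1
    simp only [map_add, map_mul, map_div₀, map_neg, map_pow, Complex.conj_ofReal, map_ofNat]
    ring
  rw [integral_congr_ae h, integral_cexp_quadratic (by norm_num), Real.sqrt_eq_rpow,
    Complex.ofReal_cpow (by positivity)]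
  congr 2
  · push_cast; ring
  · push_cast; rfl
  · ring

/-- The phase space transform of `e(α) ⊗ e(β)`, weighted by `exp(i (s q + t p))`. -/
def phaseGauss (s t : ℝ) (α β : ℂ) : Lp ℂ 2 (volume : Measure (ℝ × ℝ)) :=
  (((Real.sqrt (2 * Real.pi) : ℝ) : ℂ)⁻¹ * Complex.exp (α * β)) •
    prodFun (wideGauss ((α - β) / Real.sqrt 2 + Complex.I * s))
      (wideGauss (-Complex.I * (α + β) / Real.sqrt 2 + Complex.I * t))

/-- By the displacement formula `weyl_expVec` the exponent is `-(q² + p²) / 4` plus terms linear in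
`q` and `p`, so the function factors into one Gaussian in each variable. -/
theorem coeFn_phaseGauss (s t : ℝ) (α β : ℂ) : phaseGauss s t α β =ᵐ[volume] fun w : ℝ × ℝ =>
    Complex.exp (Complex.I * (s * w.1 + t * w.2)) * phaseFunctional (expVec β) w (expVec α) := by
  filter_upwards [Lp.coeFn_smul (((Real.sqrt (2 * Real.pi) : ℝ) : ℂ)⁻¹ * Complex.exp (α * β))
    (prodFun (wideGauss ((α - β) / Real.sqrt 2 + Complex.I * s))
      (wideGauss (-Complex.I * (α + β) / Real.sqrt 2 + Complex.I * t))), coeFn_prodFun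
    (wideGauss ((α - β) / Real.sqrt 2 + Complex.I * s))
      (wideGauss (-Complex.I * (α + β) / Real.sqrt 2 + Complex.I * t)),
    ae_fst (coeFn_wideGauss ((α - β) / Real.sqrt 2 + Complex.I * s)),
    ae_snd (coeFn_wideGauss (-Complex.I * (α + β) / Real.sqrt 2 + Complex.I * t))] with w h1 h2 h3 h4
  rw [phaseGauss, h1, Pi.smul_apply, h2, h3, h4, smul_eq_mul, phaseFunctional_apply,
    conjugation_expVec, weyl_expVec, inner_smul_left, inner_expVec, ← Complex.exp_conj]
  have hexp : ∀ P a b c d e f : ℂ, a + b + c = d + e + f → P * Complex.exp a * (Complex.exp b *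
      Complex.exp c) = Complex.exp d * (P * (Complex.exp e * Complex.exp f)) :=
    fun P a b c d e f h => by
    have h1 : P * Complex.exp a * (Complex.exp b * Complex.exp c) =
      P * Complex.exp (a + b + c) := by simp only [Complex.exp_add]; ring
    rw [h1, h, Complex.exp_add, Complex.exp_add]; ring
  refine hexp _ _ _ _ _ _ _ ?_
  have hs := sqrt_two_sq
  have h0 : (Real.sqrt 2 : ℂ) ≠ 0 := fun h0 => by simp [h0] at hs
  have hI := Complex.I_sq
  simp only [phasePoint, map_div₀, map_add, map_sub, map_neg, map_mul, Complex.conj_ofReal,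
    Complex.conj_I, Complex.conj_conj, map_ofNat]
  generalize (Real.sqrt 2 : ℂ) = r at *
  have h6 : ∀ a : ℂ, a / r = a * r / 2 := fun a => by
    rw [div_eq_div_iff h0 two_ne_zero, ← hs]; ring
  simp only [h6]
  linear_combination ( (1/8)*(w.1:ℂ)^2 + (-1/8)*(w.2:ℂ)^2*Complex.I^2 ) * hs + (
    (-1/4)*(w.2:ℂ)^2 ) * hI

/-- The first factor is the Gram kernel of `e(α) ⊗ e(β)`, which is all that remains at `s = t = 0`
and yields the isometry `J`. The second factor supplies the characteristic function of `|J Φ|²`. -/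
theorem inner_phaseGauss (s t : ℝ) (α β α' β' : ℂ) :
    ⟪phaseGauss 0 0 α' β', phaseGauss s t α β⟫_ℂ =
      Complex.exp ((starRingEnd ℂ) α' * α + (starRingEnd ℂ) β' * β) *
      Complex.exp (-((s : ℂ) ^ 2 + t ^ 2) / 2 +
        Complex.I * s * ((starRingEnd ℂ) α' - (starRingEnd ℂ) β' + α - β) / Real.sqrt 2 -
        t * ((starRingEnd ℂ) α' + (starRingEnd ℂ) β' - α - β) / Real.sqrt 2) := by
  have hp : ((Real.sqrt (2 * Real.pi) : ℝ) : ℂ) ≠ 0 := by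
    have : Real.sqrt (2 * Real.pi) ≠ 0 := by positivity
    exact_mod_cast this
  rw [phaseGauss, phaseGauss, inner_smul_left, inner_smul_right, inner_prodFun, inner_wideGauss,
    inner_wideGauss]
  simp only [map_mul, map_inv₀, Complex.conj_ofReal, ← Complex.exp_conj]
  have hexp : ∀ P a b c d e f : ℂ, P ≠ 0 → a + b + c + d = e + f → P⁻¹ * Complex.exp a *
      (P⁻¹ * Complex.exp b * (P * Complex.exp c * (P * Complex.exp d))) =
        Complex.exp e * Complex.exp f := fun P a b c d e f hP h => by
    rw [← Complex.exp_add e f, ← h]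
    simp only [Complex.exp_add]; field_simp
  refine hexp _ _ _ _ _ _ _ hp ?_
  have hs := sqrt_two_sq
  have h0 : (Real.sqrt 2 : ℂ) ≠ 0 := fun h0 => by simp [h0] at hs
  have hI := Complex.I_sq
  simp only [map_div₀, map_add, map_sub, map_neg, map_mul, Complex.conj_ofReal,
    Complex.conj_I, Complex.ofReal_zero, mul_zero, add_zero]
  generalize (Real.sqrt 2 : ℂ) = r at *
  have h6 : ∀ a : ℂ, a / r = a * r / 2 := fun a => by
    rw [div_eq_div_iff h0 two_ne_zero, ← hs]; ring
  simp only [h6]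
  linear_combination ( (1/8)*(starRingEnd ℂ) α'^2 + (-1/4)*(starRingEnd ℂ) α'*(starRingEnd ℂ) β'
    + (1/4)*(starRingEnd ℂ) α'*α + (-1/4)*(starRingEnd ℂ) α'*β + (1/8)*(starRingEnd ℂ) β'^2 +
    (-1/4)*(starRingEnd ℂ) β'*α + (1/4)*(starRingEnd ℂ) β'*β + (1/8)*α^2 + (-1/4)*α*β +
    (1/8)*β^2 + (1/8)*(starRingEnd ℂ) α'^2*Complex.I^2 + (1/4)*(starRingEnd ℂ) α'*(starRingEnd
    ℂ) β'*Complex.I^2 + (-1/4)*(starRingEnd ℂ) α'*Complex.I^2*α + (-1/4)*(starRingEnd ℂ)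
    α'*Complex.I^2*β + (1/8)*(starRingEnd ℂ) β'^2*Complex.I^2 + (-1/4)*(starRingEnd ℂ)
    β'*Complex.I^2*α + (-1/4)*(starRingEnd ℂ) β'*Complex.I^2*β + (1/8)*Complex.I^2*α^2 +
    (1/4)*Complex.I^2*α*β + (1/8)*Complex.I^2*β^2 ) * hs + ( (1/2)*(s:ℂ)^2 + (1/2)*(starRingEnd
    ℂ) α'*(t:ℂ)*r + (1/2)*(starRingEnd ℂ) β'*(t:ℂ)*r + (-1/2)*(t:ℂ)*r*α + (-1/2)*(t:ℂ)*r*β +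
    (1/2)*(t:ℂ)^2 + (1/4)*(starRingEnd ℂ) α'^2 + (1/2)*(starRingEnd ℂ) α'*(starRingEnd ℂ) β' +
    (-1/2)*(starRingEnd ℂ) α'*α + (-1/2)*(starRingEnd ℂ) α'*β + (1/4)*(starRingEnd ℂ) β'^2 +
    (-1/2)*(starRingEnd ℂ) β'*α + (-1/2)*(starRingEnd ℂ) β'*β + (1/4)*α^2 + (1/2)*α*β +
    (1/4)*β^2 ) * hI

theorem isTotal_expVec_htmul : IsTotal fun p : ℂ × ℂ => htmul (expVec p.1) (expVec p.2) :=
  isTotal_expVec.htmul isTotal_expVec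

/-- The phase space transform: an isometry `J` with `J (φ ⊗ v) (q, p) = ⟪W_{qp} C v, φ⟫ / √(2π)`. -/
theorem exists_phaseTransform : ∃ J : HTensor Mode Mode →ₗᵢ[ℂ] Lp ℂ 2 (volume : Measure (ℝ × ℝ)),
    (∀ α β, J (htmul (expVec α) (expVec β)) = phaseGauss 0 0 α β) ∧
    ∀ φ v, J (htmul φ v) =ᵐ[volume] fun w => phaseFunctional v w φ := by
  obtain ⟨J, hJ⟩ := exists_isometry_of_gram isTotal_expVec_htmul
    (fun p : ℂ × ℂ => phaseGauss 0 0 p.1 p.2) fun p p' => by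
      rw [inner_phaseGauss, inner_htmul, inner_expVec, inner_expVec, ← Complex.exp_add]
      simp
  have h0 : ∀ α β, J (htmul (expVec α) (expVec β)) =ᵐ[volume]
      fun w => phaseFunctional (expVec β) w (expVec α) := fun α β => by
    rw [hJ (α, β)]
    filter_upwards [coeFn_phaseGauss 0 0 α β] with w h1
    simpa using h1
  -- The formula is extended in `φ` with `e(β)` fixed, and afterwards in `v`, where
  -- `phaseFunctional'` makes it a bounded linear functional of `v`.
  have h1 : ∀ φ β, J (htmul φ (expVec β)) =ᵐ[volume]
      fun w => phaseFunctional (expVec β) w φ := fun φ β =>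
    isTotal_expVec.ae_eq_of_forall
      (J.toContinuousLinearMap ∘L (htmulL Mode Mode).flip (expVec β)) _ (fun α => h0 α β) φ
  refine ⟨J, fun α β => hJ (α, β), fun φ v => ?_⟩
  have h2 := isTotal_expVec.ae_eq_of_forall
      (J.toContinuousLinearMap ∘L htmulL Mode Mode φ) (phaseFunctional' φ) (fun β => by
        simp only [phaseFunctional'_apply]
        exact h1 φ β) v
  simp only [phaseFunctional'_apply] at h2
  exact h2

end PhaseSpace

/-! ## Photon detection -/

section Detection

open ContinuousLinearMap

/-- The probability that a detector of efficiency `ε` counts `n` of `m` photons. -/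
def binWeight (ε : ℝ) (m n : ℕ) : ℝ := m.choose n * ε ^ n * (1 - ε) ^ (m - n)

theorem binWeight_nonneg {ε : ℝ} (h : 0 < ε ∧ ε ≤ 1) (m n : ℕ) : 0 ≤ binWeight ε m n := by
  have h1 : 0 ≤ 1 - ε := by linarith [h.2]
  have h2 := h.1.le
  unfold binWeight
  positivity

/-- The binomial theorem; the terms with `n > m` have zero binomial coefficient, so truncated
subtraction in `m - n` does no harm. The generating function is the eigenvalue of `c^N` with `c = 1
- ε + ε u`. -/
theorem hasSum_binWeight_mul_pow (ε : ℝ) (m : ℕ) (u : ℂ) :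
    HasSum (fun n => (binWeight ε m n : ℂ) * u ^ n) ((1 - ε + ε * u) ^ m) := by
  have h : ((1 : ℂ) - ε + ε * u) ^ m =
      ∑ n ∈ Finset.range (m + 1), (binWeight ε m n : ℂ) * u ^ n := by
    rw [add_comm, add_pow]
    refine Finset.sum_congr rfl fun n _ => ?_
    rw [binWeight]
    push_cast
    ring
  rw [h]
  refine hasSum_sum_of_ne_finset_zero fun n hn => ?_
  rw [Finset.mem_range, not_lt] at hn
  simp [binWeight, Nat.choose_eq_zero_of_lt (show m < n by omega)]

theorem hasSum_binWeight (ε : ℝ) (m : ℕ) : HasSum (binWeight ε m) 1 := by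
  have h := hasSum_binWeight_mul_pow ε m 1
  simp only [one_pow, mul_one, sub_add_cancel] at h
  exact Complex.hasSum_ofReal.1 (by simpa using h)

theorem detection_numberState {ε : ℝ} (h : 0 < ε ∧ ε ≤ 1) (n m : ℕ) :
    detection ε n (numberState m) = (binWeight ε m n : ℂ) • numberState m := by
  have hle : ∀ m, binWeight ε m n ≤ 1 := fun m =>
    le_hasSum (hasSum_binWeight ε m) n fun k _ => binWeight_nonneg h m k
  obtain ⟨T, -, hT⟩ := exists_diagonal numberBasis (fun m => (binWeight ε m n : ℂ)) fun m => by
    rw [Complex.norm_real, Real.norm_of_nonneg (binWeight_nonneg h m n)]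
    exact hle m
  have h1 := hasSum_diagonal numberBasis (A := fun m => ((binWeight ε m n : ℝ) : ℂ) •
      InnerProductSpace.rankOne ℂ (numberState m) (numberState m))
    (d := fun a i => if a = i then binWeight ε a n else 0) (s := fun m => binWeight ε m n) (T := T)
    (fun a i => by
      rw [numberBasis_apply, _root_.smul_apply, InnerProductSpace.rankOne_apply,
        orthonormal_iff_ite.1 orthonormal_numberState]
      by_cases hai : a = i
      · subst hai; simp
      · simp [hai])
    (fun a i => by split_ifs; exacts [binWeight_nonneg h _ _, le_rfl])
    (fun i => by
      refine (hasSum_ite_eq i (binWeight ε i n)).congr_fun fun a => ?_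
      by_cases hai : a = i
      · subst hai; simp
      · simp [hai]) hle hT
  have h2 : detection ε n = T := by
    rw [detection]
    exact congrArg ContinuousLinearMapWOT.toCLM h1.tsum_eq
  rw [h2, ← numberBasis_apply]
  exact hT m

/-! ### Number bases and the count difference of a pair of detectors -/

theorem exists_pairBasis : ∃ e : HilbertBasis (ℕ × ℕ) ℂ (HTensor Mode Mode),
    ∀ m, e m = htmul (numberState m.1) (numberState m.2) := by
  simpa only [numberBasis_apply] using exists_tensorBasis numberBasis numberBasis

/-- The Hilbert basis of number states of two modes. -/
def pairBasis : HilbertBasis (ℕ × ℕ) ℂ (HTensor Mode Mode) := exists_pairBasis.choose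

theorem pairBasis_apply (m : ℕ × ℕ) : pairBasis m = htmul (numberState m.1) (numberState m.2) :=
  exists_pairBasis.choose_spec m

theorem exists_fourBasis : ∃ e : HilbertBasis ((ℕ × ℕ) × (ℕ × ℕ)) ℂ FourMode,
    ∀ m, e m = htmul (pairBasis m.1) (pairBasis m.2) :=
  exists_tensorBasis pairBasis pairBasis

/-- The Hilbert basis of number states of four modes. -/
def fourBasis : HilbertBasis ((ℕ × ℕ) × (ℕ × ℕ)) ℂ FourMode := exists_fourBasis.choose

theorem fourBasis_apply (m : (ℕ × ℕ) × (ℕ × ℕ)) :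
    fourBasis m = htmul (pairBasis m.1) (pairBasis m.2) :=
  exists_fourBasis.choose_spec m

/-- The joint count probabilities of two detectors for given photon numbers `m`. -/
def pairWeight (ε₁ ε₂ : ℝ) (m a : ℕ × ℕ) : ℝ := binWeight ε₁ m.1 a.1 * binWeight ε₂ m.2 a.2

theorem hasSum_pairWeight_mul (ε₁ ε₂ : ℝ) (m : ℕ × ℕ) (u w : ℂ) :
    HasSum (fun a : ℕ × ℕ => (pairWeight ε₁ ε₂ m a : ℂ) * (u ^ a.1 * w ^ a.2))
      ((1 - ε₁ + ε₁ * u) ^ m.1 * (1 - ε₂ + ε₂ * w) ^ m.2) := by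
  have h1 := hasSum_binWeight_mul_pow ε₁ m.1 u
  have h2 := hasSum_binWeight_mul_pow ε₂ m.2 w
  have h3 := summable_mul_of_summable_norm h1.summable.norm h2.summable.norm
  have h4 := HasSum.mul h1 h2 h3
  refine h4.congr_fun fun a => ?_
  rw [pairWeight, Complex.ofReal_mul]
  exact mul_mul_mul_comm _ _ _ _

theorem hasSum_pairWeight (ε₁ ε₂ : ℝ) (m : ℕ × ℕ) : HasSum (pairWeight ε₁ ε₂ m) 1 := by
  have h := hasSum_pairWeight_mul ε₁ ε₂ m 1 1
  simp only [one_pow, mul_one, sub_add_cancel] at h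
  exact Complex.hasSum_ofReal.1 (by simpa using h)

theorem pairWeight_nonneg {ε₁ ε₂ : ℝ} (h₁ : 0 < ε₁ ∧ ε₁ ≤ 1) (h₂ : 0 < ε₂ ∧ ε₂ ≤ 1)
    (m a : ℕ × ℕ) : 0 ≤ pairWeight ε₁ ε₂ m a :=
  mul_nonneg (binWeight_nonneg h₁ _ _) (binWeight_nonneg h₂ _ _)

/-- The distribution of the scaled count difference for given photon numbers `m`. -/
def pairLaw (ε₁ ε₂ r : ℝ) (m : ℕ × ℕ) : Measure ℝ :=
  Measure.sum fun a : ℕ × ℕ => ENNReal.ofReal (pairWeight ε₁ ε₂ m a) •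
    Measure.dirac (r⁻¹ * (a.2 / ε₂ - a.1 / ε₁))

theorem pairLaw_apply (ε₁ ε₂ r : ℝ) (m : ℕ × ℕ) {X : Set ℝ} (hX : MeasurableSet X) :
    pairLaw ε₁ ε₂ r m X = ∑' a : ℕ × ℕ,
      {a : ℕ × ℕ | r⁻¹ * (a.2 / ε₂ - a.1 / ε₁) ∈ X}.indicator
        (fun a => ENNReal.ofReal (pairWeight ε₁ ε₂ m a)) a := by
  rw [pairLaw, Measure.sum_apply _ hX]
  refine tsum_congr fun a => ?_
  rw [Measure.smul_apply, Measure.dirac_apply' _ hX, smul_eq_mul]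
  by_cases ha : r⁻¹ * (a.2 / ε₂ - a.1 / ε₁) ∈ X <;> simp [Set.indicator, ha]

theorem isProbabilityMeasure_pairLaw {ε₁ ε₂ : ℝ} (h₁ : 0 < ε₁ ∧ ε₁ ≤ 1) (h₂ : 0 < ε₂ ∧ ε₂ ≤ 1)
    (r : ℝ) (m : ℕ × ℕ) : IsProbabilityMeasure (pairLaw ε₁ ε₂ r m) := by
  constructor
  rw [pairLaw_apply _ _ _ _ MeasurableSet.univ]
  simp only [mem_univ, Set.ofPred_true, indicator_univ]
  rw [← ENNReal.ofReal_tsum_of_nonneg (pairWeight_nonneg h₁ h₂ m)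
    (hasSum_pairWeight ε₁ ε₂ m).summable, (hasSum_pairWeight ε₁ ε₂ m).tsum_eq, ENNReal.ofReal_one]

theorem hasSum_pairLaw {ε₁ ε₂ : ℝ} (h₁ : 0 < ε₁ ∧ ε₁ ≤ 1) (h₂ : 0 < ε₂ ∧ ε₂ ≤ 1)
    (r : ℝ) (m : ℕ × ℕ) {X : Set ℝ} (hX : MeasurableSet X) :
    HasSum (fun a : {a : ℕ × ℕ // r⁻¹ * (a.2 / ε₂ - a.1 / ε₁) ∈ X} => pairWeight ε₁ ε₂ m a)
      (pairLaw ε₁ ε₂ r m X).toReal := by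
  have := isProbabilityMeasure_pairLaw h₁ h₂ r m
  have hne := measure_ne_top (pairLaw ε₁ ε₂ r m) X
  rw [pairLaw_apply _ _ _ _ hX] at hne ⊢
  have h3 := (ENNReal.summable_toReal hne).hasSum
  rw [← ENNReal.tsum_toReal_eq (ENNReal.ne_top_of_tsum_ne_top hne)] at h3
  refine (hasSum_subtype_iff_indicator (f := pairWeight ε₁ ε₂ m)
    (s := {a : ℕ × ℕ | r⁻¹ * (a.2 / ε₂ - a.1 / ε₁) ∈ X})).2 (h3.congr_fun fun a => ?_)
  by_cases ha : r⁻¹ * (a.2 / ε₂ - a.1 / ε₁) ∈ X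
  · simp [Set.indicator, ha, ENNReal.toReal_ofReal (pairWeight_nonneg h₁ h₂ m a)]
  · simp [Set.indicator, ha]

theorem differenceDetection_pairBasis {ε₁ ε₂ : ℝ} (h₁ : 0 < ε₁ ∧ ε₁ ≤ 1) (h₂ : 0 < ε₂ ∧ ε₂ ≤ 1)
    (r : ℝ) {X : Set ℝ} (hX : MeasurableSet X) (m : ℕ × ℕ) :
    differenceDetection ε₁ ε₂ r ((Real.sqrt 2)⁻¹ • X) (pairBasis m) =
      ((pairLaw ε₁ ε₂ r m X).toReal : ℂ) • pairBasis m := by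
  have hs : Real.sqrt 2 ≠ 0 := by positivity
  have hle : ∀ m, (pairLaw ε₁ ε₂ r m X).toReal ≤ 1 := fun m => by
    have := isProbabilityMeasure_pairLaw h₁ h₂ r m
    exact measureReal_le_one
  -- The scaling of `X` by `1 / √2` cancels the `√2` in the outcome, which is why `pairLaw` contains
  -- neither.
  have hmem : ∀ a : ℕ × ℕ, (Real.sqrt 2 * r)⁻¹ * (a.2 / ε₂ - a.1 / ε₁) ∈ (Real.sqrt 2)⁻¹ • X ↔
      r⁻¹ * (a.2 / ε₂ - a.1 / ε₁) ∈ X := fun a => by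
    rw [Set.mem_inv_smul_set_iff₀ hs, smul_eq_mul, mul_inv, mul_assoc, mul_inv_cancel_left₀ hs]
  obtain ⟨T, -, hT⟩ := exists_diagonal pairBasis
    (fun m => ((pairLaw ε₁ ε₂ r m X).toReal : ℂ)) fun m => by
      rw [Complex.norm_real, Real.norm_of_nonneg ENNReal.toReal_nonneg]
      exact hle m
  have hs1 : ∀ i, HasSum (fun a : {a : ℕ × ℕ // (Real.sqrt 2 * r)⁻¹ * (a.2 / ε₂ - a.1 / ε₁) ∈
      (Real.sqrt 2)⁻¹ • X} => pairWeight ε₁ ε₂ i a) (pairLaw ε₁ ε₂ r i X).toReal := fun i =>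
    ((Equiv.subtypeEquivRight hmem).hasSum_iff).2 (hasSum_pairLaw h₁ h₂ r i hX)
  have h1 := hasSum_diagonal pairBasis (A := fun a : {a : ℕ × ℕ //
      (Real.sqrt 2 * r)⁻¹ * (a.2 / ε₂ - a.1 / ε₁) ∈ (Real.sqrt 2)⁻¹ • X} =>
      opTensor (detection ε₁ a.1.1) (detection ε₂ a.1.2))
    (d := fun a i => pairWeight ε₁ ε₂ i a)
    (s := fun m => (pairLaw ε₁ ε₂ r m X).toReal) (T := T)
    (fun a i => by
      rw [pairBasis_apply, opTensor_htmul, detection_numberState h₁, detection_numberState h₂,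
        htmul_smul_left, htmul_smul_right, smul_smul, pairWeight]
      push_cast
      rfl)
    (fun a i => pairWeight_nonneg h₁ h₂ _ _) hs1 hle hT
  have h2 : differenceDetection ε₁ ε₂ r ((Real.sqrt 2)⁻¹ • X) = T := by
    rw [differenceDetection]
    exact congrArg ContinuousLinearMapWOT.toCLM h1.tsum_eq
  rw [h2]
  exact hT m

/-- The two counts are independent binomials, so this is a product of their generating functions at
opposite-signed phases. -/
theorem integral_pairLaw {ε₁ ε₂ : ℝ} (h₁ : 0 < ε₁ ∧ ε₁ ≤ 1) (h₂ : 0 < ε₂ ∧ ε₂ ≤ 1)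
    (r s : ℝ) (m : ℕ × ℕ) :
    ∫ x, Complex.exp (Complex.I * (s * x)) ∂(pairLaw ε₁ ε₂ r m) =
      (1 - ε₁ + ε₁ * Complex.exp (-(Complex.I * s / (r * ε₁)))) ^ m.1 *
        (1 - ε₂ + ε₂ * Complex.exp (Complex.I * s / (r * ε₂))) ^ m.2 := by
  have := isProbabilityMeasure_pairLaw h₁ h₂ r m
  have hint : Integrable (fun x : ℝ => Complex.exp (Complex.I * (s * x))) (pairLaw ε₁ ε₂ r m) := by
    refine Integrable.of_bound (Continuous.aestronglyMeasurable (by fun_prop)) 1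
      (.of_forall fun x => ?_)
    simp [Complex.norm_exp]
  have h3 := hasSum_integral_measure hint
  refine h3.unique ((hasSum_pairWeight_mul ε₁ ε₂ m _ _).congr_fun fun a => ?_)
  rw [integral_smul_measure, integral_dirac, ENNReal.toReal_ofReal (pairWeight_nonneg h₁ h₂ m a),
    ← Complex.exp_nat_mul, ← Complex.exp_nat_mul, ← Complex.exp_add, Complex.real_smul]
  congr 2
  push_cast
  simp only [div_eq_mul_inv, mul_inv]
  ring

/-! ### Outcome laws on the four modes -/

/-- The distribution of the outcomes of the two homodyne detectors for given photon numbers. -/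
def fourLaw (ε₁ ε₂ ε₃ ε₄ r : ℝ) (m : (ℕ × ℕ) × (ℕ × ℕ)) : Measure (ℝ × ℝ) :=
  (pairLaw ε₁ ε₃ r m.1).prod (pairLaw ε₂ ε₄ r m.2)

/-- The distribution of the outcomes of the two homodyne detectors in a vector of the four mode
space. -/
def outLaw (ε₁ ε₂ ε₃ ε₄ r : ℝ) (Ψ : FourMode) : Measure (ℝ × ℝ) :=
  Measure.sum fun m => ENNReal.ofReal (‖⟪fourBasis m, Ψ⟫_ℂ‖ ^ 2) • fourLaw ε₁ ε₂ ε₃ ε₄ r m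

theorem isProbabilityMeasure_fourLaw {ε₁ ε₂ ε₃ ε₄ : ℝ} (h₁ : 0 < ε₁ ∧ ε₁ ≤ 1) (h₂ : 0 < ε₂ ∧ ε₂ ≤ 1)
    (h₃ : 0 < ε₃ ∧ ε₃ ≤ 1) (h₄ : 0 < ε₄ ∧ ε₄ ≤ 1)
    (r : ℝ) (m : (ℕ × ℕ) × (ℕ × ℕ)) :
    IsProbabilityMeasure (fourLaw ε₁ ε₂ ε₃ ε₄ r m) := by
  have := isProbabilityMeasure_pairLaw h₁ h₃ r m.1
  have := isProbabilityMeasure_pairLaw h₂ h₄ r m.2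
  unfold fourLaw
  infer_instance

theorem outLaw_univ {ε₁ ε₂ ε₃ ε₄ : ℝ} (h₁ : 0 < ε₁ ∧ ε₁ ≤ 1) (h₂ : 0 < ε₂ ∧ ε₂ ≤ 1)
    (h₃ : 0 < ε₃ ∧ ε₃ ≤ 1) (h₄ : 0 < ε₄ ∧ ε₄ ≤ 1)
    (r : ℝ) (Ψ : FourMode) :
    outLaw ε₁ ε₂ ε₃ ε₄ r Ψ univ = ENNReal.ofReal (‖Ψ‖ ^ 2) := by
  have := isProbabilityMeasure_fourLaw h₁ h₂ h₃ h₄ r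
  rw [outLaw, Measure.sum_apply _ MeasurableSet.univ]
  simp only [Measure.smul_apply, measure_univ, smul_eq_mul, mul_one]
  have h := HilbertBasis.hasSum_norm_sq fourBasis Ψ
  rw [← ENNReal.ofReal_tsum_of_nonneg (fun m => by positivity) h.summable, h.tsum_eq]

theorem exists_outOp {ε₁ ε₂ ε₃ ε₄ : ℝ} (h₁ : 0 < ε₁ ∧ ε₁ ≤ 1) (h₂ : 0 < ε₂ ∧ ε₂ ≤ 1)
    (h₃ : 0 < ε₃ ∧ ε₃ ≤ 1) (h₄ : 0 < ε₄ ∧ ε₄ ≤ 1)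
    (r : ℝ) {Z : Set (ℝ × ℝ)} (hZ : MeasurableSet Z) :
    ∃ T : FourMode →L[ℂ] FourMode,
      (∀ m, T (fourBasis m) = ((fourLaw ε₁ ε₂ ε₃ ε₄ r m Z).toReal : ℂ) • fourBasis m) ∧
      ∀ Ψ, ⟪Ψ, T Ψ⟫_ℂ = ((outLaw ε₁ ε₂ ε₃ ε₄ r Ψ Z).toReal : ℂ) := by
  have hp := isProbabilityMeasure_fourLaw h₁ h₂ h₃ h₄ r
  obtain ⟨T, -, hT⟩ := exists_diagonal fourBasis
    (fun m => ((fourLaw ε₁ ε₂ ε₃ ε₄ r m Z).toReal : ℂ)) fun m => by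
      rw [Complex.norm_real, Real.norm_of_nonneg ENNReal.toReal_nonneg]
      exact measureReal_le_one
  refine ⟨T, hT, fun Ψ => (hasSum_inner_diagonal fourBasis hT Ψ Ψ).unique ?_⟩
  have hfin : outLaw ε₁ ε₂ ε₃ ε₄ r Ψ Z ≠ ∞ := by
    refine ne_top_of_le_ne_top ?_ (measure_mono (subset_univ Z))
    rw [outLaw_univ h₁ h₂ h₃ h₄]
    exact ENNReal.ofReal_ne_top
  rw [outLaw, Measure.sum_apply _ hZ] at hfin ⊢
  have h3 := (ENNReal.summable_toReal hfin).hasSum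
  rw [← ENNReal.tsum_toReal_eq (ENNReal.ne_top_of_tsum_ne_top hfin)] at h3
  refine (Complex.hasSum_ofReal.2 h3).congr_fun fun m => ?_
  rw [Measure.smul_apply, smul_eq_mul, ENNReal.toReal_mul, ENNReal.toReal_ofReal (by positivity),
    ← inner_conj_symm Ψ (fourBasis m), RCLike.conj_mul]
  push_cast
  exact mul_comm _ _

/-- The outcome measure of an isometry into the four mode space, as a positive operator measure. -/
theorem exists_isPOVM_outLaw {ε₁ ε₂ ε₃ ε₄ : ℝ} (h₁ : 0 < ε₁ ∧ ε₁ ≤ 1) (h₂ : 0 < ε₂ ∧ ε₂ ≤ 1)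
    (h₃ : 0 < ε₃ ∧ ε₃ ≤ 1) (h₄ : 0 < ε₄ ∧ ε₄ ≤ 1)
    (r : ℝ) (W : HTensor Mode Mode →L[ℂ] FourMode)
    (hW : ∀ Φ, ‖W Φ‖ = ‖Φ‖) :
    ∃ P : Set (ℝ × ℝ) → HTensor Mode Mode →L[ℂ] HTensor Mode Mode,
      IsPOVM P (fun Φ => outLaw ε₁ ε₂ ε₃ ε₄ r (W Φ)) ∧
      ∀ X Y : Set ℝ, MeasurableSet X → MeasurableSet Y → ∀ Φ, ⟪Φ, P (X ×ˢ Y) Φ⟫_ℂ =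
        ⟪W Φ, opTensor (differenceDetection ε₁ ε₃ r ((Real.sqrt 2)⁻¹ • X))
          (differenceDetection ε₂ ε₄ r ((Real.sqrt 2)⁻¹ • Y)) (W Φ)⟫_ℂ := by
  have hex : ∀ Z : Set (ℝ × ℝ), ∃ T : FourMode →L[ℂ] FourMode, MeasurableSet Z →
      (∀ m, T (fourBasis m) = ((fourLaw ε₁ ε₂ ε₃ ε₄ r m Z).toReal : ℂ) • fourBasis m) ∧
      ∀ Ψ, ⟪Ψ, T Ψ⟫_ℂ = ((outLaw ε₁ ε₂ ε₃ ε₄ r Ψ Z).toReal : ℂ) := fun Z => by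
    by_cases hZ : MeasurableSet Z
    · obtain ⟨T, hT⟩ := exists_outOp h₁ h₂ h₃ h₄ r hZ
      exact ⟨T, fun _ => hT⟩
    · exact ⟨0, fun h => absurd h hZ⟩
  choose T hT using hex
  refine ⟨fun Z => adjoint W ∘L T Z ∘L W, ⟨fun Z hZ Φ => ?_, fun Φ => ?_⟩,
    fun X Y hX hY Φ => ?_⟩
  · rw [comp_apply, comp_apply, adjoint_inner_right, (hT Z hZ).2]
  · rw [outLaw_univ h₁ h₂ h₃ h₄, hW]
  · rw [comp_apply, comp_apply, adjoint_inner_right]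
    -- Both operators are diagonal in the number basis, and on rectangles the product measure
    -- `fourLaw` gives the product of eigenvalues.
    have : T (X ×ˢ Y) = opTensor (differenceDetection ε₁ ε₃ r ((Real.sqrt 2)⁻¹ • X))
        (differenceDetection ε₂ ε₄ r ((Real.sqrt 2)⁻¹ • Y)) :=
      (HilbertBasis.isTotal fourBasis).clm_ext fun m => by
        have := isProbabilityMeasure_pairLaw h₂ h₄ r m.2
        rw [(hT _ (hX.prod hY)).1, fourBasis_apply, opTensor_htmul,
          differenceDetection_pairBasis h₁ h₃ r hX, differenceDetection_pairBasis h₂ h₄ r hY,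
          htmul_smul_left, htmul_smul_right, smul_smul, fourLaw, Measure.prod_prod,
          ENNReal.toReal_mul]
        push_cast
        rfl
    rw [this]

/-- A convex combination of `1` and `u`; this is what makes the operators `c^N` contractions. -/
theorem norm_detectionChar_le {ε : ℝ} (h : 0 < ε ∧ ε ≤ 1) (u : ℂ) (hu : ‖u‖ ≤ 1) :
    ‖1 - (ε : ℂ) + ε * u‖ ≤ 1 := by
  have h1 : ‖1 - (ε : ℂ)‖ = 1 - ε := by
    rw [← Complex.ofReal_one, ← Complex.ofReal_sub, Complex.norm_real,
      Real.norm_of_nonneg (by linarith [h.2])]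
  have h2 : ‖(ε : ℂ) * u‖ ≤ ε := by
    rw [norm_mul, Complex.norm_real, Real.norm_of_nonneg h.1.le]
    exact mul_le_of_le_one_right h.1.le hu
  linarith [norm_add_le (1 - (ε : ℂ)) (ε * u)]

/-- The characteristic function of the outcome measure is given by a bounded operator which maps
exponential vectors to exponential vectors. -/
theorem exists_charOp {ε₁ ε₂ ε₃ ε₄ : ℝ} (h₁ : 0 < ε₁ ∧ ε₁ ≤ 1) (h₂ : 0 < ε₂ ∧ ε₂ ≤ 1)
    (h₃ : 0 < ε₃ ∧ ε₃ ≤ 1) (h₄ : 0 < ε₄ ∧ ε₄ ≤ 1)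
    (r s t : ℝ) : ∃ D : FourMode →L[ℂ] FourMode, ‖D‖ ≤ 1 ∧
    (∀ Ψ, ∫ w, Complex.exp (Complex.I * (s * w.1 + t * w.2)) ∂(outLaw ε₁ ε₂ ε₃ ε₄ r Ψ) =
      ⟪Ψ, D Ψ⟫_ℂ) ∧
    ∀ z₁ z₂ z₃ z₄, D (htmul (htmul (expVec z₁) (expVec z₃)) (htmul (expVec z₂) (expVec z₄))) =
      htmul (htmul (expVec ((1 - ε₁ + ε₁ * Complex.exp (-(Complex.I * s / (r * ε₁)))) * z₁))
          (expVec ((1 - ε₃ + ε₃ * Complex.exp (Complex.I * s / (r * ε₃))) * z₃)))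
        (htmul (expVec ((1 - ε₂ + ε₂ * Complex.exp (-(Complex.I * t / (r * ε₂)))) * z₂))
          (expVec ((1 - ε₄ + ε₄ * Complex.exp (Complex.I * t / (r * ε₄))) * z₄))) := by
  have hu : ∀ s ε : ℝ, ‖Complex.exp (Complex.I * s / (r * ε))‖ ≤ 1 := fun s ε => by
    have : Complex.I * s / (r * ε) = ((s / (r * ε) : ℝ) : ℂ) * Complex.I := by
      push_cast; ring
    rw [this, Complex.norm_exp_ofReal_mul_I]
  have hu' : ∀ s ε : ℝ, ‖Complex.exp (-(Complex.I * s / (r * ε)))‖ ≤ 1 := fun s ε => by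
    have : -(Complex.I * s / (r * ε)) = ((-(s / (r * ε)) : ℝ) : ℂ) * Complex.I := by
      push_cast; ring
    rw [this, Complex.norm_exp_ofReal_mul_I]
  obtain ⟨D₁, hn1, hD1, hE1⟩ := exists_numberDiagonal _ (norm_detectionChar_le h₁ _ (hu' s ε₁))
  obtain ⟨D₂, hn2, hD2, hE2⟩ := exists_numberDiagonal _ (norm_detectionChar_le h₂ _ (hu' t ε₂))
  obtain ⟨D₃, hn3, hD3, hE3⟩ := exists_numberDiagonal _ (norm_detectionChar_le h₃ _ (hu s ε₃))
  obtain ⟨D₄, hn4, hD4, hE4⟩ := exists_numberDiagonal _ (norm_detectionChar_le h₄ _ (hu t ε₄))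
  refine ⟨opTensor (opTensor D₁ D₃) (opTensor D₂ D₄), ?_, fun Ψ => ?_, fun z₁ z₂ z₃ z₄ => ?_⟩
  · refine (norm_opTensor_le _ _).trans (mul_le_one₀ ?_ (norm_nonneg _) ?_)
    · exact (norm_opTensor_le _ _).trans (mul_le_one₀ hn1 (norm_nonneg _) hn3)
    · exact (norm_opTensor_le _ _).trans (mul_le_one₀ hn2 (norm_nonneg _) hn4)
  · have hfin : IsFiniteMeasure (outLaw ε₁ ε₂ ε₃ ε₄ r Ψ) :=
      ⟨by rw [outLaw_univ h₁ h₂ h₃ h₄]; exact ENNReal.ofReal_lt_top⟩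
    have hint : Integrable (fun w : ℝ × ℝ => Complex.exp (Complex.I * (s * w.1 + t * w.2)))
        (outLaw ε₁ ε₂ ε₃ ε₄ r Ψ) := by
      refine Integrable.of_bound (Continuous.aestronglyMeasurable (by fun_prop)) 1
        (.of_forall fun x => ?_)
      simp [Complex.norm_exp]
    -- The eigenvalue at a number vector is the characteristic function of its `fourLaw`, so the
    -- operator and `outLaw` have the same expansion over the basis.
    have hdiag := hasSum_inner_diagonal fourBasis (T := opTensor (opTensor D₁ D₃) (opTensor D₂ D₄))
      (s := fun m => ∫ w, Complex.exp (Complex.I * (s * w.1 + t * w.2))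
        ∂(fourLaw ε₁ ε₂ ε₃ ε₄ r m)) (fun m => by
        have := isProbabilityMeasure_pairLaw h₁ h₃ r m.1
        have := isProbabilityMeasure_pairLaw h₂ h₄ r m.2
        have h5 : ∫ w, Complex.exp (Complex.I * (s * w.1 + t * w.2)) ∂(fourLaw ε₁ ε₂ ε₃ ε₄ r m) =
            (∫ x, Complex.exp (Complex.I * (s * x)) ∂(pairLaw ε₁ ε₃ r m.1)) *
              ∫ y, Complex.exp (Complex.I * (t * y)) ∂(pairLaw ε₂ ε₄ r m.2) := by
          rw [fourLaw, ← integral_prod_mul]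
          refine integral_congr_ae (.of_forall fun w => ?_)
          simp only [← Complex.exp_add, mul_add]
        rw [h5, integral_pairLaw h₁ h₃, integral_pairLaw h₂ h₄, fourBasis_apply, opTensor_htmul,
          pairBasis_apply, pairBasis_apply, opTensor_htmul, opTensor_htmul, hD1, hD2, hD3, hD4]
        simp only [htmul_smul_left, htmul_smul_right, smul_smul]
        congr 1
        ring) Ψ Ψ
    refine (hasSum_integral_measure hint).unique (hdiag.congr_fun fun m => ?_)
    rw [integral_smul_measure, ENNReal.toReal_ofReal (by positivity),
      ← inner_conj_symm Ψ (fourBasis m), RCLike.conj_mul, Complex.real_smul, mul_comm]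
    push_cast
    rfl
  · simp only [opTensor_htmul, hE1, hE2, hE3, hE4]

end Detection

/-! ## The eight-port homodyne detector -/

section EightPort

open ContinuousLinearMap

variable {K₁ K₂ L₁ L₂ : Type*}
  [NormedAddCommGroup K₁] [InnerProductSpace ℂ K₁] [NormedAddCommGroup K₂] [InnerProductSpace ℂ K₂]
  [NormedAddCommGroup L₁] [InnerProductSpace ℂ L₁] [NormedAddCommGroup L₂] [InnerProductSpace ℂ L₂]

/-- Isometry is the identity `T^* T = 1`, which can be tested on simple tensors. -/
theorem norm_opTensor_apply {A : K₁ →L[ℂ] L₁} {B : K₂ →L[ℂ] L₂} (hA : ∀ φ, ‖A φ‖ = ‖φ‖)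
    (hB : ∀ ψ, ‖B ψ‖ = ‖ψ‖) (t : HTensor K₁ K₂) : ‖opTensor A B t‖ = ‖t‖ := by
  have hA' : ∀ φ φ', ⟪A φ, A φ'⟫_ℂ = ⟪φ, φ'⟫_ℂ :=
    (⟨A.toLinearMap, hA⟩ : K₁ →ₗᵢ[ℂ] L₁).inner_map_map
  have hB' : ∀ ψ ψ', ⟪B ψ, B ψ'⟫_ℂ = ⟪ψ, ψ'⟫_ℂ :=
    (⟨B.toLinearMap, hB⟩ : K₂ →ₗᵢ[ℂ] L₂).inner_map_map
  have h : adjoint (opTensor A B) ∘L opTensor A B = ContinuousLinearMap.id ℂ _ :=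
    isTotal_htmul_all.clm_ext fun p => by
      rw [← sub_eq_zero]
      refine isTotal_htmul_all.eq_zero (K := HTensor K₁ K₂) fun q => ?_
      rw [inner_sub_right, comp_apply, adjoint_inner_right, opTensor_htmul, opTensor_htmul,
        ContinuousLinearMap.id_apply, inner_htmul, inner_htmul, hA', hB', sub_self]
  have h1 : ⟪opTensor A B t, opTensor A B t⟫_ℂ = ⟪t, t⟫_ℂ := by
    rw [← adjoint_inner_right, ← comp_apply, h, ContinuousLinearMap.id_apply]
  rw [inner_self_eq_norm_sq_to_K, inner_self_eq_norm_sq_to_K] at h1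
  have h2 : ‖opTensor A B t‖ ^ 2 = ‖t‖ ^ 2 := by exact_mod_cast h1
  exact (sq_eq_sq₀ (norm_nonneg _) (norm_nonneg _)).1 h2

theorem norm_coherentState (z : ℂ) : ‖coherentState z‖ = 1 := by
  have h : ⟪coherentState z, coherentState z⟫_ℂ = 1 := by
    rw [coherentState_eq_smul, inner_smul_left, inner_smul_right, inner_expVec, ← Complex.exp_conj,
      ← Complex.exp_add, ← Complex.exp_add]
    simp only [map_neg, map_div₀, map_mul, Complex.conj_conj, map_ofNat]
    rw [← Complex.exp_zero]
    congr 1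
    ring
  have h2 : ‖coherentState z‖ ^ 2 = 1 := by
    rw [← inner_self_eq_norm_sq (𝕜 := ℂ), h]
    simp
  exact (pow_eq_one_iff_of_nonneg (norm_nonneg _) two_ne_zero).1 h2

/-- The beam splitter as a bounded operator. -/
def splitter : HTensor Mode Mode →L[ℂ] HTensor Mode Mode := beamSplitter.toContinuousLinearEquiv

theorem splitter_apply (Φ : HTensor Mode Mode) : splitter Φ = beamSplitter Φ := rfl

/-- The isometry of the signal and parameter modes into the four modes before detection. -/
def homodyneIsometry (z w : ℂ) : HTensor Mode Mode →L[ℂ] FourMode :=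
  opTensor splitter splitter ∘L adjoinOscillators z w ∘L splitter

theorem norm_homodyneIsometry (z w : ℂ) (Φ : HTensor Mode Mode) :
    ‖homodyneIsometry z w Φ‖ = ‖Φ‖ := by
  have hU : ∀ Φ, ‖splitter Φ‖ = ‖Φ‖ := beamSplitter.norm_map
  have hV : ∀ z (φ : Mode), ‖tensorRight Mode (coherentState z) φ‖ = ‖φ‖ := fun z φ => by
    rw [tensorRight_apply, norm_htmul, norm_coherentState, mul_one]
  rw [homodyneIsometry, comp_apply, comp_apply, norm_opTensor_apply hU hU, adjoinOscillators,
    norm_opTensor_apply (hV z) (hV w), hU]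

theorem outputState_eq (ρ S : Mode →L[ℂ] Mode) (z : ℂ) (ϕ : ℝ) :
    outputState ρ S z ϕ = homodyneIsometry z (z * Complex.exp (Complex.I * ϕ)) ∘L opTensor ρ S ∘L
      adjoint (homodyneIsometry z (z * Complex.exp (Complex.I * ϕ))) := by
  rw [homodyneIsometry, adjoint_comp, adjoint_comp]
  rfl

/-- With `ρ = ∑ |u_i⟩⟨u_i|`, the output state decomposes along the images of `u_i ⊗ v_j` under the
isometry. Its trace against the detection operator is an absolutely convergent double series, and
summing over `j` first produces the reduction at `u_i`. -/
theorem isSignalObservable_of_isReduction {ε₁ ε₂ ε₃ ε₄ : ℝ} {S : Mode →L[ℂ] Mode} {z : ℂ} {ϕ : ℝ}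
    {v : ℕ → Mode} (hv : IsDecomposition v S)
    {P : Set (ℝ × ℝ) → HTensor Mode Mode →L[ℂ] HTensor Mode Mode} {E : Observable (ℝ × ℝ)}
    (hE : IsReduction v P E)
    (hP : ∀ X Y : Set ℝ, MeasurableSet X → MeasurableSet Y → ∀ Φ, ⟪Φ, P (X ×ˢ Y) Φ⟫_ℂ =
      ⟪homodyneIsometry z (z * Complex.exp (Complex.I * ϕ)) Φ,
        opTensor (differenceDetection ε₁ ε₃ ‖z‖ ((Real.sqrt 2)⁻¹ • X))
          (differenceDetection ε₂ ε₄ ‖z‖ ((Real.sqrt 2)⁻¹ • Y))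
        (homodyneIsometry z (z * Complex.exp (Complex.I * ϕ)) Φ)⟫_ℂ) :
    IsSignalObservable ε₁ ε₂ ε₃ ε₄ S z ϕ E := by
  intro ρ hρ X Y hX hY
  obtain ⟨u, hu, -⟩ := hρ.exists_decomposition numberBasis
  have huv := hu.opTensor hv
  rw [hu.trace_comp, outputState_eq,
    (huv.conj (homodyneIsometry z (z * Complex.exp (Complex.I * ϕ)))).trace_comp]
  simp only [← hP X Y hX hY]
  exact (((summable_inner_apply huv.summable (P (X ×ˢ Y))).hasSum.prod_fiberwise
    fun i => hE _ (hX.prod hY) (u i) (u i)).tsum_eq)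

theorem exists_signalObservable {ε₁ ε₂ ε₃ ε₄ : ℝ} (h₁ : 0 < ε₁ ∧ ε₁ ≤ 1) (h₂ : 0 < ε₂ ∧ ε₂ ≤ 1)
    (h₃ : 0 < ε₃ ∧ ε₃ ≤ 1) (h₄ : 0 < ε₄ ∧ ε₄ ≤ 1) {S : Mode →L[ℂ] Mode} {v : ℕ → Mode}
    (hv : IsDecomposition v S) (hv1 : HasSum (fun j => ‖v j‖ ^ 2) 1) (z : ℂ) (ϕ : ℝ) :
    ∃ P E, IsPOVM P (fun Φ => outLaw ε₁ ε₂ ε₃ ε₄ ‖z‖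
        (homodyneIsometry z (z * Complex.exp (Complex.I * ϕ)) Φ)) ∧
      IsReduction v P E ∧ IsSignalObservable ε₁ ε₂ ε₃ ε₄ S z ϕ E := by
  obtain ⟨P, hP, hrect⟩ := exists_isPOVM_outLaw h₁ h₂ h₃ h₄ ‖z‖ _ (norm_homodyneIsometry z _)
  obtain ⟨E, hE⟩ := hP.exists_observable hv1
  exact ⟨P, E, hP, hE, isSignalObservable_of_isReduction hv hE hrect⟩

end EightPort

/-! ## Convergence of characteristic functions -/

section Levy

/-- Lévy's continuity theorem followed by the portmanteau theorem. These concern probability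
measures on an inner product space, so the measures are divided by their common mass and transported
to `WithLp 2 (ℝ × ℝ)`; zero mass is separate. -/
theorem tendsto_measure_of_tendsto_char {μk : ℕ → Measure (ℝ × ℝ)} {μ : Measure (ℝ × ℝ)}
    [IsFiniteMeasure μ] (hmass : ∀ k, μk k univ = μ univ)
    (h : ∀ s t : ℝ, Tendsto (fun k => ∫ w, Complex.exp (Complex.I * (s * w.1 + t * w.2)) ∂(μk k))
      atTop (𝓝 (∫ w, Complex.exp (Complex.I * (s * w.1 + t * w.2)) ∂μ)))
    {Z : Set (ℝ × ℝ)} (hZ : μ (frontier Z) = 0) :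
    Tendsto (fun k => (μk k Z).toReal) atTop (𝓝 (μ Z).toReal) := by
  by_cases h0 : μ univ = 0
  · have hk : ∀ k, μk k Z = 0 := fun k => measure_mono_null (subset_univ Z) ((hmass k).trans h0)
    simp only [hk, measure_mono_null (subset_univ Z) h0]
    exact tendsto_const_nhds
  have htop := measure_ne_top μ univ
  have hp : ∀ ν : Measure (ℝ × ℝ), ν univ = μ univ →
      IsProbabilityMeasure (((μ univ)⁻¹ • ν).map (WithLp.toLp 2)) := fun ν hν => by
    have : IsProbabilityMeasure ((μ univ)⁻¹ • ν) :=
      ⟨by rw [Measure.smul_apply, hν, smul_eq_mul, ENNReal.inv_mul_cancel h0 htop]⟩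
    exact Measure.isProbabilityMeasure_map (by fun_prop)
  let N : ∀ ν : Measure (ℝ × ℝ), ν univ = μ univ → ProbabilityMeasure (WithLp 2 (ℝ × ℝ)) :=
    fun ν hν => ⟨_, hp ν hν⟩
  have hchar : ∀ (ν : Measure (ℝ × ℝ)) (hν : ν univ = μ univ) (u : WithLp 2 (ℝ × ℝ)),
      charFun (N ν hν : Measure (WithLp 2 (ℝ × ℝ))) u = (μ univ)⁻¹.toReal •
        ∫ w, Complex.exp (Complex.I * (u.fst * w.1 + u.snd * w.2)) ∂ν := fun ν hν u => by
    change charFun (((μ univ)⁻¹ • ν).map (WithLp.toLp 2)) u = _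
    rw [charFun_apply, integral_map (by fun_prop)
      (Continuous.aestronglyMeasurable (by fun_prop)), integral_smul_measure]
    congr 1
    refine integral_congr_ae (.of_forall fun w => ?_)
    simp only [WithLp.prod_inner_apply]
    congr 1
    simp
    ring
  have hlim : Tendsto (fun k => N (μk k) (hmass k)) atTop (𝓝 (N μ rfl)) := by
    refine ProbabilityMeasure.tendsto_of_tendsto_charFun fun u => ?_
    simp only [hchar]
    exact (h u.fst u.snd).const_smul _
  have hfr : (N μ rfl : Measure (WithLp 2 (ℝ × ℝ))) (frontier (WithLp.ofLp ⁻¹' Z)) = 0 := by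
    have e : frontier (WithLp.ofLp ⁻¹' Z : Set (WithLp 2 (ℝ × ℝ))) = WithLp.ofLp ⁻¹' frontier Z :=
      ((WithLp.homeomorphProd 2 ℝ ℝ).preimage_frontier Z).symm
    change (((μ univ)⁻¹ • μ).map (WithLp.toLp 2)) _ = 0
    rw [Measure.map_apply (by fun_prop) isClosed_frontier.measurableSet, e]
    rw [← preimage_comp]
    change (μ univ)⁻¹ * μ (frontier Z) = 0
    rw [hZ, mul_zero]
  have h2 := ProbabilityMeasure.tendsto_measure_of_null_frontier_of_tendsto' hlim hfr
  have hval : ∀ (ν : Measure (ℝ × ℝ)) (hν : ν univ = μ univ),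
      (N ν hν : Measure (WithLp 2 (ℝ × ℝ))) (WithLp.ofLp ⁻¹' Z) = (μ univ)⁻¹ * ν Z :=
    fun ν hν => by
    change (((μ univ)⁻¹ • ν).map (MeasurableEquiv.toLp 2 (ℝ × ℝ))) _ = _
    rw [MeasurableEquiv.map_apply]
    rfl
  simp only [hval] at h2
  have h3 := ENNReal.Tendsto.const_mul (a := μ univ) h2 (Or.inr htop)
  simp only [← mul_assoc, ENNReal.mul_inv_cancel h0 htop, one_mul] at h3
  exact (ENNReal.tendsto_toReal (measure_ne_top μ Z)).comp h3

end Levy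

/-! ## The Gaussian smearing -/

section Smearing

open ProbabilityTheory

/-- The variance of the outcome noise of a pair of detectors. -/
def noiseVariance (a b : ℝ) : NNReal := Real.toNNReal ((a⁻¹ + b⁻¹) / 2 - 1)

theorem coe_noiseVariance {a b : ℝ} (ha : 0 < a ∧ a ≤ 1) (hb : 0 < b ∧ b ≤ 1) :
    (noiseVariance a b : ℝ) = (a⁻¹ + b⁻¹) / 2 - 1 :=
  Real.coe_toNNReal _ (by
    have h1 := (one_le_inv₀ ha.1).2 ha.2
    have h2 := (one_le_inv₀ hb.1).2 hb.2
    linarith)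

/-- The density has variance `(a - 2ab + b) / (4ab)`, half of `noiseVariance`, and scaling by `√2`
doubles it. Variance zero is exactly the Dirac case. -/
theorem map_gaussianSmearing {a b : ℝ} (ha : 0 < a ∧ a ≤ 1) (hb : 0 < b ∧ b ≤ 1) :
    (gaussianSmearing a b).map (fun x => Real.sqrt 2 * x) = gaussianReal 0 (noiseVariance a b) := by
  have h2 : (0 : ℝ) ≤ 2 := by norm_num
  have hv := coe_noiseVariance ha hb
  have key : gaussianSmearing a b = gaussianReal 0 (noiseVariance a b / 2) := by
    have ha0 := ha.1.ne'
    have hb0 := hb.1.ne'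
    have hq : a - 2 * a * b + b = a * (1 - b) + b * (1 - a) := by ring
    have hvq : (noiseVariance a b : ℝ) = (a - 2 * a * b + b) / (2 * a * b) := by
      rw [hv]; field_simp; ring
    by_cases h1 : a = 1 ∧ b = 1
    · obtain ⟨rfl, rfl⟩ := h1
      have h0 : noiseVariance 1 1 = 0 := by rw [← NNReal.coe_eq_zero, hv]; norm_num
      simp [gaussianSmearing, h0]
    · have hpos : 0 < a - 2 * a * b + b := by
        rw [hq]
        rcases lt_or_eq_of_le hb.2 with h | h
        · have := mul_pos ha.1 (sub_pos.2 h)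
          have := mul_nonneg hb.1.le (sub_nonneg.2 ha.2)
          linarith
        · have hlt : a < 1 := lt_of_le_of_ne ha.2 fun h' => h1 ⟨h', h⟩
          have := mul_pos hb.1 (sub_pos.2 hlt)
          have := mul_nonneg ha.1.le (sub_nonneg.2 hb.2)
          linarith
      have hV : 0 < (noiseVariance a b : ℝ) := by
        have := ha.1; have := hb.1
        rw [hvq]; positivity
      have hV0 : noiseVariance a b / 2 ≠ 0 := by
        rw [← NNReal.coe_ne_zero]; push_cast; positivity
      rw [gaussianSmearing, if_neg h1, gaussianReal_of_var_ne_zero _ hV0]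
      congr 1
      funext x
      rw [gaussianPDF, gaussianPDFReal]
      congr 2
      · rw [← Real.sqrt_inv]
        congr 1
        push_cast
        rw [hvq]
        field_simp
      · congr 1
        push_cast
        rw [hvq]
        field_simp
        ring
  rw [key, gaussianReal_map_const_mul]
  congr 1
  · ring
  · rw [← NNReal.coe_inj]
    push_cast
    simp only [Real.sq_sqrt h2]
    ring

theorem isProbabilityMeasure_phaseSpaceSmearing {ε₁ ε₂ ε₃ ε₄ : ℝ} (h₁ : 0 < ε₁ ∧ ε₁ ≤ 1)
    (h₂ : 0 < ε₂ ∧ ε₂ ≤ 1) (h₃ : 0 < ε₃ ∧ ε₃ ≤ 1) (h₄ : 0 < ε₄ ∧ ε₄ ≤ 1) :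
    IsProbabilityMeasure (phaseSpaceSmearing ε₁ ε₂ ε₃ ε₄) := by
  rw [phaseSpaceSmearing, map_gaussianSmearing h₁ h₃, map_gaussianSmearing h₂ h₄]
  infer_instance

theorem integral_phaseSpaceSmearing {ε₁ ε₂ ε₃ ε₄ : ℝ} (h₁ : 0 < ε₁ ∧ ε₁ ≤ 1)
    (h₂ : 0 < ε₂ ∧ ε₂ ≤ 1) (h₃ : 0 < ε₃ ∧ ε₃ ≤ 1) (h₄ : 0 < ε₄ ∧ ε₄ ≤ 1) (s t : ℝ) :
    ∫ w, Complex.exp (Complex.I * (s * w.1 + t * w.2)) ∂(phaseSpaceSmearing ε₁ ε₂ ε₃ ε₄) =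
      Complex.exp (-(s : ℂ) ^ 2 / 4 * ((ε₁ : ℂ)⁻¹ + (ε₃ : ℂ)⁻¹ - 2) -
        (t : ℂ) ^ 2 / 4 * ((ε₂ : ℂ)⁻¹ + (ε₄ : ℂ)⁻¹ - 2)) := by
  have hone : ∀ {a b : ℝ}, (0 < a ∧ a ≤ 1) → (0 < b ∧ b ≤ 1) → ∀ s : ℝ,
      ∫ x, Complex.exp (Complex.I * (s * x)) ∂(gaussianReal 0 (noiseVariance a b)) =
        Complex.exp (-(s : ℂ) ^ 2 / 4 * ((a : ℂ)⁻¹ + (b : ℂ)⁻¹ - 2)) := fun {a b} ha hb s => by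
    have h := charFun_gaussianReal (μ := 0) (v := noiseVariance a b) s
    rw [charFun_apply_real] at h
    have hv : ((noiseVariance a b : ℝ) : ℂ) = ((a : ℂ)⁻¹ + (b : ℂ)⁻¹) / 2 - 1 := by
      rw [coe_noiseVariance ha hb]; push_cast; rfl
    rw [hv] at h
    simp only [mul_comm Complex.I]
    rw [h]
    congr 1
    push_cast
    ring
  rw [phaseSpaceSmearing, map_gaussianSmearing h₁ h₃, map_gaussianSmearing h₂ h₄, sub_eq_add_neg,
    Complex.exp_add, ← hone h₁ h₃]
  have h5 : -((t : ℂ) ^ 2 / 4 * ((ε₂ : ℂ)⁻¹ + (ε₄ : ℂ)⁻¹ - 2)) =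
    -(t : ℂ) ^ 2 / 4 * ((ε₂ : ℂ)⁻¹ + (ε₄ : ℂ)⁻¹ - 2) := by ring
  rw [h5, ← hone h₂ h₄, ← integral_prod_mul]
  refine integral_congr_ae (.of_forall fun w => ?_)
  simp only [← Complex.exp_add, mul_add]

end Smearing

/-! ## Covariant phase space observables and their smearings -/

section Covariant

open ContinuousLinearMap

/-- Termwise integration in which the sum is given only almost everywhere; its measurability comes
from the partial sums and its integrability from the summed norms. -/
theorem integrable_and_hasSum_integral {α : Type*} [MeasurableSpace α] {μ : Measure α}
    {F : ℕ → α → ℂ} {f : α → ℂ} (hF : ∀ i, Integrable (F i) μ)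
    (hs : Summable fun i => ∫ a, ‖F i a‖ ∂μ) (h : ∀ᵐ a ∂μ, HasSum (fun i => F i a) (f a)) :
    Integrable f μ ∧ HasSum (fun i => ∫ a, F i a ∂μ) (∫ a, f a ∂μ) := by
  have hm : AEStronglyMeasurable f μ := by
    refine aestronglyMeasurable_of_tendsto_ae atTop
      (f := fun n a => ∑ i ∈ Finset.range n, F i a) (fun n => ?_) ?_
    · exact (integrable_finsetSum _ fun i _ => hF i).aestronglyMeasurable
    · filter_upwards [h] with a ha using ha.tendsto_sum_nat
  constructor
  · refine ⟨hm, ?_⟩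
    rw [hasFiniteIntegral_iff_enorm]
    calc ∫⁻ a, ‖f a‖ₑ ∂μ ≤ ∫⁻ a, ∑' i, ‖F i a‖ₑ ∂μ := by
          refine lintegral_mono_ae ?_
          filter_upwards [h] with a ha
          rw [← ha.tsum_eq]
          exact enorm_tsum_le_tsum_enorm
      _ = ∑' i, ENNReal.ofReal (∫ a, ‖F i a‖ ∂μ) := by
          rw [lintegral_tsum fun i => (hF i).aestronglyMeasurable.enorm]
          exact tsum_congr fun i => (ofReal_integral_norm_eq_lintegral_enorm (hF i)).symm
      _ < ∞ := by
          rw [← ENNReal.ofReal_tsum_of_nonneg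
            (fun i => integral_nonneg fun a => norm_nonneg _) hs]
          exact ENNReal.ofReal_lt_top
  · have h1 := hasSum_integral_of_summable_integral_norm hF hs
    have h2 : ∫ a, f a ∂μ = ∫ a, ∑' i, F i a ∂μ := by
      refine integral_congr_ae ?_
      filter_upwards [h] with a ha using ha.tsum_eq.symm
    rwa [h2]

/-- The phase space transform. -/
def phaseTransform : HTensor Mode Mode →ₗᵢ[ℂ] Lp ℂ 2 (volume : Measure (ℝ × ℝ)) :=
  exists_phaseTransform.choose

theorem phaseTransform_expVec (α β : ℂ) :
    phaseTransform (htmul (expVec α) (expVec β)) = phaseGauss 0 0 α β :=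
  exists_phaseTransform.choose_spec.1 α β

theorem coeFn_phaseTransform (φ v : Mode) :
    phaseTransform (htmul φ v) =ᵐ[volume] fun w => phaseFunctional v w φ :=
  exists_phaseTransform.choose_spec.2 φ v

/-- The measure on phase space with density `|J Φ|²`, with `J` the phase space transform. -/
def phaseLaw (Φ : HTensor Mode Mode) : Measure (ℝ × ℝ) :=
  volume.withDensity fun w => ENNReal.ofReal (‖phaseTransform Φ w‖ ^ 2)

theorem measurable_phaseDensity (Φ : HTensor Mode Mode) :
    Measurable fun w => ENNReal.ofReal (‖phaseTransform Φ w‖ ^ 2) :=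
  ((Lp.stronglyMeasurable _).measurable.norm.pow_const 2).ennreal_ofReal

theorem integral_phaseLaw (Φ : HTensor Mode Mode) (f : ℝ × ℝ → ℂ) :
    ∫ w, f w ∂(phaseLaw Φ) = ∫ w, f w * ((starRingEnd ℂ) (phaseTransform Φ w) *
      phaseTransform Φ w) := by
  rw [phaseLaw, integral_withDensity_eq_integral_toReal_smul (measurable_phaseDensity Φ)
    (.of_forall fun w => ENNReal.ofReal_lt_top)]
  refine integral_congr_ae (.of_forall fun w => ?_)
  simp only
  rw [ENNReal.toReal_ofReal (by positivity), RCLike.conj_mul, Complex.real_smul, mul_comm]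
  push_cast
  rfl

theorem integral_norm_sq_phaseTransform (Φ : HTensor Mode Mode) :
    ∫ w, ‖phaseTransform Φ w‖ ^ 2 = ‖Φ‖ ^ 2 := by
  rw [← phaseTransform.norm_map Φ, ← inner_self_eq_norm_sq (𝕜 := ℂ), L2.inner_def,
    ← integral_re (L2.integrable_inner _ _)]
  refine integral_congr_ae (.of_forall fun w => ?_)
  exact (inner_self_eq_norm_sq (𝕜 := ℂ) _).symm

theorem phaseLaw_univ (Φ : HTensor Mode Mode) :
    phaseLaw Φ univ = ENNReal.ofReal (‖Φ‖ ^ 2) := by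
  have hint : Integrable (fun w => ‖phaseTransform Φ w‖ ^ 2) :=
    (memLp_two_iff_integrable_sq_norm (Lp.aestronglyMeasurable _)).1 (Lp.memLp _)
  rw [phaseLaw, withDensity_apply _ MeasurableSet.univ, Measure.restrict_univ,
    ← integral_norm_sq_phaseTransform,
    ofReal_integral_eq_lintegral_ofReal hint (.of_forall fun w => by positivity)]

instance (Φ : HTensor Mode Mode) : IsFiniteMeasure (phaseLaw Φ) :=
  ⟨by rw [phaseLaw_univ]; exact ENNReal.ofReal_lt_top⟩

/-- The compression of a multiplication operator to the range of the phase space transform. -/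
theorem exists_phaseOp (f : ℝ × ℝ → ℂ) (hf : Measurable f) (h1 : ∀ w, ‖f w‖ ≤ 1) :
    ∃ B : HTensor Mode Mode →L[ℂ] HTensor Mode Mode, ∀ Φ Ψ, ⟪Φ, B Ψ⟫_ℂ =
      ∫ w, f w * ((starRingEnd ℂ) (phaseTransform Φ w) * phaseTransform Ψ w) := by
  obtain ⟨T, -, hT⟩ := exists_mulOp (μ := volume) f hf.aestronglyMeasurable h1
  refine ⟨adjoint phaseTransform.toContinuousLinearMap ∘L T ∘L
    phaseTransform.toContinuousLinearMap, fun Φ Ψ => ?_⟩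
  rw [comp_apply, adjoint_inner_right, comp_apply, L2.inner_def]
  refine integral_congr_ae ?_
  filter_upwards [hT (phaseTransform Ψ)] with w hw
  change ⟪phaseTransform Φ w, T (phaseTransform Ψ) w⟫_ℂ = _
  rw [hw, RCLike.inner_apply]
  ring

/-! ### Smearing as convolution, and the covariant observable -/

variable (μ : Measure (ℝ × ℝ)) [IsProbabilityMeasure μ]

theorem measurable_smearing {Z : Set (ℝ × ℝ)} (hZ : MeasurableSet Z) :
    Measurable fun w => μ {u | u + w ∈ Z} :=
  measurable_measure_prodMk_right (μ := μ) (s := (fun p : (ℝ × ℝ) × (ℝ × ℝ) => p.1 + p.2) ⁻¹' Z)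
    (measurable_add hZ)

theorem conv_apply_eq (ν : Measure (ℝ × ℝ)) [SFinite ν] {Z : Set (ℝ × ℝ)} (hZ : MeasurableSet Z) :
    (μ.conv ν) Z = ∫⁻ w, μ {u | u + w ∈ Z} ∂ν := by
  rw [Measure.conv, Measure.map_apply measurable_add hZ, Measure.prod_apply_symm (measurable_add hZ)]
  rfl

/-- The effect of `Z` is multiplication by `w ↦ μ(Z - w)` compressed by `J`. With `μ` the Dirac
measure at `0` this is the unsmeared observable, so one construction serves both. -/
theorem exists_isPOVM_conv : ∃ P : Set (ℝ × ℝ) → HTensor Mode Mode →L[ℂ] HTensor Mode Mode,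
    IsPOVM P (fun Φ => μ.conv (phaseLaw Φ)) ∧ ∀ Z, MeasurableSet Z → ∀ Φ Ψ, ⟪Φ, P Z Ψ⟫_ℂ =
      ∫ w, ((μ {u | u + w ∈ Z}).toReal : ℂ) *
        ((starRingEnd ℂ) (phaseTransform Φ w) * phaseTransform Ψ w) := by
  have hex : ∀ Z : Set (ℝ × ℝ), ∃ B : HTensor Mode Mode →L[ℂ] HTensor Mode Mode,
      MeasurableSet Z → ∀ Φ Ψ, ⟪Φ, B Ψ⟫_ℂ = ∫ w, ((μ {u | u + w ∈ Z}).toReal : ℂ) *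
        ((starRingEnd ℂ) (phaseTransform Φ w) * phaseTransform Ψ w) := fun Z => by
    by_cases hZ : MeasurableSet Z
    · obtain ⟨B, hB⟩ := exists_phaseOp (fun w => ((μ {u | u + w ∈ Z}).toReal : ℂ))
        (Complex.measurable_ofReal.comp (measurable_smearing μ hZ).ennreal_toReal) fun w => by
          rw [Complex.norm_real, Real.norm_of_nonneg ENNReal.toReal_nonneg]
          exact measureReal_le_one
      exact ⟨B, fun _ => hB⟩
    · exact ⟨0, fun h => absurd h hZ⟩
  choose P hP using hex
  refine ⟨P, ⟨fun Z hZ Φ => ?_, fun Φ => ?_⟩, hP⟩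
  · rw [hP Z hZ, ← integral_phaseLaw, integral_complex_ofReal,
      integral_toReal (measurable_smearing μ hZ).aemeasurable
        (.of_forall fun w => measure_lt_top _ _), conv_apply_eq μ _ hZ]
  · rw [conv_apply_eq μ _ MeasurableSet.univ]
    simp [phaseLaw_univ]

/-- Since `C S C⁻¹ = ∑ |C v_j⟩⟨C v_j|`, the operator density of the covariant observable is the sum
over `j` of the products of the functions `J (φ ⊗ v_j)` and `J (ψ ⊗ v_j)`. This is where `C S C⁻¹`
appears in place of `S`. -/
theorem hasSum_inner_conjOp {S : Mode →L[ℂ] Mode} {v : ℕ → Mode} (hv : IsDecomposition v S)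
    (w : ℝ × ℝ) (φ ψ : Mode) :
    HasSum (fun j => (starRingEnd ℂ) (phaseFunctional (v j) w φ) * phaseFunctional (v j) w ψ)
      ⟪φ, (((2 * Real.pi)⁻¹ : ℂ) • (weyl w.1 w.2 ∘L conjOp S ∘L adjoint (weyl w.1 w.2))) ψ⟫_ℂ := by
  let η := adjoint (weyl w.1 w.2) φ
  let χ := adjoint (weyl w.1 w.2) ψ
  have h1 : ⟪φ, (((2 * Real.pi)⁻¹ : ℂ) •
      (weyl w.1 w.2 ∘L conjOp S ∘L adjoint (weyl w.1 w.2))) ψ⟫_ℂ =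
        ((2 * Real.pi)⁻¹ : ℂ) * (starRingEnd ℂ) ⟪conjugation η, S (conjugation χ)⟫_ℂ := by
    rw [_root_.smul_apply, inner_smul_right, comp_apply, comp_apply, ← adjoint_inner_left,
      ← inner_conj_symm]
    congr 2
    exact inner_conjugation (S (conjugation χ)) η
  have h2 := ((hv.hasSum.mapL (innerSL ℂ (conjugation η) ∘L
    ContinuousLinearMap.apply ℂ Mode (conjugation χ))).mapL Complex.conjCLE.toContinuousLinearMap).mul_left
      ((2 * Real.pi)⁻¹ : ℂ)
  rw [h1]
  refine h2.congr_fun fun j => ?_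
  change _ = ((2 * Real.pi)⁻¹ : ℂ) * (starRingEnd ℂ) ⟪conjugation η,
    InnerProductSpace.rankOne ℂ (v j) (v j) (conjugation χ)⟫_ℂ
  have h3 : ∀ ξ, ⟪conjugation (adjoint (weyl w.1 w.2) ξ), v j⟫_ℂ =
      ⟪weyl w.1 w.2 (conjugation (v j)), ξ⟫_ℂ := fun ξ => by
    rw [inner_conjugation, adjoint_inner_right]
  have hk : ((Real.sqrt (2 * Real.pi) : ℝ) : ℂ)⁻¹ * ((Real.sqrt (2 * Real.pi) : ℝ) : ℂ)⁻¹ =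
      ((2 * Real.pi)⁻¹ : ℂ) := by
    rw [← mul_inv, ← Complex.ofReal_mul, Real.mul_self_sqrt (by positivity)]
    push_cast
    rfl
  rw [InnerProductSpace.rankOne_apply, inner_smul_right, map_mul, inner_conj_symm, h3, h3, ← hk,
    phaseFunctional_apply, phaseFunctional_apply, map_mul, map_inv₀, Complex.conj_ofReal]
  ring

theorem isPhaseSpaceObservable_of_isReduction {S : Mode →L[ℂ] Mode} {v : ℕ → Mode}
    (hv : IsDecomposition v S) {P : Set (ℝ × ℝ) → HTensor Mode Mode →L[ℂ] HTensor Mode Mode}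
    {G : Observable (ℝ × ℝ)} (hG : IsReduction v P G)
    (hP : ∀ Z, MeasurableSet Z → ∀ Φ Ψ, ⟪Φ, P Z Ψ⟫_ℂ =
      ∫ w in Z, (starRingEnd ℂ) (phaseTransform Φ w) * phaseTransform Ψ w) :
    IsPhaseSpaceObservable (conjOp S) G := by
  intro Z hZ φ ψ
  let F : ℕ → ℝ × ℝ → ℂ := fun j w =>
    (starRingEnd ℂ) (phaseTransform (htmul φ (v j)) w) * phaseTransform (htmul ψ (v j)) w
  have hF' : ∀ j, Integrable (F j) := fun j =>
    ((Lp.memLp (phaseTransform (htmul φ (v j)))).star).integrable_mul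
      (Lp.memLp (phaseTransform (htmul ψ (v j))))
  have hF : ∀ j, Integrable (F j) (volume.restrict Z) := fun j => (hF' j).restrict
  have hsq : ∀ Φ : HTensor Mode Mode, Integrable (fun w => ‖phaseTransform Φ w‖ ^ 2) ∧
      ∫ w, ‖phaseTransform Φ w‖ ^ 2 = ‖Φ‖ ^ 2 := fun Φ => by
    refine ⟨(memLp_two_iff_integrable_sq_norm (Lp.aestronglyMeasurable _)).1 (Lp.memLp _), ?_⟩
    exact integral_norm_sq_phaseTransform Φ
  have hs : Summable fun j => ∫ w in Z, ‖F j w‖ := by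
    refine Summable.of_nonneg_of_le (fun j => integral_nonneg fun w => norm_nonneg _) (fun j => ?_)
      (hv.summable.mul_left (‖φ‖ ^ 2 + ‖ψ‖ ^ 2))
    calc ∫ w in Z, ‖F j w‖ ≤ ∫ w, ‖F j w‖ :=
          setIntegral_le_integral (hF' j).norm (.of_forall fun w => norm_nonneg _)
      _ ≤ ∫ w, (‖phaseTransform (htmul φ (v j)) w‖ ^ 2 + ‖phaseTransform (htmul ψ (v j)) w‖ ^ 2) := by
          refine integral_mono (hF' j).norm ((hsq _).1.add (hsq _).1) fun w => ?_
          simp only [F, norm_mul, RCLike.norm_conj]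
          nlinarith [sq_nonneg (‖phaseTransform (htmul φ (v j)) w‖ -
            ‖phaseTransform (htmul ψ (v j)) w‖), norm_nonneg (phaseTransform (htmul φ (v j)) w),
            norm_nonneg (phaseTransform (htmul ψ (v j)) w)]
      _ = (‖φ‖ ^ 2 + ‖ψ‖ ^ 2) * ‖v j‖ ^ 2 := by
          rw [integral_add (hsq _).1 (hsq _).1, (hsq _).2, (hsq _).2, norm_htmul, norm_htmul]
          ring
  have hae : ∀ᵐ w ∂(volume.restrict Z), HasSum (fun j => F j w)
      ⟪φ, (((2 * Real.pi)⁻¹ : ℂ) •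
        (weyl w.1 w.2 ∘L conjOp S ∘L adjoint (weyl w.1 w.2))) ψ⟫_ℂ := by
    refine ae_restrict_of_ae ?_
    have h1 := ae_all_iff.2 fun j => coeFn_phaseTransform φ (v j)
    have h2 := ae_all_iff.2 fun j => coeFn_phaseTransform ψ (v j)
    filter_upwards [h1, h2] with w h1 h2
    simp only [F, h1, h2]
    exact hasSum_inner_conjOp hv w φ ψ
  obtain ⟨hint, hsum⟩ := integrable_and_hasSum_integral hF hs hae
  refine ⟨hint, hsum.unique ?_⟩
  have := hG Z hZ φ ψ
  simpa only [hP Z hZ] using this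

theorem IsPhaseSpaceObservable.unique {S : Mode →L[ℂ] Mode} {G G' : Observable (ℝ × ℝ)}
    (hG : IsPhaseSpaceObservable S G) (hG' : IsPhaseSpaceObservable S G') : G = G' :=
  Observable.ext_of_effect fun Z hZ => by
    ext1 ψ
    refine ext_inner_left ℂ fun φ => ?_
    rw [← (hG Z hZ φ ψ).2, ← (hG' Z hZ φ ψ).2]

theorem IsSmearing.unique {ν : Measure (ℝ × ℝ)} {G M M' : Observable (ℝ × ℝ)}
    (hM : IsSmearing ν G M) (hM' : IsSmearing ν G M') : M = M' :=
  Observable.ext_of_law fun φ => Measure.ext fun Z hZ => by rw [hM φ Z hZ, hM' φ Z hZ]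

/-- Existence of the covariant phase space observable. -/
theorem exists_phaseSpaceObservable {S : Mode →L[ℂ] Mode} {v : ℕ → Mode}
    (hv : IsDecomposition v S) (hv1 : HasSum (fun j => ‖v j‖ ^ 2) 1) :
    ∃ G, IsPhaseSpaceObservable (conjOp S) G ∧ ∀ φ, G.law φ = reducedLaw phaseLaw v φ := by
  obtain ⟨P, hP, hP'⟩ := exists_isPOVM_conv (Measure.dirac (0 : ℝ × ℝ))
  obtain ⟨G, hG⟩ := hP.exists_observable hv1
  refine ⟨G, isPhaseSpaceObservable_of_isReduction hv hG fun Z hZ Φ Ψ => ?_, fun φ => ?_⟩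
  · rw [hP' Z hZ, ← integral_indicator hZ]
    refine integral_congr_ae (.of_forall fun w => ?_)
    have hm : MeasurableSet {u | u + w ∈ Z} := measurable_add_const w hZ
    by_cases hw : w ∈ Z <;> simp [Measure.dirac_apply' _ hm, hw]
  · rw [hG.law_apply hP hv1]
    simp only [Measure.dirac_zero_conv]

/-- Existence of the smeared phase space observable. -/
theorem exists_smearing {v : ℕ → Mode} (hv1 : HasSum (fun j => ‖v j‖ ^ 2) 1)
    {G : Observable (ℝ × ℝ)} (hG : ∀ φ, G.law φ = reducedLaw phaseLaw v φ) :
    ∃ P M, IsPOVM P (fun Φ => μ.conv (phaseLaw Φ)) ∧ IsReduction v P M ∧ IsSmearing μ G M := by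
  obtain ⟨P, hP, -⟩ := exists_isPOVM_conv μ
  obtain ⟨M, hM⟩ := hP.exists_observable hv1
  refine ⟨P, M, hP, hM, fun φ Z hZ => ?_⟩
  rw [hM.law_apply hP hv1, hG, reducedLaw, reducedLaw, Measure.sum_apply _ hZ,
    lintegral_sum_measure]
  exact tsum_congr fun j => conv_apply_eq μ _ hZ

/-- The characteristic function of the smeared measure. -/
theorem exists_charOp_conv (s t : ℝ) : ∃ B : HTensor Mode Mode →L[ℂ] HTensor Mode Mode,
    (∀ Φ, ∫ w, Complex.exp (Complex.I * (s * w.1 + t * w.2)) ∂(μ.conv (phaseLaw Φ)) = ⟪Φ, B Φ⟫_ℂ) ∧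
    ∀ α' β' α β, ⟪htmul (expVec α') (expVec β'), B (htmul (expVec α) (expVec β))⟫_ℂ =
      (∫ w, Complex.exp (Complex.I * (s * w.1 + t * w.2)) ∂μ) *
        ⟪phaseGauss 0 0 α' β', phaseGauss s t α β⟫_ℂ := by
  obtain ⟨B, hB⟩ := exists_phaseOp (fun w => Complex.exp (Complex.I * (s * w.1 + t * w.2)))
    (Continuous.measurable (by fun_prop)) fun w => by simp [Complex.norm_exp]
  -- The characteristic function of a convolution is a product, so smearing multiplies the operator
  -- by a scalar.
  refine ⟨(∫ w, Complex.exp (Complex.I * (s * w.1 + t * w.2)) ∂μ) • B, fun Φ => ?_,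
    fun α' β' α β => ?_⟩
  · rw [_root_.smul_apply, inner_smul_right, hB, ← integral_phaseLaw, Measure.conv,
      integral_map measurable_add.aemeasurable (Continuous.aestronglyMeasurable (by fun_prop)),
      ← integral_prod_mul]
    refine integral_congr_ae (.of_forall fun w => ?_)
    simp only [← Complex.exp_add, Prod.fst_add, Prod.snd_add, Complex.ofReal_add]
    congr 1
    ring
  · rw [_root_.smul_apply, inner_smul_right, hB, L2.inner_def]
    congr 1
    refine integral_congr_ae ?_
    rw [phaseTransform_expVec, phaseTransform_expVec]
    filter_upwards [coeFn_phaseGauss s t α β, coeFn_phaseGauss 0 0 α β] with w h1 h2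
    rw [h1, h2, RCLike.inner_apply]
    simp
    ring

end Covariant

/-! ## The high amplitude limit -/

section Limit

open ContinuousLinearMap

variable {r : ℕ → ℝ}

/-- Second order Taylor expansion as an exact identity with a convergent coefficient, so that later
limits need only algebra. -/
theorem tendsto_exp_remainder (hr : ∀ k, 0 < r k) (hr' : Tendsto r atTop atTop) (x : ℂ) :
    ∃ e : ℕ → ℂ, Tendsto e atTop (𝓝 (x ^ 2 / 2)) ∧
      ∀ k, Complex.exp (x / r k) - 1 = x / r k + e k / (r k : ℂ) ^ 2 := by
  refine ⟨fun k => (r k : ℂ) ^ 2 * (Complex.exp (x / r k) - 1 - x / r k), ?_, fun k => ?_⟩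
  · rw [tendsto_iff_norm_sub_tendsto_zero]
    have hlim : Tendsto (fun k => ‖x‖ ^ 3 * (r k)⁻¹) atTop (𝓝 0) := by
      simpa using (tendsto_inv_atTop_zero.comp hr').const_mul (‖x‖ ^ 3)
    refine squeeze_zero' (.of_forall fun k => norm_nonneg _) ?_ hlim
    filter_upwards [hr'.eventually_ge_atTop ‖x‖] with k hk
    have h0 := hr k
    have h0' : (r k : ℂ) ≠ 0 := by exact_mod_cast h0.ne'
    have hn : ‖x / r k‖ = ‖x‖ / r k := by
      rw [norm_div, Complex.norm_real, Real.norm_of_nonneg h0.le]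
    have h1 : ‖x / r k‖ ≤ 1 := by rw [hn]; exact (div_le_one h0).2 hk
    have h2 := Complex.exp_bound h1 (n := 3) (by norm_num)
    have h3 : (r k : ℂ) ^ 2 * (Complex.exp (x / r k) - 1 - x / r k) - x ^ 2 / 2 = (r k : ℂ) ^ 2 *
        (Complex.exp (x / r k) - ∑ m ∈ Finset.range 3, (x / r k) ^ m / m.factorial) := by
      simp only [Finset.sum_range_succ, Finset.sum_range_zero, Nat.factorial]
      push_cast
      field_simp
      ring
    rw [h3, norm_mul, norm_pow, Complex.norm_real, Real.norm_of_nonneg h0.le]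
    calc r k ^ 2 * _ ≤ r k ^ 2 * ((‖x‖ / r k) ^ 3 * 1) := by
          rw [hn] at h2
          refine mul_le_mul_of_nonneg_left (h2.trans ?_) (by positivity)
          refine mul_le_mul_of_nonneg_left ?_ (by positivity)
          norm_num [Nat.factorial]
      _ = ‖x‖ ^ 3 * (r k)⁻¹ := by field_simp
  · have h0' : (r k : ℂ) ≠ 0 := by exact_mod_cast (hr k).ne'
    field_simp
    ring

/-- The first order terms of the exponentials carry opposite signs, so their contributions of order
`r` cancel and leave exactly `i s (p + q)`. The second order terms are of size `1 / r²` against a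
factor `r² / 2`, which gives `-s² / (4a)` and `-s² / (4b)`. -/
theorem tendsto_pair_exponent (hr : ∀ k, 0 < r k) (hr' : Tendsto r atTop atTop) {a b : ℝ}
    (ha : 0 < a) (hb : 0 < b) (s : ℝ) (p q : ℂ) :
    Tendsto (fun k => a * (Complex.exp (-(Complex.I * s / (r k * a))) - 1) *
        ((p - r k) * (q - r k) / 2) +
      b * (Complex.exp (Complex.I * s / (r k * b)) - 1) * ((p + r k) * (q + r k) / 2)) atTop
      (𝓝 (Complex.I * s * (p + q) - (s : ℂ) ^ 2 / 4 * ((a : ℂ)⁻¹ + (b : ℂ)⁻¹))) := by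
  have ha' : (a : ℂ) ≠ 0 := by exact_mod_cast ha.ne'
  have hb' : (b : ℂ) ≠ 0 := by exact_mod_cast hb.ne'
  obtain ⟨e, he, hek⟩ := tendsto_exp_remainder hr hr' (-(Complex.I * s / a))
  obtain ⟨f, hf, hfk⟩ := tendsto_exp_remainder hr hr' (Complex.I * s / b)
  have hinv : Tendsto (fun k => ((r k : ℂ))⁻¹) atTop (𝓝 0) := by
    have h := (Complex.continuous_ofReal.tendsto 0).comp (tendsto_inv_atTop_zero.comp hr')
    simpa [Function.comp_def] using h
  have hlim := ((((hinv.const_mul p).sub_const 1).mul ((hinv.const_mul q).sub_const 1)).mul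
      ((he.const_mul (a : ℂ)).div_const 2)).add
    ((((hinv.const_mul p).add_const 1).mul ((hinv.const_mul q).add_const 1)).mul
      ((hf.const_mul (b : ℂ)).div_const 2)) |>.const_add (Complex.I * s * (p + q))
  have hval : Complex.I * s * (p + q) + ((p * 0 - 1) * (q * 0 - 1) *
      (a * ((-(Complex.I * s / a)) ^ 2 / 2) / 2) + (p * 0 + 1) * (q * 0 + 1) *
      (b * ((Complex.I * s / b) ^ 2 / 2) / 2)) =
      Complex.I * s * (p + q) - (s : ℂ) ^ 2 / 4 * ((a : ℂ)⁻¹ + (b : ℂ)⁻¹) := by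
    field_simp
    linear_combination (4 * (s : ℂ) ^ 2 * (b + a)) * Complex.I_sq
  rw [hval] at hlim
  refine hlim.congr fun k => ?_
  have h0 : (r k : ℂ) ≠ 0 := by exact_mod_cast (hr k).ne'
  have e1 : -(Complex.I * s / (r k * a)) = -(Complex.I * s / a) / r k := by field_simp
  have e2 : Complex.I * s / (r k * b) = Complex.I * s / b / r k := by field_simp
  rw [e1, e2, hek, hfk]
  field_simp
  ring

/-- The phase `π / 2` makes the second oscillator amplitude `i r`, so the two pairs measure
conjugate quadratures. Each oscillator contributes `exp(-r² / 2)` from its normalization. -/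
theorem homodyneIsometry_expVec (r : ℝ) (α β : ℂ) :
    homodyneIsometry r (r * Complex.exp (Complex.I * (Real.pi / 2 : ℝ)))
        (htmul (expVec α) (expVec β)) =
      Complex.exp (-(r : ℂ) ^ 2) •
        htmul (htmul (expVec (((α - β) / Real.sqrt 2 - r) / Real.sqrt 2))
            (expVec (((α - β) / Real.sqrt 2 + r) / Real.sqrt 2)))
          (htmul (expVec (((α + β) / Real.sqrt 2 - r * Complex.I) / Real.sqrt 2))
            (expVec (((α + β) / Real.sqrt 2 + r * Complex.I) / Real.sqrt 2))) := by
  have hI : Complex.exp (Complex.I * (Real.pi / 2 : ℝ)) = Complex.I := by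
    rw [mul_comm]
    push_cast
    exact Complex.exp_pi_div_two_mul_I
  rw [hI, homodyneIsometry, comp_apply, comp_apply, splitter_apply, beamSplitter_expVec,
    adjoinOscillators, opTensor_htmul, tensorRight_apply, tensorRight_apply, opTensor_htmul,
    coherentState_eq_smul, coherentState_eq_smul, htmul_smul_right, htmul_smul_right, map_smul,
    map_smul, splitter_apply, splitter_apply, beamSplitter_expVec, beamSplitter_expVec,
    htmul_smul_left, htmul_smul_right, smul_smul, ← Complex.exp_add]
  congr 2
  simp only [map_mul, Complex.conj_ofReal, Complex.conj_I]
  linear_combination (r : ℂ) ^ 2 / 2 * Complex.I_sq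

variable {ε₁ ε₂ ε₃ ε₄ : ℝ}

/-- Splitting each factor as `1 + ε (u - 1)`, the parts `1` give `γ' γ + δ' δ + 2 r²`, whose
divergent term is cancelled by the two normalizing factors `exp(-r²)`. The rest is the exponent of
`tendsto_pair_exponent`, once for each pair. -/
theorem tendsto_inner_expVec (h₁ : 0 < ε₁) (h₂ : 0 < ε₂) (h₃ : 0 < ε₃) (h₄ : 0 < ε₄)
    (hr : ∀ k, 0 < r k) (hr' : Tendsto r atTop atTop) (s t : ℝ) {D : ℕ → FourMode →L[ℂ] FourMode}
    (hD : ∀ k z₁ z₂ z₃ z₄,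
      D k (htmul (htmul (expVec z₁) (expVec z₃)) (htmul (expVec z₂) (expVec z₄))) =
      htmul (htmul (expVec ((1 - ε₁ + ε₁ * Complex.exp (-(Complex.I * s / (r k * ε₁)))) * z₁))
          (expVec ((1 - ε₃ + ε₃ * Complex.exp (Complex.I * s / (r k * ε₃))) * z₃)))
        (htmul (expVec ((1 - ε₂ + ε₂ * Complex.exp (-(Complex.I * t / (r k * ε₂)))) * z₂))
          (expVec ((1 - ε₄ + ε₄ * Complex.exp (Complex.I * t / (r k * ε₄))) * z₄))))
    (α' β' α β : ℂ) :
    Tendsto (fun k =>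
      ⟪homodyneIsometry (r k) (r k * Complex.exp (Complex.I * (Real.pi / 2 : ℝ)))
        (htmul (expVec α') (expVec β')),
      D k (homodyneIsometry (r k) (r k * Complex.exp (Complex.I * (Real.pi / 2 : ℝ)))
        (htmul (expVec α) (expVec β)))⟫_ℂ) atTop
      (𝓝 (Complex.exp (-(s : ℂ) ^ 2 / 4 * ((ε₁ : ℂ)⁻¹ + (ε₃ : ℂ)⁻¹ - 2) -
        (t : ℂ) ^ 2 / 4 * ((ε₂ : ℂ)⁻¹ + (ε₄ : ℂ)⁻¹ - 2)) *
          ⟪phaseGauss 0 0 α' β', phaseGauss s t α β⟫_ℂ)) := by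
  have hs := sqrt_two_sq
  have h0 : (Real.sqrt 2 : ℂ) ≠ 0 := fun h0 => by simp [h0] at hs
  let γ : ℂ := (α - β) / Real.sqrt 2
  let δ : ℂ := (α + β) / Real.sqrt 2
  let γ' : ℂ := ((starRingEnd ℂ) α' - (starRingEnd ℂ) β') / Real.sqrt 2
  let δ' : ℂ := ((starRingEnd ℂ) α' + (starRingEnd ℂ) β') / Real.sqrt 2
  -- For the oscillator `i r` the phase is absorbed into the amplitudes: `(iδ' ∓ r)(-iδ ∓ r) = (δ' ±
  -- i r)(δ ∓ i r)`.
  have hlim := ((tendsto_pair_exponent hr hr' h₁ h₃ s γ' γ).add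
    (tendsto_pair_exponent hr hr' h₂ h₄ t (Complex.I * δ') (-(Complex.I * δ)))).const_add
      (γ' * γ + δ' * δ)
  have hlim2 := (Complex.continuous_exp.tendsto _).comp hlim
  -- The terms `-2` account for the Gaussian `exp(-(s² + t²) / 2)` already present in the phase
  -- space law.
  have hgoal : Complex.exp (-(s : ℂ) ^ 2 / 4 * ((ε₁ : ℂ)⁻¹ + (ε₃ : ℂ)⁻¹ - 2) -
        (t : ℂ) ^ 2 / 4 * ((ε₂ : ℂ)⁻¹ + (ε₄ : ℂ)⁻¹ - 2)) *
          ⟪phaseGauss 0 0 α' β', phaseGauss s t α β⟫_ℂ = Complex.exp (γ' * γ + δ' * δ +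
      (Complex.I * s * (γ' + γ) - (s : ℂ) ^ 2 / 4 * ((ε₁ : ℂ)⁻¹ + (ε₃ : ℂ)⁻¹) +
      (Complex.I * t * (Complex.I * δ' + -(Complex.I * δ)) -
        (t : ℂ) ^ 2 / 4 * ((ε₂ : ℂ)⁻¹ + (ε₄ : ℂ)⁻¹)))) := by
    rw [inner_phaseGauss, ← Complex.exp_add, ← Complex.exp_add]
    congr 1
    simp only [γ, γ', δ, δ']
    have h6 : ∀ a : ℂ, a / Real.sqrt 2 = a * Real.sqrt 2 / 2 := fun a => by
      rw [div_eq_div_iff h0 two_ne_zero, ← hs]; ring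
    simp only [h6]
    linear_combination -((starRingEnd ℂ) α' * α + (starRingEnd ℂ) β' * β) / 2 * hs -
      (t * (Real.sqrt 2 : ℂ) / 2 * ((starRingEnd ℂ) α' + (starRingEnd ℂ) β' - α - β)) *
        Complex.I_sq
  rw [hgoal]
  refine hlim2.congr fun k => ?_
  rw [homodyneIsometry_expVec, homodyneIsometry_expVec, map_smul, inner_smul_left,
    inner_smul_right, hD]
  simp only [inner_htmul, inner_expVec, Function.comp]
  rw [← Complex.exp_conj, ← Complex.exp_add, ← Complex.exp_add, ← Complex.exp_add,
    ← Complex.exp_add, ← Complex.exp_add]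
  congr 1
  simp only [map_neg, map_pow, map_div₀, map_sub, map_add, map_mul, Complex.conj_ofReal,
    Complex.conj_I]
  generalize Complex.exp (-(Complex.I * s / (r k * ε₁))) = u₁
  generalize Complex.exp (Complex.I * s / (r k * ε₃)) = u₃
  generalize Complex.exp (-(Complex.I * t / (r k * ε₂))) = u₂
  generalize Complex.exp (Complex.I * t / (r k * ε₄)) = u₄
  change _ = -(r k : ℂ) ^ 2 + (-(r k : ℂ) ^ 2 +
    ((γ' - r k) / Real.sqrt 2 * ((1 - ε₁ + ε₁ * u₁) * ((γ - r k) / Real.sqrt 2)) +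
      (γ' + r k) / Real.sqrt 2 * ((1 - ε₃ + ε₃ * u₃) * ((γ + r k) / Real.sqrt 2)) +
    ((δ' - r k * -Complex.I) / Real.sqrt 2 *
        ((1 - ε₂ + ε₂ * u₂) * ((δ - r k * Complex.I) / Real.sqrt 2)) +
      (δ' + r k * -Complex.I) / Real.sqrt 2 *
        ((1 - ε₄ + ε₄ * u₄) * ((δ + r k * Complex.I) / Real.sqrt 2)))))
  generalize γ = g, γ' = g', δ = d, δ' = d'
  have h7 : ∀ a b c : ℂ, a / Real.sqrt 2 * (c * (b / Real.sqrt 2)) = c * (a * b / 2) :=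
    fun a b c => by
      rw [← hs]; field_simp
  simp only [h7]
  linear_combination ((r k : ℂ) ^ 2 - (ε₂ * (u₂ - 1) + ε₄ * (u₄ - 1)) * (d' * d - (r k : ℂ) ^ 2) / 2) *
    Complex.I_sq

theorem norm_le_one_of_norm_eq {K L : Type*} [NormedAddCommGroup K] [InnerProductSpace ℂ K]
    [NormedAddCommGroup L] [InnerProductSpace ℂ L] {W : K →L[ℂ] L} (hW : ∀ Φ, ‖W Φ‖ = ‖Φ‖) :
    ‖W‖ ≤ 1 :=
  W.opNorm_le_bound zero_le_one fun Φ => by rw [hW, one_mul]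

/-- The outcome measures of the detector converge to the smeared phase space measure. -/
theorem tendsto_outLaw (h₁ : 0 < ε₁ ∧ ε₁ ≤ 1) (h₂ : 0 < ε₂ ∧ ε₂ ≤ 1) (h₃ : 0 < ε₃ ∧ ε₃ ≤ 1)
    (h₄ : 0 < ε₄ ∧ ε₄ ≤ 1) (hr : ∀ k, 0 < r k) (hr' : Tendsto r atTop atTop)
    (Φ : HTensor Mode Mode) {Z : Set (ℝ × ℝ)}
    (hZ : ((phaseSpaceSmearing ε₁ ε₂ ε₃ ε₄).conv (phaseLaw Φ)) (frontier Z) = 0) :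
    Tendsto (fun k => (outLaw ε₁ ε₂ ε₃ ε₄ ‖(r k : ℂ)‖
        (homodyneIsometry (r k) (r k * Complex.exp (Complex.I * (Real.pi / 2 : ℝ))) Φ) Z).toReal)
      atTop (𝓝 (((phaseSpaceSmearing ε₁ ε₂ ε₃ ε₄).conv (phaseLaw Φ)) Z).toReal) := by
  have := isProbabilityMeasure_phaseSpaceSmearing h₁ h₂ h₃ h₄
  have hnorm : ∀ k, ‖(r k : ℂ)‖ = r k := fun k => by
    rw [Complex.norm_real, Real.norm_of_nonneg (hr k).le]
  simp only [hnorm]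
  refine tendsto_measure_of_tendsto_char (fun k => ?_) (fun s t => ?_) hZ
  · obtain ⟨P, hP, -⟩ := exists_isPOVM_conv (phaseSpaceSmearing ε₁ ε₂ ε₃ ε₄)
    rw [outLaw_univ h₁ h₂ h₃ h₄, norm_homodyneIsometry, hP.total]
  · let W : ℕ → HTensor Mode Mode →L[ℂ] FourMode := fun k =>
      homodyneIsometry (r k) (r k * Complex.exp (Complex.I * (Real.pi / 2 : ℝ)))
    choose D hD1 hD2 hD3 using fun k => exists_charOp h₁ h₂ h₃ h₄ (r k) s t
    obtain ⟨B, hB1, hB2⟩ := exists_charOp_conv (phaseSpaceSmearing ε₁ ε₂ ε₃ ε₄) s t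
    have hW : ∀ k, ‖W k‖ ≤ 1 := fun k => norm_le_one_of_norm_eq (norm_homodyneIsometry _ _)
    -- Isometries and contractions give the uniform bound `1`, so exponential vectors suffice for
    -- all `Φ`.
    have key := isTotal_expVec_htmul.tendsto_inner (B := fun k => adjoint (W k) ∘L D k ∘L W k)
      (A := B) (C := 1) (fun k => by
        refine (opNorm_comp_le _ _).trans (mul_le_one₀ ?_ (norm_nonneg _)
          ((opNorm_comp_le _ _).trans (mul_le_one₀ (hD1 k) (norm_nonneg _) (hW k))))
        rw [LinearIsometryEquiv.norm_map]
        exact hW k) (fun i j => by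
        rw [hB2, integral_phaseSpaceSmearing h₁ h₂ h₃ h₄]
        simp only [comp_apply, adjoint_inner_right]
        exact tendsto_inner_expVec h₁.1 h₂.1 h₃.1 h₄.1 hr hr' s t hD3 i.1 i.2 j.1 j.2) Φ Φ
    simp only [comp_apply, adjoint_inner_right] at key
    simp only [hB1, hD2]
    exact key

end Limit

end Homodyne

end

/-! ### Assembly of the proposition -/

open Homodyne in
theorem mainTheorem2 (ε₁ ε₂ ε₃ ε₄ : ℝ)
    (hε₁ : 0 < ε₁ ∧ ε₁ ≤ 1) (hε₂ : 0 < ε₂ ∧ ε₂ ≤ 1)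
    (hε₃ : 0 < ε₃ ∧ ε₃ ≤ 1) (hε₄ : 0 < ε₄ ∧ ε₄ ≤ 1)
    (S : Mode →L[ℂ] Mode) (hS : IsState S)
    (r : ℕ → ℝ) (hr : ∀ k, 0 < r k) (hr' : Tendsto r atTop atTop) :
    (∀ k, ∃! E, IsSignalObservable ε₁ ε₂ ε₃ ε₄ S (r k) (Real.pi / 2) E) ∧
    (∃! G, IsPhaseSpaceObservable (conjOp S) G) ∧
    (∀ G, IsPhaseSpaceObservable (conjOp S) G →
      ∃! M, IsSmearing (phaseSpaceSmearing ε₁ ε₂ ε₃ ε₄) G M) ∧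
    ∀ (E : ℕ → Observable (ℝ × ℝ)) (G M : Observable (ℝ × ℝ)),
      (∀ k, IsSignalObservable ε₁ ε₂ ε₃ ε₄ S (r k) (Real.pi / 2) (E k)) →
      IsPhaseSpaceObservable (conjOp S) G →
      IsSmearing (phaseSpaceSmearing ε₁ ε₂ ε₃ ε₄) G M →
      Observable.TendstoWeaklyInProbability E M := by
  obtain ⟨v, hv, hv1⟩ := hS.exists_decomposition numberBasis
  have := isProbabilityMeasure_phaseSpaceSmearing hε₁ hε₂ hε₃ hε₄
  choose P F hP hF hFs using fun k =>
    exists_signalObservable hε₁ hε₂ hε₃ hε₄ hv hv1 (r k) (Real.pi / 2)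
  obtain ⟨G₀, hG₀, hlaw⟩ := exists_phaseSpaceObservable hv hv1
  obtain ⟨Q, M₀, hQ, hM₀, hsm⟩ := exists_smearing (phaseSpaceSmearing ε₁ ε₂ ε₃ ε₄) hv1 hlaw
  refine ⟨fun k => ⟨F k, hFs k, fun E hE => hE.unique (hFs k)⟩,
    ⟨G₀, hG₀, fun G hG => hG.unique hG₀⟩, fun G hG => ?_, fun E G M hE hG hM => ?_⟩
  · rw [hG.unique hG₀]
    exact ⟨M₀, hsm, fun M hM => hM.unique hsm⟩
  -- By uniqueness the given observables are the constructed ones, which share the same vectors `v`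
  -- in their reductions.
  · rw [hG.unique hG₀] at hM
    rw [hM.unique hsm, funext fun k => (hE k).unique (hFs k)]
    exact tendstoWeaklyInProbability_of_measure hv1 hP hQ hF hM₀ fun Φ Z _ hZ =>
      tendsto_outLaw hε₁ hε₂ hε₃ hε₄ hr hr' Φ hZ
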